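/- Let $\mathbf k$ be a commutative $\mathbb Q$-algebra and $S$ a set. **Lie algebras.** $\mathfrak t_n$ is the Lie algebra over $\mathbf k$ with generators $t_{ij}$ ($i\ne j\in[n]=\{1,\dots,n\}$) and relations $t_{ji}=t_{ij}$, $[t_{ij},t_{ik}+t_{jk}]=0$, $[t_{ij},t_{kl}]=0$ ($i,j,k,l$ distinct), and $\mathfrak p_n$ is its quotient by the relations $\sum_{j\ne i}t_{ij}=0$ ($i\in[n]$); $\exp(\hat{\mathfrak t}_n)$, $\exp(\hat{\mathfrak p}_n)$ are the prounipotent groups of their degree completions, on which $S_n$ acts by permuting indices. For disjoint $I_1,\dots,I_n\subset[m]$, let $x\mapsto x^{I_1,\dots,I_n}$ be the morphism $\mathfrak t_n\to\mathfrak t_m$, $t_{ij}\mapsto\sum_{\alpha\in I_i,\beta\in I_j}t_{\alpha\beta}$. An associator is a pair $(\mu,\Phi)$, $\mu\in\mathbf k$, $\Phi=\Phi(A,B)\in\exp(\hat{\mathfrak f}_2)$ ($\mathfrak f_2$ the free Lie algebra on $A,B$), such that $\Phi(B,A)=\Phi(A,B)^{-1}$, in $\exp(\hat{\mathfrak t}_3)$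 $$e^{\mu(t_{13}+t_{23})/2}=\Phi(t_{13},t_{12})\,e^{\mu t_{13}/2}\,\Phi(t_{13},t_{23})^{-1}\,e^{\mu t_{23}/2}\,\Phi(t_{12},t_{23}),$$ and in $\exp(\hat{\mathfrak t}_4)$ $$\Phi(t_{12},t_{23}+t_{24})\,\Phi(t_{13}+t_{23},t_{34})=\Phi(t_{23},t_{34})\,\Phi(t_{12}+t_{13},t_{24}+t_{34})\,\Phi(t_{12},t_{23}).$$ **The category $\mathbf{PaCD}^\Phi_S$.** Objects: parenthesized words in $S$, i.e. planar binary rooted trees with leaves labelled by $S$, together with the empty word. The morphisms from $X$ to $Y$, with sequences of letters $\underline s$, $\underline s'$, form the set $\exp(\hat{\mathfrak t}_n)\rtimes\{f\in S_n\mid \underline s'f=\underline s\}$ if both words have length $n$, and the empty set if the lengths differ; composition is the product. The tensor product is concatenation on objects, and on morphisms it is induced by $\mathfrak t_n\times\mathfrak t_{n'}\to\mathfrak t_{n+n'}$, $(t_{ij},0)\mapsto t_{ij}$, $(0,t_{ij})\mapsto t_{n+i,n+j}$, and $S_n\times S_{n'}\to S_{n+n'}$. For $|X|=n$, $|Y|=n'$,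 $|Z|=n''$ the braiding is $\beta_{XY}=s_{n,n'}(e^{\mu t_{12}/2})^{[n],\,n+[n']}$, where $s_{n,n'}(i)=n'+i$ for $i\le n$ and $s_{n,n'}(n+i)=i$ for $i\le n'$, and the associativity constraint is $a_{XYZ}=\Phi(t_{12},t_{23})^{[n],\,n+[n'],\,n+n'+[n'']}$. This is a braided monoidal category. **Half-balanced structures and contractions.** A half-balanced structure on a braided monoidal category $\mathcal C$ consists of an involutive endofunctor $*$ with $(X\otimes Y)^*=Y^*\otimes X^*$, $(f\otimes g)^*=g^*\otimes f^*$, and of natural isomorphisms $a_X:X\to X^*$ ($a_Y\varphi=\varphi^*a_X$ for $\varphi:X\to Y$), such that $(a_X)^*=a_{X^*}$, $(\beta_{XY})^*=\beta_{Y^*X^*}$, $(a_{XYZ})^*=(a_{Z^*Y^*X^*})^{-1}$ and $a_{X\otimes Y}=(a_Y\otimes a_X)\beta_{XY}$. Set $\theta_X=a_{X^*}a_X$. A half-balanced contraction of $\mathcal C$ is a functor $\langle-\rangle:\mathcal C\to\mathcal O$ such that, for all $X,Y,Z$: $\langle X\otimes Y\rangle=\langle Y\otimes X\rangle$ and $\langle(\theta_Y\otimes\mathrm{id}_X)\beta_{XY}\rangle=\mathrm{id}$;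 $\langle(X\otimes Y)\otimes Z\rangle=\langle X\otimes(Y\otimes Z)\rangle$ and $\langle a_{XYZ}\rangle=\mathrm{id}$; $\langle X\rangle=\langle X^*\rangle$ and $\langle a_X\rangle=\mathrm{id}$. On $\mathbf{PaCD}^\Phi_S$ let $*$ send a word to its mirror image and conjugate morphisms by the order-reversing permutations. Let $a_X:X\to X^*$ be the half-twist: $a_X=\mathrm{id}$ if $X$ is empty or a single letter, and $a_{X\otimes Y}=(a_Y\otimes a_X)\beta_{XY}$. **The category $\mathbf{PaDih}^{gr}_S$.** Let $PlT_n$ be the set of planar 3-valent trees with a bijection from the set of leaves to $[n]$ compatible with the cyclic orders (equivalently, rooted planar binary trees up to moving the root to another edge). Let $\widetilde{\mathbf{PaDih}}{}^{gr}_S$ have objects $\bigsqcup_{n\ge0}PlT_n\times S^n$, with morphisms $(t,\underline s)\to(t',\underline s')$ forming the set $\exp(\hat{\mathfrak p}_n)\rtimes\{f\in S_n\mid\underline s'f=\underline s\}$ (the empty set if the lengths differ). The infinite dihedral group $D=\langle r,s\mid s^2=(rs)^2=1\rangle$ maps to $S_n$ by $r\mapsto(i\mapsto i+1\bmod n)$,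 $s\mapsto(i\mapsto n+1-i)$. It acts on objects by permuting the numbers of the leaves and the entries of $\underline s$, reflections also replacing the tree by its mirror image; for $g\in D$, let $i^g_X:X\to gX$ be the image of $g$ in $S_n\subset\exp(\hat{\mathfrak p}_n)\rtimes S_n$. Then $\mathbf{PaDih}^{gr}_S$ is the quotient category $\widetilde{\mathbf{PaDih}}{}^{gr}_S/D$: its objects are the $D$-orbits of objects, and it is universal for functors $F$ on $\widetilde{\mathbf{PaDih}}{}^{gr}_S$ with $F(gX)=F(X)$ and $F(i^g_X)=\mathrm{id}_{F(X)}$. Let $\mathbf{PaCD}^\Phi_S\to\mathbf{PaDih}^{gr}_S$ be the composite of the quotient functor with the functor $\mathbf{PaCD}^\Phi_S\to\widetilde{\mathbf{PaDih}}{}^{gr}_S$ which numbers the leaves of a tree from left to right and forgets its root, and which is induced on morphisms by the projections $\mathfrak t_n\to\mathfrak p_n$. **Proposition.** For every associator $(\mu,\Phi)$ over $\mathbf k$ and every set $S$, the pair $(*,(a_X)_X)$ is a half-balanced structure on $\mathbf{PaCD}^\Phi_S$, and the functor $\mathbf{PaCD}^\Phi_S\to\mathbf{PaDih}^{gr}_S$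 is a half-balanced contraction. -/

import Mathlib

universe u v w u₁ v₁

noncomputable section

open CategoryTheory MonoidalCategory

set_option linter.unusedSectionVars false

attribute [local instance 100] LieRing.ofAssociativeRing

/-! ## Prounipotent groups of exponentials -/

/-- The augmentation of the enveloping algebra of a Lie algebra. -/
def augmentation (k : Type u) [CommRing k] (L : Type v) [LieRing L] [LieAlgebra k L] :
    UniversalEnvelopingAlgebra k L →ₐ[k] k :=
  UniversalEnvelopingAlgebra.lift k (0 : L →ₗ⁅k⁆ k)

/-- The augmentation ideal of the enveloping algebra, i.e. the two-sided ideal generated by `L`. -/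
abbrev augIdeal (k : Type u) [CommRing k] (L : Type v) [LieRing L] [LieAlgebra k L] :
    Ideal (UniversalEnvelopingAlgebra k L) :=
  RingHom.ker (augmentation k L)

/-- The truncated enveloping algebra `U(L) / I ^ N`. -/
def TruncEnv (k : Type u) [CommRing k] (L : Type v) [LieRing L] [LieAlgebra k L] (N : ℕ) :
    Type (max u v) :=
  UniversalEnvelopingAlgebra k L ⧸ (augIdeal k L) ^ N

section ExpGroup

variable {k : Type u} [CommRing k] [Algebra ℚ k]
variable {L : Type v} [LieRing L] [LieAlgebra k L]
variable {L' : Type w} [LieRing L'] [LieAlgebra k L']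

instance (N : ℕ) : Ring (TruncEnv k L N) :=
  inferInstanceAs (Ring (UniversalEnvelopingAlgebra k L ⧸ (augIdeal k L) ^ N))

instance (N : ℕ) : Algebra k (TruncEnv k L N) :=
  inferInstanceAs (Algebra k (UniversalEnvelopingAlgebra k L ⧸ (augIdeal k L) ^ N))

instance (N : ℕ) : Algebra ℚ (TruncEnv k L N) :=
  ((algebraMap k (TruncEnv k L N)).comp (algebraMap ℚ k)).toAlgebra'
    fun c x => Algebra.commutes (algebraMap ℚ k c) x

namespace TruncEnv

/-- The quotient map from the enveloping algebra to its truncation. -/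
def mk (N : ℕ) : UniversalEnvelopingAlgebra k L →+* TruncEnv k L N :=
  Ideal.Quotient.mk ((augIdeal k L) ^ N)

/-- The image of an element of `L` in the truncated enveloping algebra. -/
def ι (N : ℕ) (x : L) : TruncEnv k L N := mk N (UniversalEnvelopingAlgebra.ι k x)

lemma mk_surjective (N : ℕ) : Function.Surjective (mk (k := k) (L := L) N) :=
  Ideal.Quotient.mk_surjective

lemma ι_mem_augIdeal (x : L) : UniversalEnvelopingAlgebra.ι k x ∈ augIdeal k L := by
  rw [RingHom.mem_ker]
  exact UniversalEnvelopingAlgebra.lift_ι_apply k (0 : L →ₗ⁅k⁆ k) x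

lemma isNilpotent_ι (N : ℕ) (x : L) : IsNilpotent (ι (k := k) N x) := by
  refine ⟨N, ?_⟩
  rw [ι, ← map_pow]
  exact Ideal.Quotient.eq_zero_iff_mem.2 (Ideal.pow_mem_pow (ι_mem_augIdeal x) N)

/-- The algebra morphism of enveloping algebras induced by a Lie algebra morphism. -/
def envMap (f : L →ₗ⁅k⁆ L') : UniversalEnvelopingAlgebra k L →ₐ[k] UniversalEnvelopingAlgebra k L' :=
  UniversalEnvelopingAlgebra.lift k ((UniversalEnvelopingAlgebra.ι k).comp f)

lemma envMap_ι (f : L →ₗ⁅k⁆ L') (x : L) :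
    envMap f (UniversalEnvelopingAlgebra.ι k x) = UniversalEnvelopingAlgebra.ι k (f x) :=
  UniversalEnvelopingAlgebra.lift_ι_apply k _ x

lemma augmentation_envMap (f : L →ₗ⁅k⁆ L') (x : UniversalEnvelopingAlgebra k L) :
    augmentation k L' (envMap f x) = augmentation k L x := by
  have : (augmentation k L').comp (envMap f) = augmentation k L := by
    apply UniversalEnvelopingAlgebra.hom_ext
    refine LieHom.ext fun y => ?_
    change augmentation k L' (envMap f (UniversalEnvelopingAlgebra.ι k y)) =
      augmentation k L (UniversalEnvelopingAlgebra.ι k y)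
    rw [envMap_ι]
    exact (ι_mem_augIdeal (k := k) (f y)).trans (ι_mem_augIdeal (k := k) y).symm
  exact DFunLike.congr_fun this x

lemma envMap_mem (f : L →ₗ⁅k⁆ L') (N : ℕ) (x : UniversalEnvelopingAlgebra k L)
    (hx : x ∈ (augIdeal k L) ^ N) : envMap f x ∈ (augIdeal k L') ^ N := by
  induction N generalizing x with
  | zero => rw [Submodule.pow_zero, Ideal.one_eq_top]; trivial
  | succ N ih =>
    rw [Ideal.IsTwoSided.pow_succ] at hx ⊢
    refine Submodule.smul_induction_on hx (fun a ha b hb => ?_) (fun a b ha hb => ?_)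
    · rw [smul_eq_mul, map_mul]
      refine Ideal.mul_mem_mul ?_ (ih b hb)
      rw [RingHom.mem_ker] at ha ⊢
      exact (augmentation_envMap f a).trans ha
    · rw [map_add]; exact add_mem ha hb

/-- The ring morphism of truncated enveloping algebras induced by a Lie algebra morphism. -/
def map (f : L →ₗ⁅k⁆ L') (N : ℕ) : TruncEnv k L N →+* TruncEnv k L' N :=
  Ideal.Quotient.lift _ ((mk N).comp (envMap f : UniversalEnvelopingAlgebra k L →+* _))
    fun x hx => Ideal.Quotient.eq_zero_iff_mem.2 (envMap_mem f N x hx)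

lemma map_mk (f : L →ₗ⁅k⁆ L') (N : ℕ) (x : UniversalEnvelopingAlgebra k L) :
    map f N (mk N x) = mk N (envMap f x) := rfl

lemma map_ι (f : L →ₗ⁅k⁆ L') (N : ℕ) (x : L) :
    map f N (ι (k := k) N x) = ι N (f x) := by
  rw [ι, map_mk, envMap_ι]; rfl

/-- The transition maps `U(L) / I ^ N → U(L) / I ^ M`, for `M ≤ N`. -/
def trans {M N : ℕ} (h : M ≤ N) : TruncEnv k L N →+* TruncEnv k L M :=
  Ideal.Quotient.lift _ (mk M)
    fun _ hx => Ideal.Quotient.eq_zero_iff_mem.2 (Ideal.pow_le_pow_right h hx)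

lemma trans_mk {M N : ℕ} (h : M ≤ N) (x : UniversalEnvelopingAlgebra k L) :
    trans h (mk N x) = mk M x := rfl

lemma trans_ι {M N : ℕ} (h : M ≤ N) (x : L) : trans h (ι (k := k) N x) = ι M x := rfl

lemma map_trans (f : L →ₗ⁅k⁆ L') {M N : ℕ} (h : M ≤ N) (x : TruncEnv k L N) :
    map f M (trans h x) = trans h (map f N x) := by
  obtain ⟨x, rfl⟩ := mk_surjective N x
  rfl

/-- The action of `TruncEnv.map` on units. -/
def unitsMap (f : L →ₗ⁅k⁆ L') (N : ℕ) : (TruncEnv k L N)ˣ →* (TruncEnv k L' N)ˣ :=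
  Units.map (map f N).toMonoidHom

/-- The action of `TruncEnv.trans` on units. -/
def unitsTrans {M N : ℕ} (h : M ≤ N) : (TruncEnv k L N)ˣ →* (TruncEnv k L M)ˣ :=
  Units.map (trans h).toMonoidHom

/-- The exponential of an element of `L`, as a unit of the truncated enveloping algebra. -/
def expUnit (N : ℕ) (x : L) : (TruncEnv k L N)ˣ where
  val := IsNilpotent.exp (ι N x)
  inv := IsNilpotent.exp (-ι N x)
  val_inv := IsNilpotent.exp_mul_exp_neg_self (isNilpotent_ι N x)
  inv_val := IsNilpotent.exp_neg_mul_exp_self (isNilpotent_ι N x)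

lemma map_expUnit (f : L →ₗ⁅k⁆ L') (N : ℕ) (x : L) :
    unitsMap f N (expUnit N x) = expUnit N (f x) := by
  ext
  change map f N (IsNilpotent.exp (ι N x)) = IsNilpotent.exp (ι N (f x))
  rw [IsNilpotent.map_exp (isNilpotent_ι N x), map_ι]

lemma trans_expUnit {M N : ℕ} (h : M ≤ N) (x : L) :
    unitsTrans h (expUnit (k := k) N x) = expUnit M x := by
  ext
  change trans h (IsNilpotent.exp (ι N x)) = IsNilpotent.exp (ι M x)
  rw [IsNilpotent.map_exp (isNilpotent_ι N x), trans_ι]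

end TruncEnv

variable (k L) in
/-- The group `exp (L̂)` of the completion `L̂ = lim L / (L ∩ I ^ N)` of `L` (for a graded Lie
algebra generated in degree one, this is the degree completion). It is the inverse limit over `N`
of the groups of exponentials of elements of `L` inside the units of `U(L) / I ^ N`; by the
Baker-Campbell-Hausdorff formula the subgroup generated by these exponentials consists of
exponentials only. -/
def expSubgroup : Subgroup (∀ N : ℕ, (TruncEnv k L N)ˣ) where
  carrier := {g | (∀ N, g N ∈ Subgroup.closure (Set.range (TruncEnv.expUnit (k := k) (L := L) N))) ∧
    ∀ (M N : ℕ) (h : M ≤ N), TruncEnv.unitsTrans h (g N) = g M}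
  one_mem' := ⟨fun _ => one_mem _, fun _ _ _ => map_one _⟩
  mul_mem' ha hb := ⟨fun N => mul_mem (ha.1 N) (hb.1 N), fun M N h => by
    rw [Pi.mul_apply, map_mul, ha.2 M N h, hb.2 M N h]; rfl⟩
  inv_mem' ha := ⟨fun N => inv_mem (ha.1 N), fun M N h => by
    rw [Pi.inv_apply, map_inv, ha.2 M N h]; rfl⟩

variable (k L) in
/-- The group `exp (L̂)`. -/
def ExpGroup : Type (max u v) := expSubgroup k L

instance : Group (ExpGroup k L) := inferInstanceAs (Group (expSubgroup k L))

namespace ExpGroup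

/-- The exponential of an element of `L`. -/
def exp (x : L) : ExpGroup k L :=
  ⟨fun N => TruncEnv.expUnit N x,
    fun _ => Subgroup.subset_closure ⟨x, rfl⟩, fun _ _ h => TruncEnv.trans_expUnit h x⟩

lemma ext_val {g h : ExpGroup k L} (e : ∀ N, g.1 N = h.1 N) : g = h :=
  Subtype.ext (funext e)

/-- Functoriality of `L ↦ exp (L̂)`. -/
def map (f : L →ₗ⁅k⁆ L') : ExpGroup k L →* ExpGroup k L' where
  toFun g := ⟨fun N => TruncEnv.unitsMap f N (g.1 N), by
    refine ⟨fun N => ?_, fun M N h => ?_⟩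
    · have := g.2.1 N
      refine Subgroup.closure_induction
        (p := fun x _ => TruncEnv.unitsMap f N x ∈
          Subgroup.closure (Set.range (TruncEnv.expUnit (k := k) (L := L') N))) ?_ ?_ ?_ ?_ this
      · rintro _ ⟨x, rfl⟩
        exact Subgroup.subset_closure ⟨f x, (TruncEnv.map_expUnit f N x).symm⟩
      · rw [map_one]; exact one_mem _
      · intro x y _ _ hx hy; rw [map_mul]; exact mul_mem hx hy
      · intro x _ hx; rw [map_inv]; exact inv_mem hx
    · have e := g.2.2 M N h
      change TruncEnv.unitsTrans h (TruncEnv.unitsMap f N (g.1 N)) = TruncEnv.unitsMap f M (g.1 M)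
      rw [← e]
      ext
      exact (TruncEnv.map_trans f h _).symm⟩
  map_one' := ext_val fun N => map_one (TruncEnv.unitsMap f N)
  map_mul' a b := ext_val fun N =>
    map_mul (TruncEnv.unitsMap f N) (a.1 N) (b.1 N)

lemma map_exp (f : L →ₗ⁅k⁆ L') (x : L) : map f (exp (k := k) x) = exp (f x) :=
  ext_val fun N => TruncEnv.map_expUnit f N x

lemma map_comp {L'' : Type*} [LieRing L''] [LieAlgebra k L''] (f : L →ₗ⁅k⁆ L')
    (g : L' →ₗ⁅k⁆ L'') (x : ExpGroup k L) : map g (map f x) = map (g.comp f) x := by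
  refine ext_val fun N => Units.ext ?_
  change TruncEnv.map g N (TruncEnv.map f N (x.1 N : TruncEnv k L N)) =
    TruncEnv.map (g.comp f) N (x.1 N : TruncEnv k L N)
  obtain ⟨y, hy⟩ := TruncEnv.mk_surjective N (x.1 N : TruncEnv k L N)
  rw [← hy, TruncEnv.map_mk, TruncEnv.map_mk, TruncEnv.map_mk]
  congr 1
  have : (TruncEnv.envMap g).comp (TruncEnv.envMap f) = TruncEnv.envMap (g.comp f) := by
    apply UniversalEnvelopingAlgebra.hom_ext
    refine LieHom.ext fun z => ?_
    change TruncEnv.envMap g (TruncEnv.envMap f (UniversalEnvelopingAlgebra.ι k z)) =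
      TruncEnv.envMap (g.comp f) (UniversalEnvelopingAlgebra.ι k z)
    rw [TruncEnv.envMap_ι, TruncEnv.envMap_ι, TruncEnv.envMap_ι]; rfl
  exact DFunLike.congr_fun this y

lemma map_id (x : ExpGroup k L) : map (LieHom.id : L →ₗ⁅k⁆ L) x = x := by
  refine ext_val fun N => Units.ext ?_
  change TruncEnv.map (LieHom.id : L →ₗ⁅k⁆ L) N (x.1 N : TruncEnv k L N) = x.1 N
  obtain ⟨y, hy⟩ := TruncEnv.mk_surjective N (x.1 N : TruncEnv k L N)
  rw [← hy, TruncEnv.map_mk]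
  congr 1
  have : TruncEnv.envMap (LieHom.id : L →ₗ⁅k⁆ L) = AlgHom.id k _ := by
    apply UniversalEnvelopingAlgebra.hom_ext
    refine LieHom.ext fun z => ?_
    exact TruncEnv.envMap_ι _ z
  exact DFunLike.congr_fun this y

lemma commute_expUnit (N : ℕ) {x y : L} (h : ⁅x, y⁆ = 0) :
    Commute (TruncEnv.ι (k := k) N x) (TruncEnv.ι N y) := by
  have : ⁅UniversalEnvelopingAlgebra.ι k x, UniversalEnvelopingAlgebra.ι k y⁆ = 0 := by
    rw [← LieHom.map_lie, h, map_zero]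
  rw [LieRing.of_associative_ring_bracket, sub_eq_zero] at this
  change TruncEnv.mk N _ * TruncEnv.mk N _ = TruncEnv.mk N _ * TruncEnv.mk N _
  rw [← map_mul, this, map_mul]

/-- Images of two Lie algebra morphisms that commute have commuting groups of exponentials. -/
lemma commute_map {M : Type*} [LieRing M] [LieAlgebra k M] (f : L →ₗ⁅k⁆ M) (g : L' →ₗ⁅k⁆ M)
    (h : ∀ x y, ⁅f x, g y⁆ = 0) (a : ExpGroup k L) (b : ExpGroup k L') :
    map f a * map g b = map g b * map f a := by
  refine ext_val fun N => ?_
  change TruncEnv.unitsMap f N (a.1 N) * TruncEnv.unitsMap g N (b.1 N) =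
    TruncEnv.unitsMap g N (b.1 N) * TruncEnv.unitsMap f N (a.1 N)
  change Commute (TruncEnv.unitsMap f N (a.1 N)) (TruncEnv.unitsMap g N (b.1 N))
  refine Subgroup.closure_induction
    (p := fun u _ => Commute (TruncEnv.unitsMap f N u) (TruncEnv.unitsMap g N (b.1 N)))
    ?_ ?_ ?_ ?_ (a.2.1 N)
  · rintro _ ⟨x, rfl⟩
    refine Subgroup.closure_induction
      (p := fun u _ => Commute (TruncEnv.unitsMap f N (TruncEnv.expUnit N x))
        (TruncEnv.unitsMap g N u)) ?_ ?_ ?_ ?_ (b.2.1 N)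
    · rintro _ ⟨y, rfl⟩
      rw [TruncEnv.map_expUnit, TruncEnv.map_expUnit]
      have hc := commute_expUnit (k := k) N (h x y)
      apply Units.ext
      change IsNilpotent.exp (TruncEnv.ι N (f x)) * IsNilpotent.exp (TruncEnv.ι N (g y)) =
        IsNilpotent.exp (TruncEnv.ι N (g y)) * IsNilpotent.exp (TruncEnv.ι N (f x))
      rw [← IsNilpotent.exp_add_of_commute hc (TruncEnv.isNilpotent_ι N _)
        (TruncEnv.isNilpotent_ι N _), ← IsNilpotent.exp_add_of_commute hc.symm
        (TruncEnv.isNilpotent_ι N _) (TruncEnv.isNilpotent_ι N _), add_comm]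
    · rw [map_one]; exact Commute.one_right _
    · intro u v _ _ hu hv; rw [map_mul]; exact hu.mul_right hv
    · intro u _ hu; rw [map_inv]; exact hu.inv_right
  · rw [map_one]; exact Commute.one_left _
  · intro u v _ _ hu hv; rw [map_mul]; exact hu.mul_left hv
  · intro u _ hu; rw [map_inv]; exact hu.inv_left

lemma exp_zero : exp (k := k) (0 : L) = 1 := by
  refine ext_val fun N => Units.ext ?_
  change IsNilpotent.exp (TruncEnv.mk N (UniversalEnvelopingAlgebra.ι k (0 : L))) = 1
  rw [map_zero, map_zero, IsNilpotent.exp_zero]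

lemma map_zero_hom (x : ExpGroup k L) : map (0 : L →ₗ⁅k⁆ L') x = 1 := by
  refine ext_val fun N => ?_
  change TruncEnv.unitsMap (0 : L →ₗ⁅k⁆ L') N (x.1 N) = 1
  refine Subgroup.closure_induction
    (p := fun u _ => TruncEnv.unitsMap (0 : L →ₗ⁅k⁆ L') N u = 1) ?_ ?_ ?_ ?_ (x.2.1 N)
  · rintro _ ⟨y, rfl⟩
    rw [TruncEnv.map_expUnit]
    exact congrFun (congrArg Subtype.val (exp_zero (k := k) (L := L'))) N
  · exact map_one _
  · intro u v _ _ hu hv; rw [map_mul, hu, hv, one_mul]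
  · intro u _ hu; rw [map_inv, hu, inv_one]

end ExpGroup
end ExpGroup

/-! ## The Lie algebras of infinitesimal braids -/

section DrinfeldKohno

/-- The free Lie algebra on symbols `t i j`, for `i ≠ j`. -/
abbrev FreeT (k : Type u) [CommRing k] (ι : Type) : Type u :=
  FreeLieAlgebra k {p : ι × ι // p.1 ≠ p.2}

/-- The symbol `t i j`. -/
abbrev freeT (k : Type u) [CommRing k] {ι : Type} (i j : ι) (h : i ≠ j) : FreeT k ι :=
  FreeLieAlgebra.of k ⟨(i, j), h⟩

/-- The defining relations `t j i = t i j`, `[t i j, t i l + t j l] = 0` and `[t i j, t l m] = 0`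
(for distinct indices) of the Lie algebra of infinitesimal braids. -/
inductive DKRel (k : Type u) [CommRing k] (ι : Type) : FreeT k ι → Prop
  | symm (i j : ι) (h : i ≠ j) :
      DKRel k ι (freeT k j i h.symm - freeT k i j h)
  | three (i j l : ι) (hij : i ≠ j) (hil : i ≠ l) (hjl : j ≠ l) :
      DKRel k ι ⁅freeT k i j hij,
        freeT k i l hil + freeT k j l hjl⁆
  | four (i j l m : ι) (hij : i ≠ j) (hlm : l ≠ m) (hil : i ≠ l) (him : i ≠ m) (hjl : j ≠ l)
      (hjm : j ≠ m) :
      DKRel k ι ⁅freeT k i j hij, freeT k l m hlm⁆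

/-- The ideal of relations of the Lie algebra of infinitesimal braids. -/
abbrev dkIdeal (k : Type u) [CommRing k] (ι : Type) : LieIdeal k (FreeT k ι) :=
  LieSubmodule.lieSpan k (FreeT k ι) {x | DKRel k ι x}

/-- The Lie algebra of infinitesimal braids `t_ι` over `k`. -/
abbrev DK (k : Type u) [CommRing k] (ι : Type) : Type u := FreeT k ι ⧸ dkIdeal k ι

/-- The projection onto a quotient Lie algebra. -/
def lieMk {k : Type u} [CommRing k] {L : Type v} [LieRing L] [LieAlgebra k L] (I : LieIdeal k L) :
    L →ₗ⁅k⁆ L ⧸ I :=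
  { (LieSubmodule.Quotient.mk' I : L →ₗ[k] L ⧸ I) with
    map_lie' := fun {x y} => LieSubmodule.Quotient.mk_bracket (I := I) x y }

lemma lieMk_surjective {k : Type u} [CommRing k] {L : Type v} [LieRing L] [LieAlgebra k L]
    (I : LieIdeal k L) : Function.Surjective (lieMk I) :=
  LieSubmodule.Quotient.surjective_mk' I

/-- Morphisms out of the quotient of a Lie algebra by the ideal generated by a set. -/
def lieLift {k : Type u} [CommRing k] {L : Type v} [LieRing L] [LieAlgebra k L]
    {L' : Type w} [LieRing L'] [LieAlgebra k L'] (s : Set L) (f : L →ₗ⁅k⁆ L')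
    (h : ∀ x ∈ s, f x = 0) : (L ⧸ (LieSubmodule.lieSpan k L s : LieIdeal k L)) →ₗ⁅k⁆ L' :=
  { Submodule.liftQ (LieSubmodule.lieSpan k L s : LieIdeal k L).toSubmodule (f : L →ₗ[k] L') (by
      intro x hx
      have : (LieSubmodule.lieSpan k L s : LieIdeal k L) ≤ f.ker :=
        LieSubmodule.lieSpan_le.2 fun y hy => (LieHom.mem_ker).2 (h y hy)
      exact (LieHom.mem_ker).1 (this hx)) with
    map_lie' := fun {x y} => by
      obtain ⟨x, rfl⟩ := lieMk_surjective _ x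
      obtain ⟨y, rfl⟩ := lieMk_surjective _ y
      exact LieHom.map_lie f x y }

lemma lieLift_mk {k : Type u} [CommRing k] {L : Type v} [LieRing L] [LieAlgebra k L]
    {L' : Type w} [LieRing L'] [LieAlgebra k L'] (s : Set L) (f : L →ₗ⁅k⁆ L')
    (h : ∀ x ∈ s, f x = 0) (x : L) : lieLift s f h (lieMk _ x) = f x := rfl

/-- The Lie subalgebra of all `y` such that `g y` commutes with `a`. -/
def commSubalgebra {k : Type u} [CommRing k] {L : Type v} [LieRing L] [LieAlgebra k L]
    {L' : Type w} [LieRing L'] [LieAlgebra k L'] (a : L') (g : L →ₗ⁅k⁆ L') : LieSubalgebra k L where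
  carrier := {y | ⁅a, g y⁆ = 0}
  add_mem' {x y} hx hy := by
    change ⁅a, g (x + y)⁆ = 0
    rw [map_add, lie_add, show ⁅a, g x⁆ = 0 from hx, show ⁅a, g y⁆ = 0 from hy, add_zero]
  zero_mem' := by
    change ⁅a, g 0⁆ = 0
    rw [map_zero, lie_zero]
  smul_mem' c x hx := by
    change ⁅a, g (c • x)⁆ = 0
    rw [map_smul, lie_smul, show ⁅a, g x⁆ = 0 from hx, smul_zero]
  lie_mem' {x y} hx hy := by
    change ⁅a, g ⁅x, y⁆⁆ = 0
    rw [LieHom.map_lie, leibniz_lie, show ⁅a, g x⁆ = 0 from hx, show ⁅a, g y⁆ = 0 from hy,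
      zero_lie, lie_zero, add_zero]

variable {k : Type u} [CommRing k] {ι κ J : Type} [DecidableEq ι] [DecidableEq κ] [DecidableEq J]

namespace DK

variable (k) in
/-- The generators `t i j`; it is convenient to set `t i i = 0`. -/
def t (i j : ι) : DK k ι :=
  if h : i ≠ j then lieMk _ (FreeLieAlgebra.of k ⟨(i, j), h⟩) else 0

lemma t_of_ne {i j : ι} (h : i ≠ j) : t k i j = lieMk _ (FreeLieAlgebra.of k ⟨(i, j), h⟩) :=
  dif_pos h

@[simp] lemma t_self (i : ι) : t k i i = 0 := dif_neg (by simp)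

lemma mk_rel {x : FreeT k ι} (h : DKRel k ι x) : lieMk (dkIdeal k ι) x = 0 :=
  (LieSubmodule.Quotient.mk_eq_zero _).2 (LieSubmodule.subset_lieSpan h)

lemma t_symm (i j : ι) : t k j i = t k i j := by
  by_cases h : i = j
  · rw [h]
  · rw [t_of_ne h, t_of_ne (Ne.symm h), ← sub_eq_zero, ← map_sub]
    exact mk_rel (DKRel.symm i j h)

lemma t_three {i j l : ι} (hij : i ≠ j) (hil : i ≠ l) (hjl : j ≠ l) :
    ⁅t k i j, t k i l + t k j l⁆ = 0 := by
  rw [t_of_ne hij, t_of_ne hil, t_of_ne hjl, ← map_add, ← LieHom.map_lie]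
  exact mk_rel (DKRel.three i j l hij hil hjl)

lemma t_four {i j l m : ι} (hil : i ≠ l) (him : i ≠ m) (hjl : j ≠ l) (hjm : j ≠ m) :
    ⁅t k i j, t k l m⁆ = 0 := by
  by_cases hij : i = j
  · rw [hij, t_self, zero_lie]
  by_cases hlm : l = m
  · rw [hlm, t_self, lie_zero]
  rw [t_of_ne hij, t_of_ne hlm, ← LieHom.map_lie]
  exact mk_rel (DKRel.four i j l m hij hlm hil him hjl hjm)

/-- A Lie subalgebra which contains the generators contains everything. -/
lemma mem_of_gen (P : LieSubalgebra k (DK k ι)) (h : ∀ i j, t k i j ∈ P) (x : DK k ι) : x ∈ P := by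
  obtain ⟨x, rfl⟩ := lieMk_surjective _ x
  let F : FreeT k ι →ₗ⁅k⁆ P := FreeLieAlgebra.lift k fun p => ⟨t k p.1.1 p.1.2, h _ _⟩
  have : P.incl.comp F = lieMk (dkIdeal k ι) := by
    apply FreeLieAlgebra.hom_ext
    intro p
    change ((F (FreeLieAlgebra.of k p) : P) : DK k ι) = _
    rw [FreeLieAlgebra.lift_of_apply]
    exact t_of_ne p.2
  rw [← this]
  exact (F x).2

variable [Fintype J]

variable (k) in
/-- `∑ t α β`, where `α` runs over `φ⁻¹ (i)` and `β` over `φ⁻¹ (j)`. -/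
def cableGen (φ : J → Option ι) (i j : ι) : DK k J :=
  ∑ α with φ α = some i, ∑ β with φ β = some j, t k α β

lemma cableGen_symm (φ : J → Option ι) (i j : ι) : cableGen k φ j i = cableGen k φ i j := by
  rw [cableGen, cableGen, Finset.sum_comm]
  exact Finset.sum_congr rfl fun _ _ => Finset.sum_congr rfl fun _ _ => t_symm _ _

/-- The key commutation: if `χ` is constant on the support of `φ` then the two cablings commute. -/
lemma lie_cableGen {φ : J → Option ι} {χ : J → Option κ}
    (h : ∀ x y, φ x ≠ none → φ y ≠ none → χ x = χ y) {i j : ι} (hij : i ≠ j) {l m : κ}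
    (hlm : l ≠ m) : ⁅cableGen k φ i j, cableGen k χ l m⁆ = 0 := by
  rw [cableGen, sum_lie]
  refine Finset.sum_eq_zero fun α hα => ?_
  rw [sum_lie]
  refine Finset.sum_eq_zero fun β hβ => ?_
  simp only [Finset.mem_filter, Finset.mem_univ, true_and] at hα hβ
  have hne : α ≠ β := by rintro rfl; exact hij (Option.some_injective _ (hα.symm.trans hβ))
  have hχ : χ α = χ β := h α β (by simp [hα]) (by simp [hβ])
  -- the statement is symmetric in `l`, `m`; first treat the case `χ α = some l`
  have key : ∀ l m : κ, l ≠ m → χ α = some l → ⁅t k α β, cableGen k χ l m⁆ = 0 := by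
    intro l m hlm hl
    rw [cableGen, Finset.sum_comm, lie_sum]
    refine Finset.sum_eq_zero fun δ hδ => ?_
    simp only [Finset.mem_filter, Finset.mem_univ, true_and] at hδ
    have hαδ : α ≠ δ := by rintro rfl; exact hlm (Option.some_injective _ (hl.symm.trans hδ))
    have hβδ : β ≠ δ := by
      rintro rfl; exact hlm (Option.some_injective _ (hl.symm.trans (hχ.trans hδ)))
    have hsub : ({α, β} : Finset J) ⊆ Finset.univ.filter fun γ => χ γ = some l := by
      intro γ hγ
      simp only [Finset.mem_insert, Finset.mem_singleton] at hγ
      rcases hγ with rfl | rfl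
      · simp [hl]
      · simp [← hχ, hl]
    rw [← Finset.sum_sdiff hsub, lie_add, lie_sum, Finset.sum_pair hne,
      t_three hne hαδ hβδ, add_zero]
    refine Finset.sum_eq_zero fun γ hγ => ?_
    simp only [Finset.mem_sdiff, Finset.mem_insert, Finset.mem_singleton, not_or] at hγ
    exact t_four (Ne.symm hγ.2.1) hαδ (Ne.symm hγ.2.2) hβδ
  by_cases hl : χ α = some l
  · exact key l m hlm hl
  by_cases hm : χ α = some m
  · rw [← cableGen_symm]; exact key m l hlm.symm hm
  rw [cableGen, lie_sum]
  refine Finset.sum_eq_zero fun γ hγ => ?_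
  rw [lie_sum]
  refine Finset.sum_eq_zero fun δ hδ => ?_
  simp only [Finset.mem_filter, Finset.mem_univ, true_and] at hγ hδ
  refine t_four ?_ ?_ ?_ ?_ <;> rintro rfl
  · exact hl hγ
  · exact hm hδ
  · exact hl (hχ.trans hγ)
  · exact hm (hχ.trans hδ)

lemma lie_cableGen_four (φ : J → Option ι) {i j l m : ι} (hil : i ≠ l) (him : i ≠ m) (hjl : j ≠ l)
    (hjm : j ≠ m) : ⁅cableGen k φ i j, cableGen k φ l m⁆ = 0 := by
  rw [cableGen, sum_lie]
  refine Finset.sum_eq_zero fun α hα => ?_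
  rw [sum_lie]
  refine Finset.sum_eq_zero fun β hβ => ?_
  rw [cableGen, lie_sum]
  refine Finset.sum_eq_zero fun γ hγ => ?_
  rw [lie_sum]
  refine Finset.sum_eq_zero fun δ hδ => ?_
  simp only [Finset.mem_filter, Finset.mem_univ, true_and] at hα hβ hγ hδ
  refine t_four ?_ ?_ ?_ ?_ <;> rintro rfl
  · exact hil (Option.some_injective _ (hα.symm.trans hγ))
  · exact him (Option.some_injective _ (hα.symm.trans hδ))
  · exact hjl (Option.some_injective _ (hβ.symm.trans hγ))
  · exact hjm (Option.some_injective _ (hβ.symm.trans hδ))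

lemma lie_cableGen_three (φ : J → Option ι) {i j l : ι} (hij : i ≠ j) (hil : i ≠ l) (hjl : j ≠ l) :
    ⁅cableGen k φ i j, cableGen k φ i l + cableGen k φ j l⁆ = 0 := by
  -- merge the blocks `i` and `j`
  let χ : J → Option Bool := fun x =>
    if φ x = some i ∨ φ x = some j then some true else if φ x = some l then some false else none
  have e : cableGen k φ i l + cableGen k φ j l = cableGen k χ true false := by
    have h1 : (Finset.univ.filter fun x => χ x = some true) =
        (Finset.univ.filter fun x => φ x = some i) ∪
          (Finset.univ.filter fun x => φ x = some j) := by
      ext x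
      simp only [χ, Finset.mem_filter, Finset.mem_univ, true_and, Finset.mem_union]
      split_ifs <;> simp_all
    have h2 : (Finset.univ.filter fun x => χ x = some false) =
        Finset.univ.filter fun x => φ x = some l := by
      ext x
      simp only [χ, Finset.mem_filter, Finset.mem_univ, true_and]
      split_ifs with h h' <;> simp_all
      rcases h with h | h <;> simp [h, hil, hjl]
    rw [cableGen, cableGen, cableGen, h1, h2, Finset.sum_union]
    rw [Finset.disjoint_left]
    intro x hx hx'
    simp only [Finset.mem_filter, Finset.mem_univ, true_and] at hx hx'
    exact hij (Option.some_injective _ (hx.symm.trans hx'))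
  let φ' : J → Option ι := fun x => if φ x = some i ∨ φ x = some j then φ x else none
  have e' : cableGen k φ i j = cableGen k φ' i j := by
    have h1 : ∀ a, (a = i ∨ a = j) → (Finset.univ.filter fun x => φ x = some a) =
        Finset.univ.filter fun x => φ' x = some a := by
      intro a ha
      ext x
      simp only [φ', Finset.mem_filter, Finset.mem_univ, true_and]
      split_ifs with h
      · rfl
      · push Not at h
        rcases ha with rfl | rfl <;> simp_all
    rw [cableGen, cableGen, h1 i (Or.inl rfl), h1 j (Or.inr rfl)]
  rw [e, e']
  refine lie_cableGen (fun x y hx hy => ?_) hij (by decide)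
  have : ∀ z, φ' z ≠ none → χ z = some true := by
    intro z hz
    simp only [φ', ne_eq, ite_eq_right_iff, not_forall] at hz
    obtain ⟨hz, _⟩ := hz
    simp only [χ, if_pos hz]
  rw [this x hx, this y hy]

variable (k) in
/-- The morphism `t_ι → t_J`, `x ↦ x ^ (I_i)`, attached to a family `(I_i)` of disjoint subsets of
`J`, mapping `t i j` to `∑ t α β`, for `α ∈ I_i` and `β ∈ I_j`. A family of disjoint subsets indexed
by `ι` is the same as a partially defined map `φ` from `J` to `ι`, with `I_i = φ⁻¹ (i)`. -/
def cable (φ : J → Option ι) : DK k ι →ₗ⁅k⁆ DK k J :=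
  lieLift _ (FreeLieAlgebra.lift k fun p => cableGen k φ p.1.1 p.1.2) (by
    rintro x hx
    induction hx with
    | symm i j h =>
      rw [map_sub, FreeLieAlgebra.lift_of_apply, FreeLieAlgebra.lift_of_apply, sub_eq_zero]
      exact cableGen_symm φ i j
    | three i j l hij hil hjl =>
      rw [LieHom.map_lie, map_add, FreeLieAlgebra.lift_of_apply, FreeLieAlgebra.lift_of_apply,
        FreeLieAlgebra.lift_of_apply]
      exact lie_cableGen_three φ hij hil hjl
    | four i j l m hij hlm hil him hjl hjm =>
      rw [LieHom.map_lie, FreeLieAlgebra.lift_of_apply, FreeLieAlgebra.lift_of_apply]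
      exact lie_cableGen_four φ hil him hjl hjm)

lemma cable_t (φ : J → Option ι) {i j : ι} (h : i ≠ j) :
    cable k φ (t k i j) = cableGen k φ i j := by
  rw [t_of_ne h, cable, lieLift_mk, FreeLieAlgebra.lift_of_apply]

lemma hom_ext {L : Type*} [LieRing L] [LieAlgebra k L] {f g : DK k ι →ₗ⁅k⁆ L}
    (h : ∀ i j, i ≠ j → f (t k i j) = g (t k i j)) : f = g := by
  have : f.comp (lieMk _) = g.comp (lieMk _) := by
    apply FreeLieAlgebra.hom_ext
    intro p
    have := h p.1.1 p.1.2 p.2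
    rwa [t_of_ne p.2] at this
  refine LieHom.ext fun x => ?_
  obtain ⟨x, rfl⟩ := lieMk_surjective _ x
  exact LieHom.congr_fun this x

lemma lie_cable {φ : J → Option ι} {χ : J → Option κ}
    (h : ∀ x y, φ x ≠ none → φ y ≠ none → χ x = χ y) (a : DK k ι) (b : DK k κ) :
    ⁅cable k φ a, cable k χ b⁆ = 0 := by
  have h1 : ∀ i j, i ≠ j → ∀ b, ⁅cable k φ (t k i j), cable k χ b⁆ = 0 := by
    intro i j hij b
    refine mem_of_gen (commSubalgebra (cable k φ (t k i j)) (cable k χ)) (fun l m => ?_) b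
    change ⁅cable k φ (t k i j), cable k χ (t k l m)⁆ = 0
    by_cases hlm : l = m
    · rw [hlm, t_self, map_zero, lie_zero]
    · rw [cable_t _ hij, cable_t _ hlm]
      exact lie_cableGen h hij hlm
  have h2 : ⁅cable k χ b, cable k φ a⁆ = 0 := by
    refine mem_of_gen (commSubalgebra (cable k χ b) (cable k φ)) (fun i j => ?_) a
    change ⁅cable k χ b, cable k φ (t k i j)⁆ = 0
    by_cases hij : i = j
    · rw [hij, t_self, map_zero, lie_zero]
    · rw [← lie_skew, h1 i j hij, neg_zero]
  rw [← lie_skew, h2, neg_zero]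

variable [Fintype κ]

lemma cable_comp (φ : κ → Option ι) (ψ : J → Option κ) :
    (cable k ψ).comp (cable k φ) = cable k fun x => (ψ x).bind φ := by
  refine hom_ext fun i j h => ?_
  rw [LieHom.comp_apply, cable_t _ h, cable_t _ h, cableGen, cableGen, map_sum]
  have hb : ∀ (a : ι) (f : J → DK k J),
      ∑ x with (ψ x).bind φ = some a, f x =
        ∑ y with φ y = some a, ∑ x with ψ x = some y, f x := by
    intro a f
    rw [Finset.sum_comm' (t' := Finset.univ.filter fun x => (ψ x).bind φ = some a)
      (s' := fun x => Finset.univ.filter fun y => ψ x = some y)]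
    · refine Finset.sum_congr rfl fun x hx => ?_
      simp only [Finset.mem_filter, Finset.mem_univ, true_and] at hx
      obtain ⟨y, hy, -⟩ := Option.bind_eq_some_iff.1 hx
      have : (Finset.univ.filter fun z => ψ x = some z) = {y} := by
        ext z; simp [hy, eq_comm]
      rw [this, Finset.sum_singleton]
    · intro y x
      simp only [Finset.mem_filter, Finset.mem_univ, true_and, Option.bind_eq_some_iff]
      constructor
      · rintro ⟨h1, h2⟩; exact ⟨h2, y, h2, h1⟩
      · rintro ⟨h2, z, h3, h4⟩
        obtain rfl : y = z := Option.some_injective _ (h2.symm.trans h3)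
        exact ⟨h4, h2⟩
  rw [hb]
  refine Finset.sum_congr rfl fun a ha => ?_
  rw [map_sum]
  simp only [hb]
  rw [Finset.sum_comm]
  refine Finset.sum_congr rfl fun b hb' => ?_
  have hab : a ≠ b := by
    rintro rfl
    simp only [Finset.mem_filter, Finset.mem_univ, true_and] at ha hb'
    exact h (Option.some_injective _ (ha.symm.trans hb'))
  rw [cable_t _ hab, cableGen]

lemma cable_some [Fintype ι] : cable k (some : ι → Option ι) = LieHom.id := by
  refine hom_ext fun i j h => ?_
  rw [cable_t _ h, cableGen]
  simp [Finset.filter_eq']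

end DK
end DrinfeldKohno

/-! ## Permutations decorated by families of groups -/

/-- A sequence of groups `G n`, on which the bijections `[m] ≃ [n]` act. -/
structure SymFamily where
  /-- The groups. -/
  G : ℕ → Type u
  [group : ∀ n, Group (G n)]
  /-- The action of bijections; for `m = n`, this is an action of the symmetric group. -/
  relabel : ∀ {m n : ℕ}, (Fin m ≃ Fin n) → G m →* G n
  relabel_refl : ∀ {n : ℕ} (x : G n), relabel (Equiv.refl _) x = x
  relabel_trans : ∀ {l m n : ℕ} (e : Fin l ≃ Fin m) (e' : Fin m ≃ Fin n) (x : G l),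
    relabel (e.trans e') x = relabel e' (relabel e x)

attribute [instance] SymFamily.group

/-- Pairs `(g, f)` with `g ∈ G n` and `f : [m] ≃ [n]` a bijection such that `s' ∘ f = s`. This is
empty if `m ≠ n`; for `m = n`, this is the subset `G n ⋊ {f ∈ S_n | s' ∘ f = s}` of `G n ⋊ S_n`,
where `(g, f)` stands for the product `g * f`. -/
@[ext]
structure DecHom (F : SymFamily.{u}) {S : Type v} {m n : ℕ} (s : Fin m → S) (s' : Fin n → S) :
    Type u where
  /-- The component in `G n`. -/
  elt : F.G n
  /-- The component in the symmetric group. -/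
  perm : Fin m ≃ Fin n
  comm : ∀ i, s' (perm i) = s i

namespace DecHom

variable {F : SymFamily.{u}} {S : Type v} {m n l q : ℕ} {s : Fin m → S} {s' : Fin n → S}
  {s'' : Fin l → S} {s''' : Fin q → S}

/-- The unit of the semidirect product. -/
def one (s : Fin m → S) : DecHom F s s := ⟨1, Equiv.refl _, fun _ => rfl⟩

/-- The product in the semidirect product, in the order of composition:
`(g', f') * (g, f) = (g' * f' g, f' * f)`. -/
def mul (y : DecHom F s' s'') (x : DecHom F s s') : DecHom F s s'' :=
  ⟨y.elt * F.relabel y.perm x.elt, x.perm.trans y.perm, fun i => by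
    rw [Equiv.trans_apply, y.comm, x.comm]⟩

/-- The inverse in the semidirect product. -/
def inv (x : DecHom F s s') : DecHom F s' s :=
  ⟨F.relabel x.perm.symm x.elt⁻¹, x.perm.symm, fun i => by
    rw [← x.comm, Equiv.apply_symm_apply]⟩

lemma mul_one (x : DecHom F s s') : mul x (one s) = x := by
  ext1
  · simp [mul, one]
  · rfl

lemma one_mul (x : DecHom F s s') : mul (one s') x = x := by
  ext1
  · simp [mul, one, F.relabel_refl]
  · rfl

lemma mul_assoc (z : DecHom F s'' s''') (y : DecHom F s' s'') (x : DecHom F s s') :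
    mul (mul z y) x = mul z (mul y x) := by
  ext1
  · simp [mul, F.relabel_trans, _root_.mul_assoc]
  · rfl

lemma inv_mul (x : DecHom F s s') : mul (inv x) x = one s := by
  ext1
  · simp [mul, one, inv]
  · simp [mul, one, inv]

lemma mul_inv (x : DecHom F s s') : mul x (inv x) = one s' := by
  ext1
  · simp [mul, one, inv, ← F.relabel_trans, F.relabel_refl]
  · simp [mul, one, inv]

end DecHom

section Families

variable (k : Type u) [CommRing k] [Algebra ℚ k]

/-- The group `exp (t̂_ι)`. -/
abbrev ExpT (ι : Type) : Type u := ExpGroup k (DK k ι)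

variable {k} {ι κ J : Type} [DecidableEq ι] [DecidableEq κ] [DecidableEq J] [Fintype J]

/-- The group morphism `exp (t̂_ι) → exp (t̂_J)`, `x ↦ x ^ (I_i)`, for `I_i = φ⁻¹ (i)`. -/
def ins (φ : J → Option ι) : ExpT k ι →* ExpT k J := ExpGroup.map (DK.cable k φ)

lemma ins_ins [Fintype κ] (φ : κ → Option ι) (ψ : J → Option κ) (x : ExpT k ι) :
    ins ψ (ins φ x) = ins (fun a => (ψ a).bind φ) x := by
  rw [ins, ins, ExpGroup.map_comp, DK.cable_comp]; rfl

lemma ins_some [Fintype ι] (x : ExpT k ι) : ins (some : ι → Option ι) x = x := by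
  rw [ins, DK.cable_some, ExpGroup.map_id]

lemma ins_comm {φ : J → Option ι} {χ : J → Option κ}
    (h : ∀ x y, φ x ≠ none → φ y ≠ none → χ x = χ y) (a : ExpT k ι) (b : ExpT k κ) :
    ins φ a * ins χ b = ins χ b * ins φ a :=
  ExpGroup.commute_map _ _ (DK.lie_cable h) a b

variable (k) in
/-- The groups `exp (t̂_n)`, on which the symmetric groups act by permutation of indices. -/
abbrev expTFamily : SymFamily.{u} where
  G n := ExpT k (Fin n)
  relabel e := ins fun a => some (e.symm a)
  relabel_refl x := ins_some x
  relabel_trans {l m n} e e' x := by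
    rw [ins_ins]; rfl

/-- The elements `∑ t i j` (sum over `j ≠ i`; recall that `t i i = 0`) of `t_n`. -/
def sphereRel (k : Type u) [CommRing k] (n : ℕ) : Set (DK k (Fin n)) :=
  {x | ∃ i, x = ∑ j, DK.t k i j}

/-- The Lie algebra `p_n`, the quotient of `t_n` by the relations `∑ t i j = 0`, for any `i`. -/
abbrev SphDK (k : Type u) [CommRing k] (n : ℕ) : Type u :=
  DK k (Fin n) ⧸ (LieSubmodule.lieSpan k (DK k (Fin n)) (sphereRel k n) : LieIdeal k (DK k (Fin n)))

namespace SphDK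

/-- The projection `t_n → p_n`. -/
def proj (k : Type u) [CommRing k] (n : ℕ) : DK k (Fin n) →ₗ⁅k⁆ SphDK k n := lieMk _

lemma cable_sphereRel {k : Type u} [CommRing k] {m n : ℕ} (e : Fin m ≃ Fin n) (i : Fin m) :
    DK.cable k (fun a => some (e.symm a)) (∑ j, DK.t k i j) = ∑ j, DK.t k (e i) j := by
  rw [map_sum, ← Equiv.sum_comp e]
  refine Finset.sum_congr rfl fun j _ => ?_
  by_cases h : i = j
  · rw [h, DK.t_self, DK.t_self, map_zero]
  · rw [DK.cable_t _ h, DK.cableGen]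
    have hf : ∀ l : Fin m, (Finset.univ.filter fun a : Fin n => some (e.symm a) = some l) =
        {e l} := by
      intro l; ext a
      simp [Equiv.symm_apply_eq]
    rw [hf, hf, Finset.sum_singleton, Finset.sum_singleton]

/-- The permutation of indices in `p_n`, induced by that in `t_n`. -/
def relabel (k : Type u) [CommRing k] {m n : ℕ} (e : Fin m ≃ Fin n) :
    SphDK k m →ₗ⁅k⁆ SphDK k n :=
  lieLift _ ((proj k n).comp (DK.cable k fun a => some (e.symm a))) (by
    rintro _ ⟨i, rfl⟩
    rw [LieHom.comp_apply, cable_sphereRel]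
    exact (LieSubmodule.Quotient.mk_eq_zero _).2 (LieSubmodule.subset_lieSpan ⟨e i, rfl⟩))

lemma relabel_proj {k : Type u} [CommRing k] {m n : ℕ} (e : Fin m ≃ Fin n) (x : DK k (Fin m)) :
    relabel k e (proj k m x) = proj k n (DK.cable k (fun a => some (e.symm a)) x) := rfl

end SphDK

variable (k) in
/-- The groups `exp (p̂_n)`, on which the symmetric groups act by permutation of indices. -/
abbrev expPFamily : SymFamily.{u} where
  G n := ExpGroup k (SphDK k n)
  relabel e := ExpGroup.map (SphDK.relabel k e)
  relabel_refl {n} x := by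
    have : SphDK.relabel k (Equiv.refl (Fin n)) = LieHom.id := by
      refine LieHom.ext fun y => ?_
      obtain ⟨y, rfl⟩ := lieMk_surjective _ y
      exact congrArg (SphDK.proj k n) (LieHom.congr_fun DK.cable_some y)
    rw [this, ExpGroup.map_id]
  relabel_trans {l m n} e e' x := by
    rw [ExpGroup.map_comp]
    congr 1
    refine congrArg _ (LieHom.ext fun y => ?_)
    obtain ⟨y, rfl⟩ := lieMk_surjective _ y
    exact congrArg (SphDK.proj k n)
      (LieHom.congr_fun (DK.cable_comp (fun a => some (e.symm a)) fun a => some (e'.symm a)) y).symm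

/-- The group morphism `exp (t̂_n) → exp (p̂_n)`. -/
def expProj (k : Type u) [CommRing k] [Algebra ℚ k] (n : ℕ) :
    (expTFamily k).G n →* (expPFamily k).G n :=
  ExpGroup.map (SphDK.proj k n)

lemma expProj_relabel {m n : ℕ} (e : Fin m ≃ Fin n) (x : ExpT k (Fin m)) :
    (expPFamily k).relabel e (expProj k m x) = expProj k n ((expTFamily k).relabel e x) :=
  (ExpGroup.map_comp (SphDK.proj k m) (SphDK.relabel k e) x).trans
    (ExpGroup.map_comp (DK.cable k fun a => some (e.symm a)) (SphDK.proj k n) x).symm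

end Families

/-! ## Drinfeld associators -/

/-- The image `Φ (x, y)` of `Φ (A, B) ∈ exp (f̂_2)` under `A ↦ x`, `B ↦ y`. -/
def subst {k : Type u} [CommRing k] [Algebra ℚ k] {L : Type v} [LieRing L] [LieAlgebra k L]
    (Φ : ExpGroup k (FreeLieAlgebra k (Fin 2))) (x y : L) : ExpGroup k L :=
  ExpGroup.map (FreeLieAlgebra.lift k ![x, y]) Φ

/-- A Drinfeld associator over `k`: a pair `(μ, Φ)`, with `μ ∈ k` and `Φ ∈ exp (f̂_2)`, satisfying
the duality, hexagon and pentagon relations. The indices `1, 2, 3, 4` of the generators of `t_3`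
and `t_4` are denoted here by `0, 1, 2, 3`. -/
structure Associator (k : Type u) [CommRing k] [Algebra ℚ k] where
  /-- The parameter `μ`. -/
  μ : k
  /-- The series `Φ (A, B)`. -/
  Φ : ExpGroup k (FreeLieAlgebra k (Fin 2))
  duality : subst Φ (FreeLieAlgebra.of k (1 : Fin 2)) (FreeLieAlgebra.of k (0 : Fin 2)) = Φ⁻¹
  hexagon : let t : Fin 3 → Fin 3 → DK k (Fin 3) := DK.t k
    let e : DK k (Fin 3) → ExpT k (Fin 3) := fun x => ExpGroup.exp (((1 / 2 : ℚ) • μ) • x)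
    e (t 0 2 + t 1 2) =
      subst Φ (t 0 2) (t 0 1) * e (t 0 2) * (subst Φ (t 0 2) (t 1 2))⁻¹ * e (t 1 2) *
        subst Φ (t 0 1) (t 1 2)
  pentagon : let t : Fin 4 → Fin 4 → DK k (Fin 4) := DK.t k
    subst Φ (t 0 1) (t 1 2 + t 1 3) * subst Φ (t 0 2 + t 1 2) (t 2 3) =
      subst Φ (t 1 2) (t 2 3) * subst Φ (t 0 1 + t 0 2) (t 1 3 + t 2 3) *
        subst Φ (t 0 1) (t 1 2)

/-! ## Parenthesized words -/

/-- Parenthesized words in the alphabet `S`: planar binary rooted trees with leaves labelled by `S`,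
together with the empty word, which is a two-sided unit for the product. This is the union over
`n ≥ 0` of `T_n × S ^ n`. -/
abbrev PaWord (S : Type v) : Type v := WithOne (FreeMagma S)

namespace PaWord

variable {S : Type v}

/-- The number of letters. -/
def len (X : PaWord S) : ℕ := WithOne.recOneCoe (motive := fun _ => ℕ) 0 FreeMagma.length X

/-- The sequence of letters of a nonempty word. -/
def magmaLetters : (x : FreeMagma S) → Fin x.length → S
  | .of s => fun _ => s
  | .mul x y => Fin.append (magmaLetters x) (magmaLetters y)

/-- The sequence of letters, read from left to right. -/
def letters (X : PaWord S) : Fin X.len → S :=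
  WithOne.recOneCoe (motive := fun X : PaWord S => Fin X.len → S) (fun i => Fin.elim0 i)
    magmaLetters X

lemma len_mul (X Y : PaWord S) : (X * Y).len = X.len + Y.len := by
  induction X using WithOne.recOneCoe with
  | one => rw [MulOneClass.one_mul]; exact (Nat.zero_add _).symm
  | coe x =>
    induction Y using WithOne.recOneCoe with
    | one => rfl
    | coe y => rfl

/-- The positions in `X * Y` are those of `X`, followed by those of `Y`. -/
def pos (X Y : PaWord S) : Fin X.len ⊕ Fin Y.len ≃ Fin (X * Y).len :=
  finSumFinEquiv.trans (finCongr (len_mul X Y).symm)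

lemma pos_inl_val (X Y : PaWord S) (i : Fin X.len) : (pos X Y (Sum.inl i) : ℕ) = i := by
  simp [pos]

lemma pos_inr_val (X Y : PaWord S) (i : Fin Y.len) : (pos X Y (Sum.inr i) : ℕ) = X.len + i := by
  simp [pos]

lemma letters_congr {X Y : PaWord S} (h : X = Y) (i : Fin X.len) (j : Fin Y.len)
    (hij : (i : ℕ) = j) : X.letters i = Y.letters j := by
  subst h
  rw [Fin.ext hij]

lemma letters_pos (X Y : PaWord S) (a : Fin X.len ⊕ Fin Y.len) :
    (X * Y).letters (pos X Y a) = Sum.elim X.letters Y.letters a := by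
  induction X using WithOne.recOneCoe with
  | one =>
    rcases a with a | a
    · exact Fin.elim0 a
    · exact letters_congr (MulOneClass.one_mul Y) _ _ (by
        rw [pos_inr_val]; exact Nat.zero_add _)
  | coe x =>
    induction Y using WithOne.recOneCoe with
    | one =>
      rcases a with a | a
      · exact letters_congr (MulOneClass.mul_one _) _ _ (by rw [pos_inl_val])
      · exact Fin.elim0 a
    | coe y =>
      rcases a with a | a
      · exact Fin.append_left (magmaLetters x) (magmaLetters y) a
      · exact Fin.append_right (magmaLetters x) (magmaLetters y) a

@[simp] lemma letters_pos_inl (X Y : PaWord S) (a : Fin X.len) :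
    (X * Y).letters (pos X Y (Sum.inl a)) = X.letters a := letters_pos X Y (Sum.inl a)

@[simp] lemma letters_pos_inr (X Y : PaWord S) (a : Fin Y.len) :
    (X * Y).letters (pos X Y (Sum.inr a)) = Y.letters a := letters_pos X Y (Sum.inr a)

/-- Case analysis on a position in a product. -/
lemma pos_cases {X Y : PaWord S} {P : Fin (X * Y).len → Prop} (hl : ∀ i, P (pos X Y (Sum.inl i)))
    (hr : ∀ i, P (pos X Y (Sum.inr i))) (a : Fin (X * Y).len) : P a := by
  obtain ⟨a, rfl⟩ := (pos X Y).surjective a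
  rcases a with a | a
  · exact hl a
  · exact hr a

/-- The identity permutation, from positions in `(X * Y) * Z` to positions in `X * (Y * Z)`. -/
def assocPerm (X Y Z : PaWord S) : Fin (X * Y * Z).len ≃ Fin (X * (Y * Z)).len :=
  finCongr (by rw [len_mul, len_mul, len_mul, len_mul, Nat.add_assoc])

@[simp] lemma assocPerm_1 (X Y Z : PaWord S) (i : Fin X.len) :
    assocPerm X Y Z (pos _ _ (Sum.inl (pos _ _ (Sum.inl i)))) = pos _ _ (Sum.inl i) :=
  Fin.ext (by simp [assocPerm, pos_inl_val])

@[simp] lemma assocPerm_2 (X Y Z : PaWord S) (i : Fin Y.len) :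
    assocPerm X Y Z (pos _ _ (Sum.inl (pos _ _ (Sum.inr i)))) =
      pos _ _ (Sum.inr (pos _ _ (Sum.inl i))) :=
  Fin.ext (by simp [assocPerm, pos_inl_val, pos_inr_val])

@[simp] lemma assocPerm_3 (X Y Z : PaWord S) (i : Fin Z.len) :
    assocPerm X Y Z (pos _ _ (Sum.inr i)) = pos _ _ (Sum.inr (pos _ _ (Sum.inr i))) :=
  Fin.ext (by simp [assocPerm, pos_inr_val, len_mul, Nat.add_assoc])

@[simp] lemma assocPerm_symm_1 (X Y Z : PaWord S) (i : Fin X.len) :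
    (assocPerm X Y Z).symm (pos _ _ (Sum.inl i)) = pos _ _ (Sum.inl (pos _ _ (Sum.inl i))) := by
  rw [Equiv.symm_apply_eq, assocPerm_1]

@[simp] lemma assocPerm_symm_2 (X Y Z : PaWord S) (i : Fin Y.len) :
    (assocPerm X Y Z).symm (pos _ _ (Sum.inr (pos _ _ (Sum.inl i)))) =
      pos _ _ (Sum.inl (pos _ _ (Sum.inr i))) := by
  rw [Equiv.symm_apply_eq, assocPerm_2]

@[simp] lemma assocPerm_symm_3 (X Y Z : PaWord S) (i : Fin Z.len) :
    (assocPerm X Y Z).symm (pos _ _ (Sum.inr (pos _ _ (Sum.inr i)))) = pos _ _ (Sum.inr i) := by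
  rw [Equiv.symm_apply_eq, assocPerm_3]

/-- The permutation `s_{n, n'}`: position `i` of `X` is sent to `n' + i`, position `n + i` of `Y`
is sent to `i`. -/
def swapPerm (X Y : PaWord S) : Fin (X * Y).len ≃ Fin (Y * X).len :=
  (pos X Y).symm.trans ((Equiv.sumComm _ _).trans (pos Y X))

/-- The permutation `σ * σ'`. -/
def tensorPerm {X X' Y Y' : PaWord S} (e : Fin X.len ≃ Fin X'.len) (e' : Fin Y.len ≃ Fin Y'.len) :
    Fin (X * Y).len ≃ Fin (X' * Y').len :=
  (pos X Y).symm.trans ((Equiv.sumCongr e e').trans (pos X' Y'))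

@[simp] lemma swapPerm_inl (X Y : PaWord S) (i : Fin X.len) :
    swapPerm X Y (pos _ _ (Sum.inl i)) = pos _ _ (Sum.inr i) := by simp [swapPerm]

@[simp] lemma swapPerm_inr (X Y : PaWord S) (i : Fin Y.len) :
    swapPerm X Y (pos _ _ (Sum.inr i)) = pos _ _ (Sum.inl i) := by simp [swapPerm]

@[simp] lemma swapPerm_symm (X Y : PaWord S) : (swapPerm X Y).symm = swapPerm Y X := by
  ext i : 1
  rfl

@[simp] lemma tensorPerm_inl {X X' Y Y' : PaWord S} (e : Fin X.len ≃ Fin X'.len)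
    (e' : Fin Y.len ≃ Fin Y'.len) (i : Fin X.len) :
    tensorPerm e e' (pos _ _ (Sum.inl i)) = pos _ _ (Sum.inl (e i)) := by simp [tensorPerm]

@[simp] lemma tensorPerm_inr {X X' Y Y' : PaWord S} (e : Fin X.len ≃ Fin X'.len)
    (e' : Fin Y.len ≃ Fin Y'.len) (i : Fin Y.len) :
    tensorPerm e e' (pos _ _ (Sum.inr i)) = pos _ _ (Sum.inr (e' i)) := by simp [tensorPerm]

@[simp] lemma tensorPerm_symm {X X' Y Y' : PaWord S} (e : Fin X.len ≃ Fin X'.len)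
    (e' : Fin Y.len ≃ Fin Y'.len) : (tensorPerm e e').symm = tensorPerm e.symm e'.symm := rfl

/-- The identity permutation, from positions in `1 * X` to positions in `X`. -/
def leftUnitPerm (X : PaWord S) : Fin (1 * X).len ≃ Fin X.len :=
  finCongr (by rw [MulOneClass.one_mul])

/-- The identity permutation, from positions in `X * 1` to positions in `X`. -/
def rightUnitPerm (X : PaWord S) : Fin (X * 1).len ≃ Fin X.len :=
  finCongr (by rw [MulOneClass.mul_one])

@[simp] lemma leftUnitPerm_inr (X : PaWord S) (i : Fin X.len) :
    leftUnitPerm X (pos _ _ (Sum.inr i)) = i :=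
  Fin.ext (by simp only [leftUnitPerm, finCongr_apply, Fin.val_cast, pos_inr_val]; exact Nat.zero_add _)

@[simp] lemma rightUnitPerm_inl (X : PaWord S) (i : Fin X.len) :
    rightUnitPerm X (pos _ _ (Sum.inl i)) = i :=
  Fin.ext (by simp only [rightUnitPerm, finCongr_apply, Fin.val_cast, pos_inl_val])

@[simp] lemma leftUnitPerm_symm (X : PaWord S) (i : Fin X.len) :
    (leftUnitPerm X).symm i = pos _ _ (Sum.inr i) := by
  rw [Equiv.symm_apply_eq, leftUnitPerm_inr]

@[simp] lemma rightUnitPerm_symm (X : PaWord S) (i : Fin X.len) :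
    (rightUnitPerm X).symm i = pos _ _ (Sum.inl i) := by
  rw [Equiv.symm_apply_eq, rightUnitPerm_inl]

/-- The partially defined map attached to `[n] ⊂ [n + n']`, `n = |X|`, `n' = |Y|`. -/
def leftPart (X Y : PaWord S) (a : Fin (X * Y).len) : Option (Fin X.len) :=
  Sum.elim some (fun _ => none) ((pos X Y).symm a)

/-- The partially defined map attached to `n + [n'] ⊂ [n + n']`, `n = |X|`, `n' = |Y|`. -/
def rightPart (X Y : PaWord S) (a : Fin (X * Y).len) : Option (Fin Y.len) :=
  Sum.elim (fun _ => none) some ((pos X Y).symm a)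

@[simp] lemma leftPart_inl (X Y : PaWord S) (i : Fin X.len) :
    leftPart X Y (pos X Y (Sum.inl i)) = some i := by simp [leftPart]
@[simp] lemma leftPart_inr (X Y : PaWord S) (i : Fin Y.len) :
    leftPart X Y (pos X Y (Sum.inr i)) = none := by simp [leftPart]
@[simp] lemma rightPart_inl (X Y : PaWord S) (i : Fin X.len) :
    rightPart X Y (pos X Y (Sum.inl i)) = none := by simp [rightPart]
@[simp] lemma rightPart_inr (X Y : PaWord S) (i : Fin Y.len) :
    rightPart X Y (pos X Y (Sum.inr i)) = some i := by simp [rightPart]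

/-- The partially defined map attached to the pair of subsets `([n], n + [n'])` of `[n + n']`. -/
def blocks₂ (X Y : PaWord S) (a : Fin (X * Y).len) : Option (Fin 2) :=
  Sum.elim (fun _ => some 0) (fun _ => some 1) ((pos X Y).symm a)

/-- The partially defined map attached to the triple of subsets
`([n], n + [n'], n + n' + [n''])` of `[n + n' + n'']`. -/
def blocks₃ (X Y Z : PaWord S) (a : Fin (X * (Y * Z)).len) : Option (Fin 3) :=
  Sum.elim (fun _ => some 0)
    (fun b => Sum.elim (fun _ => some 1) (fun _ => some 2) ((pos Y Z).symm b))
    ((pos X (Y * Z)).symm a)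

@[simp] lemma blocks₂_inl (X Y : PaWord S) (i : Fin X.len) :
    blocks₂ X Y (pos X Y (Sum.inl i)) = some 0 := by simp [blocks₂]
@[simp] lemma blocks₂_inr (X Y : PaWord S) (i : Fin Y.len) :
    blocks₂ X Y (pos X Y (Sum.inr i)) = some 1 := by simp [blocks₂]
@[simp] lemma blocks₃_1 (X Y Z : PaWord S) (i : Fin X.len) :
    blocks₃ X Y Z (pos _ _ (Sum.inl i)) = some 0 := by simp [blocks₃]
@[simp] lemma blocks₃_2 (X Y Z : PaWord S) (i : Fin Y.len) :
    blocks₃ X Y Z (pos _ _ (Sum.inr (pos _ _ (Sum.inl i)))) = some 1 := by simp [blocks₃]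
@[simp] lemma blocks₃_3 (X Y Z : PaWord S) (i : Fin Z.len) :
    blocks₃ X Y Z (pos _ _ (Sum.inr (pos _ _ (Sum.inr i)))) = some 2 := by simp [blocks₃]

end PaWord

/-! ## The braided monoidal category `PaCD` attached to an associator -/

section Subst

variable {k : Type u} [CommRing k] [Algebra ℚ k] {L : Type v} [LieRing L] [LieAlgebra k L]
  {L' : Type w} [LieRing L'] [LieAlgebra k L']

lemma map_subst (f : L →ₗ⁅k⁆ L') (Φ : ExpGroup k (FreeLieAlgebra k (Fin 2))) (x y : L) :
    ExpGroup.map f (subst Φ x y) = subst Φ (f x) (f y) := by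
  rw [subst, subst, ExpGroup.map_comp]
  congr 2
  apply FreeLieAlgebra.hom_ext
  intro i
  rw [LieHom.comp_apply, FreeLieAlgebra.lift_of_apply, FreeLieAlgebra.lift_of_apply]
  fin_cases i <;> rfl

lemma subst_zero (Φ : ExpGroup k (FreeLieAlgebra k (Fin 2))) :
    subst Φ (0 : L) (0 : L) = 1 := by
  have : (FreeLieAlgebra.lift k ![(0 : L), 0]) = 0 := by
    apply FreeLieAlgebra.hom_ext
    intro i
    rw [FreeLieAlgebra.lift_of_apply]
    fin_cases i <;> rfl
  rw [subst, this, ExpGroup.map_zero_hom]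

lemma subst_swap (A : Associator k) (x y : L) : subst A.Φ y x = (subst A.Φ x y)⁻¹ := by
  have := congrArg (ExpGroup.map (FreeLieAlgebra.lift k ![x, y])) A.duality
  rw [map_subst, map_inv, FreeLieAlgebra.lift_of_apply, FreeLieAlgebra.lift_of_apply] at this
  exact this

end Subst

namespace Associator

variable {k : Type u} [CommRing k] [Algebra ℚ k] (A : Associator k)

/-- The element `Φ (t_12, t_23)` of `exp (t̂_3)`. -/
def phi : ExpT k (Fin 3) := subst A.Φ (DK.t k 0 1) (DK.t k 1 2)

/-- The element `exp (μ t_12 / 2)` of `exp (t̂_2)`. -/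
def halfBraid : ExpT k (Fin 2) := ExpGroup.exp (((1 / 2 : ℚ) • A.μ) • DK.t k 0 1)

section

variable {J : Type} [DecidableEq J] [Fintype J]

lemma ins_phi (φ : J → Option (Fin 3)) :
    ins φ A.phi = subst A.Φ (DK.cableGen k φ 0 1) (DK.cableGen k φ 1 2) := by
  rw [phi, ins, map_subst, DK.cable_t _ (by decide), DK.cable_t _ (by decide)]

lemma ins_halfBraid (φ : J → Option (Fin 2)) :
    ins φ A.halfBraid = ExpGroup.exp (((1 / 2 : ℚ) • A.μ) • DK.cableGen k φ 0 1) := by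
  rw [halfBraid, ins, ExpGroup.map_exp, map_smul, DK.cable_t _ (by decide)]

end

lemma pentagon' :
    ins ![none, some 0, some 1, some 2] A.phi * ins ![some 0, some 1, some 1, some 2] A.phi *
      ins ![some 0, some 1, some 2, none] A.phi =
    ins ![some 0, some 1, some 2, some 2] A.phi * ins ![some 0, some 0, some 1, some 2] A.phi := by
  simp only [ins_phi]
  simpa [DK.cableGen, Finset.sum_filter, Fin.sum_univ_four] using A.pentagon.symm

lemma hexagon_reverse' :
    ins ![some 0, some 0, some 1] A.halfBraid =
      ins ![some 1, some 2, some 0] A.phi * ins ![some 0, none, some 1] A.halfBraid *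
        (ins ![some 0, some 2, some 1] A.phi)⁻¹ * ins ![none, some 0, some 1] A.halfBraid *
          ins ![some 0, some 1, some 2] A.phi := by
  simp only [ins_phi, ins_halfBraid]
  have h1 : DK.t k (2 : Fin 3) 0 = DK.t k 0 2 := DK.t_symm _ _
  have h2 : DK.t k (2 : Fin 3) 1 = DK.t k 1 2 := DK.t_symm _ _
  simpa [DK.cableGen, Finset.sum_filter, Fin.sum_univ_three, h1, h2] using A.hexagon

lemma phi_reverse : ins ![some 2, some 1, some 0] A.phi = A.phi⁻¹ := by
  rw [ins_phi, phi, ← subst_swap]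
  have h1 : DK.t k (2 : Fin 3) 1 = DK.t k 1 2 := DK.t_symm _ _
  have h2 : DK.t k (1 : Fin 3) 0 = DK.t k 0 1 := DK.t_symm _ _
  simp [DK.cableGen, Finset.sum_filter, Fin.sum_univ_three, h1, h2]

lemma halfBraid_swap : ins ![some 1, some 0] A.halfBraid = A.halfBraid := by
  rw [ins_halfBraid, halfBraid]
  have h1 : DK.t k (1 : Fin 2) 0 = DK.t k 0 1 := DK.t_symm _ _
  simp [DK.cableGen, Finset.sum_filter, Fin.sum_univ_two, h1]

lemma hexagon_forward' :
    ins ![some 2, some 0, some 1] A.phi * ins ![some 0, some 1, some 1] A.halfBraid *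
        ins ![some 0, some 1, some 2] A.phi =
      ins ![some 0, none, some 1] A.halfBraid * ins ![some 1, some 0, some 2] A.phi *
        ins ![some 0, some 1, none] A.halfBraid := by
  have h := congrArg (ins (k := k) (![some 2, some 1, some 0] : Fin 3 → Option (Fin 3)))
    A.hexagon_reverse'
  have c : ∀ (κ : Type) [DecidableEq κ] [Fintype κ] (x : ExpT k κ)
      (p : Fin 3 → Option κ) (q : Fin 3 → Option κ),
      (∀ a, q a = ((![some 2, some 1, some 0] : Fin 3 → Option (Fin 3)) a).bind p) →
      ins (![some 2, some 1, some 0] : Fin 3 → Option (Fin 3)) (ins p x) = ins q x := by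
    intro κ _ _ x p q hq
    rw [ins_ins, ← funext hq]
  have e : ∀ p q : Fin 3 → Option (Fin 3),
      (∀ a, q a = (p a).bind ![some 2, some 1, some 0]) →
      ins q A.phi = (ins p A.phi)⁻¹ := by
    intro p q hq
    rw [← map_inv, ← phi_reverse, ins_ins, ← funext hq]
  have e' : ∀ p q : Fin 3 → Option (Fin 2), (∀ a, q a = (p a).bind ![some 1, some 0]) →
      ins q A.halfBraid = ins p A.halfBraid := by
    intro p q hq
    rw [funext hq, ← ins_ins, halfBraid_swap]
  simp only [map_mul, map_inv] at h
  rw [c _ A.halfBraid _ ![some 1, some 0, some 0] (by decide),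
    c _ A.halfBraid _ ![some 1, none, some 0] (by decide),
    c _ A.halfBraid _ ![some 1, some 0, none] (by decide),
    c _ A.phi _ ![some 0, some 2, some 1] (by decide),
    c _ A.phi _ ![some 1, some 2, some 0] (by decide),
    c _ A.phi _ ![some 2, some 1, some 0] (by decide),
    e' ![some 0, some 1, some 1] ![some 1, some 0, some 0] (by decide),
    e' ![some 0, none, some 1] ![some 1, none, some 0] (by decide),
    e' ![some 0, some 1, none] ![some 1, some 0, none] (by decide),
    e ![some 0, some 1, some 2] ![some 2, some 1, some 0] (by decide),
    ← e ![some 1, some 2, some 0] ![some 1, some 0, some 2] (by decide)] at h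
  rw [h, e ![some 0, some 2, some 1] ![some 2, some 0, some 1] (by decide)]
  group

end Associator

section InsLemmas

variable {k : Type u} [CommRing k] [Algebra ℚ k] {ι J : Type} [DecidableEq ι] [Fintype ι]
  [DecidableEq J] [Fintype J]

lemma ins_congr {φ ψ : J → Option ι} (h : ∀ a, φ a = ψ a) (x : ExpT k ι) : ins φ x = ins ψ x := by
  rw [funext h]

end InsLemmas

/-- The objects of the category `PaCD` attached to the associator `A` and the set `S`: the
parenthesized words in `S`. -/
def PaCD {k : Type u} [CommRing k] [Algebra ℚ k] (_A : Associator k) (S : Type v) : Type v :=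
  PaWord S

namespace PaCD

open PaWord

section Homs

variable {k : Type u} [CommRing k] [Algebra ℚ k] {S : Type v}

variable (k) in
/-- The morphisms of `PaCD`: the set `exp (t̂_n) ⋊ {f ∈ S_n | s' ∘ f = s}` for words with letters
`s`, `s'`, of the same length `n`, and the empty set for words of different lengths. -/
abbrev Hm (X Y : PaWord S) : Type u := DecHom (expTFamily k) X.letters Y.letters

/-- The tensor product `(g, f) * (g', f') = (g * g', f * f')`. -/
def tensor {X Y X' Y' : PaWord S} (f : Hm k X Y) (f' : Hm k X' Y') : Hm k (X * X') (Y * Y') where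
  elt := ins (leftPart Y Y') f.elt * ins (rightPart Y Y') f'.elt
  perm := tensorPerm f.perm f'.perm
  comm := pos_cases (fun i => by simp [f.comm]) (fun i => by simp [f'.comm])

/-- The left unit constraint. -/
def lunit (X : PaWord S) : Hm k (1 * X) X where
  elt := 1
  perm := leftUnitPerm X
  comm := pos_cases (fun i => i.elim0) fun i => by simp

/-- The right unit constraint. -/
def runit (X : PaWord S) : Hm k (X * 1) X where
  elt := 1
  perm := rightUnitPerm X
  comm := pos_cases (fun i => by simp) fun i => i.elim0

/-- The associativity constraint, given by the element
`Φ (t_12, t_23) ^ ([n], n + [n'], n + n' + [n''])`. -/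
def assoc (A : Associator k) (X Y Z : PaWord S) : Hm k (X * Y * Z) (X * (Y * Z)) where
  elt := ins (blocks₃ X Y Z) A.phi
  perm := assocPerm X Y Z
  comm := pos_cases (pos_cases (fun i => by simp) fun i => by simp) fun i => by simp

/-- The braiding, given by the element `s_{n, n'} * exp (μ t_12 / 2) ^ ([n], n + [n'])`. -/
def braid (A : Associator k) (X Y : PaWord S) : Hm k (X * Y) (Y * X) where
  elt := (expTFamily k).relabel (swapPerm X Y) (ins (blocks₂ X Y) A.halfBraid)
  perm := swapPerm X Y
  comm := pos_cases (fun i => by simp) fun i => by simp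

lemma hm_ext {X Y : PaWord S} {f g : Hm k X Y} (h : ∀ a, f.perm a = g.perm a)
    (h' : f.elt = g.elt) : f = g :=
  DecHom.ext h' (Equiv.ext h)

lemma tensor_one (X Y : PaWord S) :
    tensor (DecHom.one X.letters : Hm k X X) (DecHom.one Y.letters : Hm k Y Y) =
      DecHom.one (X * Y).letters :=
  hm_ext (pos_cases (fun i => by simp [tensor, DecHom.one])
    fun i => by simp [tensor, DecHom.one]) (by
    simp [tensor, DecHom.one])

lemma left_right_comm {X Y : PaWord S} (a : ExpT k (Fin X.len)) (b : ExpT k (Fin Y.len)) :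
    ins (leftPart X Y) a * ins (rightPart X Y) b = ins (rightPart X Y) b * ins (leftPart X Y) a :=
  ins_comm (pos_cases (fun i => pos_cases (by simp) (by simp))
    fun i => pos_cases (by simp) (by simp)) a b

lemma mul_mul_mul_comm' {G : Type u} [Group G] (a b c d : G) (h : b * c = c * b) :
    a * b * (c * d) = a * c * (b * d) := by
  rw [_root_.mul_assoc, ← _root_.mul_assoc b, h, _root_.mul_assoc, _root_.mul_assoc]

lemma mul_tensor {X Y Z X' Y' Z' : PaWord S} (g : Hm k Y Z) (g' : Hm k Y' Z') (f : Hm k X Y)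
    (f' : Hm k X' Y') :
    DecHom.mul (tensor g g') (tensor f f') = tensor (DecHom.mul g f) (DecHom.mul g' f') := by
  refine hm_ext (pos_cases (fun i => by simp [tensor, DecHom.mul])
    fun i => by simp [tensor, DecHom.mul]) ?_
  simp only [tensor, DecHom.mul, map_mul, ins_ins]
  have e₁ : ∀ a, (some ((tensorPerm g.perm g'.perm).symm a)).bind (leftPart Y Y') =
      (leftPart Z Z' a).bind fun a => some (g.perm.symm a) := pos_cases (by simp) (by simp)
  have e₂ : ∀ a, (some ((tensorPerm g.perm g'.perm).symm a)).bind (rightPart Y Y') =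
      (rightPart Z Z' a).bind fun a => some (g'.perm.symm a) := pos_cases (by simp) (by simp)
  have h' := left_right_comm (ins (fun a => some (g.perm.symm a)) f.elt) g'.elt
  simp only [ins_ins] at h'
  rw [ins_congr e₁, ins_congr e₂]
  exact mul_mul_mul_comm' _ _ _ _ h'.symm

lemma lunit_natural {X Y : PaWord S} (f : Hm k X Y) :
    DecHom.mul (lunit Y) (tensor (DecHom.one (1 : PaWord S).letters) f) =
      DecHom.mul f (lunit X) := by
  refine hm_ext (pos_cases (fun i => i.elim0) fun i => by simp [tensor, DecHom.mul, lunit]) ?_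
  simp only [tensor, DecHom.mul, lunit, DecHom.one, ins_ins, map_one, _root_.one_mul,
    _root_.mul_one]
  refine Eq.trans (ins_congr (fun a => ?_) _) (ins_some _)
  simp

lemma runit_natural {X Y : PaWord S} (f : Hm k X Y) :
    DecHom.mul (runit Y) (tensor f (DecHom.one (1 : PaWord S).letters)) =
      DecHom.mul f (runit X) := by
  refine hm_ext (pos_cases (fun i => by simp [tensor, DecHom.mul, runit]) fun i => i.elim0) ?_
  simp only [tensor, DecHom.mul, runit, DecHom.one, ins_ins, map_one, _root_.one_mul,
    _root_.mul_one]
  refine Eq.trans (ins_congr (fun a => ?_) _) (ins_some _)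
  simp

/-- Case analysis on a position in a product of three words. -/
lemma pos_cases₃ {X Y Z : PaWord S} {P : Fin (X * (Y * Z)).len → Prop}
    (h₁ : ∀ i, P (pos _ _ (Sum.inl i))) (h₂ : ∀ i, P (pos _ _ (Sum.inr (pos _ _ (Sum.inl i)))))
    (h₃ : ∀ i, P (pos _ _ (Sum.inr (pos _ _ (Sum.inr i))))) (a) : P a :=
  pos_cases h₁ (pos_cases h₂ h₃) a

/-- Case analysis on a position in a product of three words. -/
lemma pos_cases₃' {X Y Z : PaWord S} {P : Fin (X * Y * Z).len → Prop}
    (h₁ : ∀ i, P (pos _ _ (Sum.inl (pos _ _ (Sum.inl i)))))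
    (h₂ : ∀ i, P (pos _ _ (Sum.inl (pos _ _ (Sum.inr i)))))
    (h₃ : ∀ i, P (pos _ _ (Sum.inr i))) (a) : P a :=
  pos_cases (pos_cases h₁ h₂) h₃ a

lemma blocks_comm {X Y Z : PaWord S} (a : ExpT k (Fin X.len)) (b : ExpT k (Fin Y.len))
    (c : ExpT k (Fin Z.len)) (x : ExpT k (Fin 3)) :
    (ins (leftPart X (Y * Z)) a * (ins (rightPart X (Y * Z)) (ins (leftPart Y Z) b) *
      ins (rightPart X (Y * Z)) (ins (rightPart Y Z) c))) * ins (blocks₃ X Y Z) x =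
    ins (blocks₃ X Y Z) x * (ins (leftPart X (Y * Z)) a * (ins (rightPart X (Y * Z))
      (ins (leftPart Y Z) b) * ins (rightPart X (Y * Z)) (ins (rightPart Y Z) c))) := by
  refine Commute.mul_left ?_ (Commute.mul_left ?_ ?_)
  · exact ins_comm (pos_cases₃ (fun i => pos_cases₃ (by simp) (by simp) (by simp))
      (fun i => pos_cases₃ (by simp) (by simp) (by simp))
      (fun i => pos_cases₃ (by simp) (by simp) (by simp))) _ _
  · rw [ins_ins]
    exact ins_comm (pos_cases₃ (fun i => pos_cases₃ (by simp) (by simp) (by simp))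
      (fun i => pos_cases₃ (by simp) (by simp) (by simp))
      (fun i => pos_cases₃ (by simp) (by simp) (by simp))) _ _
  · rw [ins_ins]
    exact ins_comm (pos_cases₃ (fun i => pos_cases₃ (by simp) (by simp) (by simp))
      (fun i => pos_cases₃ (by simp) (by simp) (by simp))
      (fun i => pos_cases₃ (by simp) (by simp) (by simp))) _ _

lemma assoc_natural (A : Associator k) {X Y Z X' Y' Z' : PaWord S} (f : Hm k X X')
    (g : Hm k Y Y') (h : Hm k Z Z') :
    DecHom.mul (assoc A X' Y' Z') (tensor (tensor f g) h) =
      DecHom.mul (tensor f (tensor g h)) (assoc A X Y Z) := by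
  refine hm_ext (pos_cases₃' (fun i => by simp [tensor, DecHom.mul, assoc])
    (fun i => by simp [tensor, DecHom.mul, assoc])
    (fun i => by simp [tensor, DecHom.mul, assoc])) ?_
  have key := blocks_comm f.elt g.elt h.elt A.phi
  simp only [ins_ins] at key
  simp only [tensor, DecHom.mul, assoc, map_mul, ins_ins]
  have e : ∀ a, (some ((tensorPerm f.perm (tensorPerm g.perm h.perm)).symm a)).bind
      (blocks₃ X Y Z) = blocks₃ X' Y' Z' a :=
    pos_cases₃ (by simp) (by simp) (by simp)
  rw [ins_congr e, key, _root_.mul_assoc]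
  refine congrArg₂ _ rfl (congrArg₂ _ ?_ ?_)
  · exact ins_congr (pos_cases₃ (by simp) (by simp) (by simp)) _
  · refine congrArg₂ _ ?_ ?_
    · exact ins_congr (pos_cases₃ (by simp) (by simp) (by simp)) _
    · exact ins_congr (pos_cases₃ (by simp) (by simp) (by simp)) _

lemma triangle (A : Associator k) (X Y : PaWord S) :
    DecHom.mul (tensor (DecHom.one X.letters) (lunit Y)) (assoc A X 1 Y) =
      tensor (runit X) (DecHom.one Y.letters) := by
  refine hm_ext (pos_cases₃' (fun i => by simp [tensor, DecHom.mul, assoc, DecHom.one, runit])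
    (fun i => i.elim0)
    (fun i => by simp [tensor, DecHom.mul, assoc, DecHom.one, lunit])) ?_
  simp only [tensor, DecHom.mul, assoc, DecHom.one, lunit, runit, ins_ins, map_one,
    _root_.one_mul, _root_.mul_one]
  rw [Associator.ins_phi]
  have e : ∀ a, (some ((tensorPerm (Equiv.refl _) (leftUnitPerm Y)).symm a)).bind
      (blocks₃ X 1 Y) ≠ some 1 :=
    pos_cases (by simp) (by simp)
  have e' : (Finset.univ.filter fun a =>
      (some ((tensorPerm (Equiv.refl _) (leftUnitPerm Y)).symm a)).bind
      (blocks₃ X 1 Y) = some 1) = ∅ := by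
    rw [Finset.filter_eq_empty_iff]
    exact fun a _ => e a
  rw [DK.cableGen, DK.cableGen, e']
  simp only [Finset.sum_empty, Finset.sum_const_zero]
  exact subst_zero _

/-- The partially defined map attached to four consecutive blocks. -/
def blocks₄ (W X Y Z : PaWord S) (a : Fin (W * (X * (Y * Z))).len) : Option (Fin 4) :=
  Sum.elim (fun _ => some 0) (fun b => (blocks₃ X Y Z b).map Fin.succ)
    ((pos W (X * (Y * Z))).symm a)

/-- Case analysis on a position in a product of four words. -/
lemma pos_cases₄ {W X Y Z : PaWord S} {P : Fin (W * (X * (Y * Z))).len → Prop}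
    (h₀ : ∀ i, P (pos _ _ (Sum.inl i))) (h₁ : ∀ i, P (pos _ _ (Sum.inr (pos _ _ (Sum.inl i)))))
    (h₂ : ∀ i, P (pos _ _ (Sum.inr (pos _ _ (Sum.inr (pos _ _ (Sum.inl i)))))))
    (h₃ : ∀ i, P (pos _ _ (Sum.inr (pos _ _ (Sum.inr (pos _ _ (Sum.inr i))))))) (a) : P a :=
  pos_cases h₀ (pos_cases h₁ (pos_cases h₂ h₃)) a

lemma pentagon (A : Associator k) (W X Y Z : PaWord S) :
    DecHom.mul (DecHom.mul (tensor (DecHom.one W.letters) (assoc A X Y Z)) (assoc A W (X * Y) Z))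
        (tensor (assoc A W X Y) (DecHom.one Z.letters)) =
      DecHom.mul (assoc A W X (Y * Z)) (assoc A (W * X) Y Z) := by
  refine hm_ext (pos_cases (pos_cases₃' (by simp [tensor, DecHom.mul, assoc, DecHom.one])
    (by simp [tensor, DecHom.mul, assoc, DecHom.one])
    (by simp [tensor, DecHom.mul, assoc, DecHom.one]))
    (by simp [tensor, DecHom.mul, assoc, DecHom.one])) ?_
  have key := congrArg (ins (blocks₄ W X Y Z)) A.pentagon'
  simp only [map_mul, ins_ins] at key
  simp only [tensor, DecHom.mul, assoc, DecHom.one, ins_ins, map_one,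
    _root_.one_mul, _root_.mul_one]
  refine Eq.trans ?_ (key.trans ?_)
  · refine congrArg₂ _ ?_ ?_
    · refine congrArg₂ _ ?_ ?_
      · exact ins_congr (pos_cases₄ (by simp [blocks₄]) (by simp [blocks₄]) (by simp [blocks₄])
          (by simp [blocks₄])) _
      · exact ins_congr (pos_cases₄ (by simp [blocks₄]) (by simp [blocks₄]) (by simp [blocks₄])
          (by simp [blocks₄])) _
    · exact ins_congr (pos_cases₄ (by simp [blocks₄]) (by simp [blocks₄]) (by simp [blocks₄])
        (by simp [blocks₄])) _
  · refine congrArg₂ _ ?_ ?_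
    · exact ins_congr (pos_cases₄ (by simp [blocks₄]) (by simp [blocks₄]) (by simp [blocks₄])
        (by simp [blocks₄])) _
    · exact ins_congr (pos_cases₄ (by simp [blocks₄]) (by simp [blocks₄]) (by simp [blocks₄])
        (by simp [blocks₄])) _

lemma braid_natural (A : Associator k) {X Y X' Y' : PaWord S} (f : Hm k X X') (g : Hm k Y Y') :
    DecHom.mul (braid A X' Y') (tensor f g) = DecHom.mul (tensor g f) (braid A X Y) := by
  refine hm_ext (pos_cases (by simp [tensor, DecHom.mul, braid])
    (by simp [tensor, DecHom.mul, braid])) ?_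
  have key : ∀ (a : ExpT k (Fin Y'.len)) (b : ExpT k (Fin X'.len)) (x : ExpT k (Fin 2)),
      ins (leftPart Y' X') a * ins (rightPart Y' X') b *
        ins (fun i => blocks₂ X' Y' (swapPerm Y' X' i)) x =
      ins (fun i => blocks₂ X' Y' (swapPerm Y' X' i)) x *
        (ins (leftPart Y' X') a * ins (rightPart Y' X') b) := by
    intro a b x
    refine Commute.mul_left ?_ ?_
    · exact ins_comm (pos_cases (fun i => pos_cases (by simp) (by simp))
        (fun i => pos_cases (by simp) (by simp))) _ _
    · exact ins_comm (pos_cases (fun i => pos_cases (by simp) (by simp))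
        (fun i => pos_cases (by simp) (by simp))) _ _
  simp only [tensor, DecHom.mul, braid, map_mul, ins_ins]
  have e : ∀ a, (some ((tensorPerm g.perm f.perm).symm a)).bind
      (fun b => (some ((swapPerm X Y).symm b)).bind (blocks₂ X Y)) =
        blocks₂ X' Y' (swapPerm Y' X' a) :=
    pos_cases (by simp) (by simp)
  rw [ins_congr e, key, left_right_comm]
  have e₁ : ∀ a, (some ((swapPerm X' Y').symm a)).bind (leftPart X' Y') = rightPart Y' X' a :=
    pos_cases (by simp) (by simp)
  have e₂ : ∀ a, (some ((swapPerm X' Y').symm a)).bind (rightPart X' Y') = leftPart Y' X' a :=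
    pos_cases (by simp) (by simp)
  have e₃ : ∀ a, (some ((swapPerm X' Y').symm a)).bind (blocks₂ X' Y') =
      blocks₂ X' Y' (swapPerm Y' X' a) := pos_cases (by simp) (by simp)
  rw [ins_congr e₁, ins_congr e₂, ins_congr e₃]

lemma hexagon₁ (A : Associator k) (X Y Z : PaWord S) :
    DecHom.mul (DecHom.mul (assoc A Y Z X) (braid A X (Y * Z))) (assoc A X Y Z) =
      DecHom.mul (DecHom.mul (tensor (DecHom.one Y.letters) (braid A X Z)) (assoc A Y X Z))
        (tensor (braid A X Y) (DecHom.one Z.letters)) := by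
  refine hm_ext (pos_cases₃' (by simp [tensor, DecHom.mul, assoc, braid, DecHom.one])
    (by simp [tensor, DecHom.mul, assoc, braid, DecHom.one])
    (by simp [tensor, DecHom.mul, assoc, braid, DecHom.one])) ?_
  have key := congrArg (ins (fun a => (blocks₃ Y Z X a).bind ![some 1, some 2, some 0]))
    A.hexagon_forward'
  simp only [map_mul, ins_ins] at key
  simp only [tensor, DecHom.mul, assoc, braid, DecHom.one, ins_ins, map_one,
    _root_.one_mul, _root_.mul_one]
  refine Eq.trans ?_ (key.trans ?_)
  · refine congrArg₂ _ ?_ ?_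
    · refine congrArg₂ _ ?_ ?_
      · exact ins_congr (pos_cases₃ (by simp) (by simp) (by simp)) _
      · exact ins_congr (pos_cases₃ (by simp) (by simp) (by simp)) _
    · exact ins_congr (pos_cases₃ (by simp) (by simp) (by simp)) _
  · refine congrArg₂ _ ?_ ?_
    · refine congrArg₂ _ ?_ ?_
      · exact ins_congr (pos_cases₃ (by simp) (by simp) (by simp)) _
      · exact ins_congr (pos_cases₃ (by simp) (by simp) (by simp)) _
    · exact ins_congr (pos_cases₃ (by simp) (by simp) (by simp)) _

lemma hexagon₂ (A : Associator k) (X Y Z : PaWord S) :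
    DecHom.mul (DecHom.mul (DecHom.inv (assoc A Z X Y)) (braid A (X * Y) Z))
        (DecHom.inv (assoc A X Y Z)) =
      DecHom.mul (DecHom.mul (tensor (braid A X Z) (DecHom.one Y.letters))
        (DecHom.inv (assoc A X Z Y))) (tensor (DecHom.one X.letters) (braid A Y Z)) := by
  refine hm_ext (pos_cases₃ (by simp [tensor, DecHom.mul, DecHom.inv, assoc, braid, DecHom.one])
    (by simp [tensor, DecHom.mul, DecHom.inv, assoc, braid, DecHom.one])
    (by simp [tensor, DecHom.mul, DecHom.inv, assoc, braid, DecHom.one])) ?_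
  have key₀ : (ins ![some 1, some 2, some 0] A.phi)⁻¹ * ins ![some 0, some 0, some 1] A.halfBraid *
      (ins ![some 0, some 1, some 2] A.phi)⁻¹ = ins ![some 0, none, some 1] A.halfBraid *
        (ins ![some 0, some 2, some 1] A.phi)⁻¹ * ins ![none, some 0, some 1] A.halfBraid := by
    rw [A.hexagon_reverse']
    group
  have key := congrArg (ins (fun a => (blocks₃ Z X Y (assocPerm Z X Y a)).bind
    ![some 2, some 0, some 1])) key₀
  simp only [map_mul, map_inv, ins_ins] at key
  simp only [tensor, DecHom.mul, DecHom.inv, assoc, braid, DecHom.one, map_inv, ins_ins, map_one,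
    _root_.one_mul, _root_.mul_one]
  refine Eq.trans ?_ (key.trans ?_)
  · refine congrArg₂ _ (congrArg₂ _ (congrArg _ ?_) ?_) (congrArg _ ?_)
    · exact ins_congr (pos_cases₃' (by simp) (by simp) (by simp)) _
    · exact ins_congr (pos_cases₃' (by simp) (by simp) (by simp)) _
    · exact ins_congr (pos_cases₃' (by simp) (by simp) (by simp)) _
  · refine congrArg₂ _ (congrArg₂ _ ?_ (congrArg _ ?_)) ?_
    · exact ins_congr (pos_cases₃' (by simp) (by simp) (by simp)) _
    · exact ins_congr (pos_cases₃' (by simp) (by simp) (by simp)) _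
    · exact ins_congr (pos_cases₃' (by simp) (by simp) (by simp)) _

end Homs

variable {k : Type u} [CommRing k] [Algebra ℚ k] (A : Associator k) (S : Type v)

instance : Category.{u} (PaCD A S) where
  Hom X Y := Hm k (S := S) X Y
  id X := DecHom.one (PaWord.letters (S := S) X)
  comp f g := DecHom.mul g f
  id_comp f := DecHom.mul_one f
  comp_id f := DecHom.one_mul f
  assoc f g h := (DecHom.mul_assoc h g f).symm

variable {A S} in
/-- All morphisms of `PaCD` are invertible. -/
def isoMk {X Y : PaCD A S} (f : X ⟶ Y) : X ≅ Y where
  hom := f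
  inv := DecHom.inv f
  hom_inv_id := DecHom.inv_mul f
  inv_hom_id := DecHom.mul_inv f

instance : MonoidalCategoryStruct (PaCD A S) where
  tensorObj X Y := HMul.hMul (α := PaWord S) (β := PaWord S) X Y
  tensorUnit := (1 : PaWord S)
  tensorHom f g := tensor f g
  whiskerLeft X _ _ f := tensor (DecHom.one (PaWord.letters (S := S) X)) f
  whiskerRight f Y := tensor f (DecHom.one (PaWord.letters (S := S) Y))
  associator X Y Z := isoMk (assoc A X Y Z)
  leftUnitor X := isoMk (lunit X)
  rightUnitor X := isoMk (runit X)

instance : MonoidalCategory (PaCD A S) := MonoidalCategory.ofTensorHom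
  (id_tensorHom_id := fun X Y => tensor_one X Y)
  (id_tensorHom := fun _ _ _ _ => rfl)
  (tensorHom_id := fun _ _ => rfl)
  (tensorHom_comp_tensorHom := fun f g f' g' => mul_tensor f' g' f g)
  (associator_naturality := fun f g h => assoc_natural A f g h)
  (leftUnitor_naturality := fun f => lunit_natural f)
  (rightUnitor_naturality := fun f => runit_natural f)
  (pentagon := fun W X Y Z => pentagon A W X Y Z)
  (triangle := fun X Y => triangle A X Y)

instance : BraidedCategory (PaCD A S) where
  braiding X Y := isoMk (braid A X Y)
  braiding_naturality_right X _ _ f := braid_natural A (DecHom.one (PaWord.letters (S := S) X)) f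
  braiding_naturality_left f Z := braid_natural A f (DecHom.one (PaWord.letters (S := S) Z))
  hexagon_forward X Y Z := hexagon₁ A X Y Z
  hexagon_reverse X Y Z := hexagon₂ A X Y Z

end PaCD

/-! ## Half-balanced braided monoidal categories and their contractions -/

/-- A functor `* : C ⥤ C` and isomorphisms `a_X : X ≅ X*`, for `C` a braided monoidal category. -/
structure HalfBalanceData (C : Type v) [Category.{u} C] where
  /-- The functor `*`. -/
  star : C ⥤ C
  /-- The isomorphisms `a_X : X ≅ X*`. -/
  a : ∀ X : C, X ≅ star.obj X

namespace HalfBalanceData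

variable {C : Type v} [Category.{u} C] [MonoidalCategory C] [BraidedCategory C]

/-- The axioms of a half-balanced structure. All the equalities between objects are strict;
`eqToHom` is the identity morphism between equal objects. -/
structure IsHalfBalanced (H : HalfBalanceData C) : Prop where
  /-- The functor `*` is an involution. -/
  star_star : H.star ⋙ H.star = 𝟭 C
  /-- `(X ⊗ Y)* = Y* ⊗ X*`. -/
  star_tensor : ∀ X Y : C, H.star.obj (X ⊗ Y) = H.star.obj Y ⊗ H.star.obj X
  /-- `(f ⊗ g)* = g* ⊗ f*`. -/
  star_tensorHom : ∀ {X X' Y Y' : C} (f : X ⟶ X') (g : Y ⟶ Y'),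
    H.star.map (f ⊗ₘ g) = eqToHom (star_tensor X Y) ≫ (H.star.map g ⊗ₘ H.star.map f) ≫
      eqToHom (star_tensor X' Y').symm
  /-- `(a_X)* = a_{X*}`. -/
  star_a : ∀ X : C, H.star.map (H.a X).hom = (H.a (H.star.obj X)).hom
  /-- `(β_{X, Y})* = β_{Y*, X*}`. -/
  star_braiding : ∀ X Y : C, H.star.map (β_ X Y).hom = eqToHom (star_tensor X Y) ≫
    (β_ (H.star.obj Y) (H.star.obj X)).hom ≫ eqToHom (star_tensor Y X).symm
  /-- The image under `*` of the associativity constraint of `X, Y, Z` is the associativity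
  constraint of `Z*, Y*, X*`, oriented as it has to be: from `Z* ⊗ (Y* ⊗ X*)` to
  `(Z* ⊗ Y*) ⊗ X*`. -/
  star_associator : ∀ X Y Z : C, H.star.map (α_ X Y Z).hom =
    eqToHom ((star_tensor (X ⊗ Y) Z).trans
        (congrArg (fun W => H.star.obj Z ⊗ W) (star_tensor X Y))) ≫
      (α_ (H.star.obj Z) (H.star.obj Y) (H.star.obj X)).inv ≫
        eqToHom ((star_tensor X (Y ⊗ Z)).trans
          (congrArg (fun W => W ⊗ H.star.obj X) (star_tensor Y Z))).symm
  /-- Naturality: `a_Y φ = φ* a_X`. -/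
  a_natural : ∀ {X Y : C} (φ : X ⟶ Y), φ ≫ (H.a Y).hom = (H.a X).hom ≫ H.star.map φ
  /-- `a_{X ⊗ Y} = (a_Y ⊗ a_X) β_{X, Y}`. -/
  a_tensor : ∀ X Y : C, (H.a (X ⊗ Y)).hom =
    (β_ X Y).hom ≫ ((H.a Y).hom ⊗ₘ (H.a X).hom) ≫ eqToHom (star_tensor X Y).symm

/-- The balanced structure `θ_X = a_{X*} a_X` attached to a half-balanced structure. -/
def balance {H : HalfBalanceData C} (h : H.IsHalfBalanced) (X : C) : X ≅ X :=
  H.a X ≪≫ H.a (H.star.obj X) ≪≫ eqToIso (congrArg (fun F : C ⥤ C => F.obj X) h.star_star)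

end HalfBalanceData

section Contraction

variable {C : Type v} [Category.{u} C] [MonoidalCategory C] [BraidedCategory C]
  {O : Type v₁} [Category.{u₁} O]

/-- The axioms of a (balanced) contraction `F`, for the balanced structure `θ` on `C`. -/
structure IsBalancedContraction (θ : ∀ X : C, X ≅ X) (F : C ⥤ O) : Prop where
  /-- `⟨X ⊗ Y⟩ = ⟨Y ⊗ X⟩`. -/
  obj_swap : ∀ X Y : C, F.obj (X ⊗ Y) = F.obj (Y ⊗ X)
  /-- `⟨(θ_Y ⊗ id_X) β_{X, Y}⟩ = id`. -/
  map_swap : ∀ X Y : C, F.map ((β_ X Y).hom ≫ ((θ Y).hom ⊗ₘ 𝟙 X)) = eqToHom (obj_swap X Y)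
  /-- `⟨(X ⊗ Y) ⊗ Z⟩ = ⟨X ⊗ (Y ⊗ Z)⟩`. -/
  obj_assoc : ∀ X Y Z : C, F.obj ((X ⊗ Y) ⊗ Z) = F.obj (X ⊗ (Y ⊗ Z))
  /-- The image of the associativity constraint is the identity. -/
  map_assoc : ∀ X Y Z : C, F.map (α_ X Y Z).hom = eqToHom (obj_assoc X Y Z)

/-- The axioms of a half-balanced contraction `F`. -/
structure IsHalfBalancedContraction {H : HalfBalanceData C} (h : H.IsHalfBalanced)
    (F : C ⥤ O) : Prop extends IsBalancedContraction (HalfBalanceData.balance h) F where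
  /-- `⟨X⟩ = ⟨X*⟩`. -/
  obj_star : ∀ X : C, F.obj X = F.obj (H.star.obj X)
  /-- `⟨a_X⟩ = id`. -/
  map_a : ∀ X : C, F.map (H.a X).hom = eqToHom (obj_star X)

end Contraction

/-! ## Quotients of categories by group actions -/

/-- An action of the group `G` on the category `C`: an action on the set of objects, and
isomorphisms `i g X : X ≅ g • X`, with `i (g * h) X = i g (h • X) ∘ i h X`. -/
structure CatAction (G : Type w) [Group G] (C : Type v) [Category.{u} C] extends
    MulAction G C where
  /-- The isomorphisms `X ≅ g • X`. -/
  i : ∀ (g : G) (X : C), X ≅ g • X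
  i_mul : ∀ (g h : G) (X : C), (i (g * h) X).hom =
    (i h X).hom ≫ (i g (h • X)).hom ≫ eqToHom (mul_smul g h X).symm

namespace CatAction

variable {G : Type w} [Group G] {C : Type v} [Category.{u} C] (α : CatAction G C)

/-- The set of orbits of objects. -/
def Orb : Type v := Quotient (@MulAction.orbitRel G C _ α.toMulAction)

/-- The orbit of an object. -/
def orb (X : C) : α.Orb := Quotient.mk _ X

lemma orb_smul (g : G) (X : C) : α.orb X = α.orb (letI := α.toMulAction; g • X) :=
  letI := α.toMulAction
  (Quotient.sound (MulAction.orbitRel_apply.2 (MulAction.mem_orbit X g))).symm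

/-- The morphisms of `C`, viewed as arrows between orbits. -/
inductive Arrow : α.Orb → α.Orb → Type (max u v)
  | mk {X Y : C} (f : X ⟶ Y) : Arrow (α.orb X) (α.orb Y)

instance : Quiver α.Orb := ⟨α.Arrow⟩

/-- The arrow between orbits given by a morphism, viewed in the free category. -/
def arrow {X Y : C} (f : X ⟶ Y) :
    (Paths.of α.Orb).obj (α.orb X) ⟶ (Paths.of α.Orb).obj (α.orb Y) :=
  (Paths.of α.Orb).map (Arrow.mk f : α.orb X ⟶ α.orb Y)

/-- The relations of the quotient category: compatibility with identities and composition, and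
triviality of all the `i g X`. -/
inductive Rel : HomRel (Paths α.Orb)
  | id (X : C) : Rel (α.arrow (𝟙 X)) (𝟙 _)
  | comp {X Y Z : C} (f : X ⟶ Y) (g : Y ⟶ Z) : Rel (α.arrow (f ≫ g)) (α.arrow f ≫ α.arrow g)
  | act (g : G) (X : C) : Rel (α.arrow (α.i g X).hom)
      (eqToHom (congrArg (Paths.of α.Orb).obj (α.orb_smul g X)))

/-- The quotient category `C / G`. Its objects are the orbits of objects of `C`; its morphisms are
generated by those of `C`, the `i g X` being identified with identities, so that a functor from
`C / G` is the same as a functor `F` from `C`, such that `F (g • X) = F X` and `F (i g X)` is the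
identity of `F X`, for all `g` and `X`. -/
abbrev QuotCat : Type v := CategoryTheory.Quotient α.Rel

/-- The quotient functor `C ⥤ C / G`. -/
def quotFunctor : C ⥤ α.QuotCat where
  obj X := (CategoryTheory.Quotient.functor α.Rel).obj ((Paths.of α.Orb).obj (α.orb X))
  map f := (CategoryTheory.Quotient.functor α.Rel).map (α.arrow f)
  map_id X := (CategoryTheory.Quotient.sound _ (Rel.id X)).trans (CategoryTheory.Functor.map_id _ _)
  map_comp f g := (CategoryTheory.Quotient.sound _ (Rel.comp f g)).trans (CategoryTheory.Functor.map_comp _ _ _)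

lemma quotFunctor_obj (g : G) (X : C) :
    α.quotFunctor.obj X = α.quotFunctor.obj (letI := α.toMulAction; g • X) :=
  congrArg (fun o => (CategoryTheory.Quotient.functor α.Rel).obj ((Paths.of α.Orb).obj o))
    (α.orb_smul g X)

lemma quotFunctor_i (g : G) (X : C) :
    α.quotFunctor.map (α.i g X).hom = eqToHom (α.quotFunctor_obj g X) :=
  (CategoryTheory.Quotient.sound _ (Rel.act g X)).trans (eqToHom_map _ _)

end CatAction

/-! ## Planar trees and the category `PaDih` -/

namespace PaWord

variable {L : Type v} {M : Type w}

/-- The list of leaves of a nonempty word. -/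
def magmaLeaves : FreeMagma L → List L
  | .of s => [s]
  | .mul x y => magmaLeaves x ++ magmaLeaves y

/-- The list of leaves, from left to right. -/
def leaves (X : PaWord L) : List L :=
  WithOne.recOneCoe (motive := fun _ => List L) [] magmaLeaves X

lemma leaves_mul (X Y : PaWord L) : (X * Y).leaves = X.leaves ++ Y.leaves := by
  induction X using WithOne.recOneCoe with
  | one => rw [MulOneClass.one_mul]; rfl
  | coe x =>
    induction Y using WithOne.recOneCoe with
    | one => exact (List.append_nil _).symm
    | coe y => rfl

/-- The mirror image of a nonempty word. -/
def magmaMirror : FreeMagma L → FreeMagma L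
  | .of s => .of s
  | .mul x y => .mul (magmaMirror y) (magmaMirror x)

/-- The mirror image of a parenthesized word. -/
def mirror (X : PaWord L) : PaWord L :=
  WithOne.recOneCoe (motive := fun _ => PaWord L) 1 (fun x => (magmaMirror x : PaWord L)) X

lemma mirror_mul (X Y : PaWord L) : (X * Y).mirror = Y.mirror * X.mirror := by
  induction X using WithOne.recOneCoe with
  | one => rw [MulOneClass.one_mul]; exact (MulOneClass.mul_one _).symm
  | coe x =>
    induction Y using WithOne.recOneCoe with
    | one => exact (MulOneClass.one_mul _).symm
    | coe y => rfl

/-- Change of the labels of the leaves of a nonempty word. -/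
def magmaMap (f : L → M) : FreeMagma L → FreeMagma M
  | .of s => .of (f s)
  | .mul x y => .mul (magmaMap f x) (magmaMap f y)

/-- Change of the labels of the leaves. -/
def map (f : L → M) (X : PaWord L) : PaWord M :=
  WithOne.recOneCoe (motive := fun _ => PaWord M) 1 (fun x => (magmaMap f x : PaWord M)) X

lemma map_mul (f : L → M) (X Y : PaWord L) : (X * Y).map f = X.map f * Y.map f := by
  induction X using WithOne.recOneCoe with
  | one => rw [MulOneClass.one_mul]; exact (MulOneClass.one_mul _).symm
  | coe x =>
    induction Y using WithOne.recOneCoe with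
    | one => exact (MulOneClass.mul_one _).symm
    | coe y => rfl

/-- Induction on parenthesized words. -/
@[elab_as_elim]
lemma induct {P : PaWord L → Prop} (one : P 1) (letter : ∀ s, P (FreeMagma.of s : FreeMagma L))
    (mul : ∀ X Y, P X → P Y → P (X * Y)) (X : PaWord L) : P X := by
  induction X using WithOne.recOneCoe with
  | one => exact one
  | coe x =>
    induction x with
    | ih1 s => exact letter s
    | ih2 x y hx hy => exact mul _ _ hx hy

lemma leaves_map (f : L → M) (X : PaWord L) : (X.map f).leaves = X.leaves.map f :=
  induct rfl (fun _ => rfl)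
    (fun X Y hX hY => by rw [map_mul, leaves_mul, leaves_mul, List.map_append, hX, hY]) X

lemma leaves_mirror (X : PaWord L) : X.mirror.leaves = X.leaves.reverse :=
  induct rfl (fun _ => rfl)
    (fun X Y hX hY => by rw [mirror_mul, leaves_mul, leaves_mul, List.reverse_append, hX, hY]) X

lemma mirror_mirror (X : PaWord L) : X.mirror.mirror = X :=
  induct rfl (fun _ => rfl) (fun X Y hX hY => by rw [mirror_mul, mirror_mul, hX, hY]) X

lemma map_mirror (f : L → M) (X : PaWord L) : X.mirror.map f = (X.map f).mirror :=
  induct rfl (fun _ => rfl)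
    (fun X Y hX hY => by rw [mirror_mul, map_mul, map_mul, mirror_mul, hX, hY]) X

lemma map_id (X : PaWord L) : X.map id = X :=
  induct rfl (fun _ => rfl) (fun X Y hX hY => by rw [map_mul, hX, hY]) X

lemma map_comp {N : Type*} (g : M → N) (f : L → M) (X : PaWord L) :
    (X.map f).map g = X.map (g ∘ f) :=
  induct rfl (fun _ => rfl) (fun X Y hX hY => by rw [map_mul, map_mul, map_mul, hX, hY]) X

/-- The word obtained from a nonempty word, by replacing its letters from left to right by those of
the sequence `f`. -/
def magmaReplace : (x : FreeMagma L) → (Fin x.length → M) → FreeMagma M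
  | .of _, f => .of (f ⟨0, Nat.one_pos⟩)
  | .mul x y, f => .mul (magmaReplace x fun i => f (Fin.castAdd y.length i))
      (magmaReplace y fun i => f (Fin.natAdd x.length i))

/-- The word obtained by replacing the letters, from left to right, by the numbers of their
positions (starting from `0`). -/
def number (X : PaWord L) : PaWord (Fin X.len) :=
  WithOne.recOneCoe (motive := fun X : PaWord L => PaWord (Fin X.len)) 1
    (fun x => ((magmaReplace x id : FreeMagma (Fin x.length)) : PaWord (Fin x.length))) X

lemma leaves_magmaReplace (x : FreeMagma L) (f : Fin x.length → M) :
    magmaLeaves (magmaReplace x f) = List.ofFn f := by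
  induction x with
  | ih1 s => rfl
  | ih2 x y hx hy =>
    refine (congrArg₂ _ (hx _) (hy _)).trans ?_
    rw [← List.ofFn_fin_append]
    exact congrArg List.ofFn (Fin.append_castAdd_natAdd (f := f))

lemma leaves_number (X : PaWord L) : X.number.leaves = List.finRange X.len := by
  induction X using WithOne.recOneCoe with
  | one => rfl
  | coe x => exact (leaves_magmaReplace x id).trans (List.ofFn_id _)

end PaWord

/-- The moves of the root of a rooted planar binary tree, along the edges of the underlying
unrooted planar tree (the root being inserted in the middle of an edge). -/
inductive RootMove {L : Type v} : PaWord L → PaWord L → Prop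
  | swap (X Y : PaWord L) : RootMove (X * Y) (Y * X)
  | shift (X Y Z : PaWord L) : RootMove (X * Y * Z) (X * (Y * Z))

/-- Planar 3-valent trees with leaves labelled by `L`: rooted planar binary trees, up to moves of
the root. -/
def PlaneTree (L : Type v) : Type v := Quot (RootMove (L := L))

namespace PlaneTree

variable {L : Type v} {M : Type w}

/-- The tree obtained by replacing the root and the edges connected to it by a single edge. -/
def unroot (X : PaWord L) : PlaneTree L := Quot.mk _ X

/-- The labels of the leaves, in cyclic order. -/
def leafCycle : PlaneTree L → Cycle L :=
  Quot.lift (fun X => (X.leaves : Cycle L)) (by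
    rintro _ _ (⟨X, Y⟩ | ⟨X, Y, Z⟩)
    · rw [PaWord.leaves_mul, PaWord.leaves_mul]
      exact Quot.sound ⟨X.leaves.length, List.rotate_append_length_eq _ _⟩
    · simp only [PaWord.leaves_mul, List.append_assoc])

/-- Change of the labels of the leaves. -/
def map (f : L → M) : PlaneTree L → PlaneTree M :=
  Quot.map (PaWord.map f) (by
    rintro _ _ (⟨X, Y⟩ | ⟨X, Y, Z⟩)
    · rw [PaWord.map_mul, PaWord.map_mul]; exact .swap _ _
    · simp only [PaWord.map_mul]; exact .shift _ _ _)

/-- The mirror image. -/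
def mirror : PlaneTree L → PlaneTree L :=
  Quot.lift (fun X => unroot X.mirror) (by
    rintro _ _ (⟨X, Y⟩ | ⟨X, Y, Z⟩)
    · rw [PaWord.mirror_mul, PaWord.mirror_mul]; exact Quot.sound (.swap _ _)
    · simp only [PaWord.mirror_mul]; exact (Quot.sound (.shift _ _ _)).symm)

lemma leafCycle_map (f : L → M) (T : PlaneTree L) : (T.map f).leafCycle = T.leafCycle.map f := by
  induction T using Quot.ind with
  | mk X => exact congrArg _ (PaWord.leaves_map f X)

lemma leafCycle_mirror (T : PlaneTree L) : T.mirror.leafCycle = T.leafCycle.reverse := by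
  induction T using Quot.ind with
  | mk X => exact congrArg _ (PaWord.leaves_mirror X)

lemma mirror_mirror (T : PlaneTree L) : T.mirror.mirror = T := by
  induction T using Quot.ind with
  | mk X => exact congrArg _ (PaWord.mirror_mirror X)

lemma map_mirror (f : L → M) (T : PlaneTree L) : T.mirror.map f = (T.map f).mirror := by
  induction T using Quot.ind with
  | mk X => exact congrArg _ (PaWord.map_mirror f X)

lemma map_id (T : PlaneTree L) : T.map id = T := by
  induction T using Quot.ind with
  | mk X => exact congrArg _ (PaWord.map_id X)

lemma map_comp {N : Type*} (g : M → N) (f : L → M) (T : PlaneTree L) :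
    (T.map f).map g = T.map (g ∘ f) := by
  induction T using Quot.ind with
  | mk X => exact congrArg _ (PaWord.map_comp g f X)

end PlaneTree

/-- Planar 3-valent trees, together with a bijection of the set of leaves with `[n]` which is
compatible with the cyclic orders. -/
def PlT (n : ℕ) : Type :=
  {T : PlaneTree (Fin n) // T.leafCycle = (List.finRange n : Cycle (Fin n))}

/-- The map from parenthesizations to planar trees: the leaves are numbered from left to right, and
the root is forgotten. -/
def PlT.ofWord {S : Type v} (X : PaWord S) : PlT X.len :=
  ⟨PlaneTree.unroot X.number, congrArg _ X.leaves_number⟩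

section Dihedral

/-- The infinite dihedral group, with generators `r` and `s` satisfying `s ^ 2 = (r * s) ^ 2 = 1`;
here, `r i = r ^ i` and `sr i = s * r ^ i`. -/
abbrev DihInf : Type := DihedralGroup 0

/-- The reflections. -/
def DihInf.isRefl : DihInf → Bool
  | .r _ => false
  | .sr _ => true

/-- The morphism from the infinite dihedral group to the symmetric group, which takes `r` to
`i ↦ i + 1` mod `n`, and `s` to the reversal. -/
def dihPerm (n : ℕ) : DihInf → Equiv.Perm (Fin n)
  | .r i => finRotate n ^ (show ℤ from i)
  | .sr i => Fin.revPerm * finRotate n ^ (show ℤ from i)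

lemma rev_finRotate (n : ℕ) :
    (Fin.revPerm : Equiv.Perm (Fin n)) * finRotate n = (finRotate n)⁻¹ * Fin.revPerm := by
  rw [eq_inv_mul_iff_mul_eq]
  ext i : 1
  have : NeZero n := ⟨fun h => (h ▸ i).elim0⟩
  simp only [Equiv.Perm.mul_apply, Fin.revPerm_apply, finRotate_apply]
  rw [Fin.rev_add]
  exact sub_add_cancel _ _

lemma rev_finRotate_zpow (n : ℕ) (i : ℤ) :
    (Fin.revPerm : Equiv.Perm (Fin n)) * finRotate n ^ i = finRotate n ^ (-i) * Fin.revPerm := by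
  rw [zpow_neg, ← inv_zpow]
  exact (SemiconjBy.zpow_right (rev_finRotate n) i)

lemma rev_rev (n : ℕ) : (Fin.revPerm : Equiv.Perm (Fin n)) * Fin.revPerm = 1 := by
  ext i : 1
  exact Fin.rev_rev i

lemma dihPerm_mul (n : ℕ) (g h : DihInf) : dihPerm n (g * h) = dihPerm n g * dihPerm n h := by
  rcases g with (i : ℤ) | (i : ℤ) <;> rcases h with (j : ℤ) | (j : ℤ)
  · exact zpow_add _ _ _
  · change Fin.revPerm * finRotate n ^ (j - i) = finRotate n ^ i * (Fin.revPerm * finRotate n ^ j)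
    rw [← mul_assoc, ← neg_neg i, ← rev_finRotate_zpow, mul_assoc, ← zpow_add]
    congr 2; ring
  · exact (congrArg _ (zpow_add _ _ _)).trans (mul_assoc _ _ _).symm
  · change finRotate n ^ (j - i) = Fin.revPerm * finRotate n ^ i * (Fin.revPerm * finRotate n ^ j)
    rw [rev_finRotate_zpow, mul_assoc, ← mul_assoc Fin.revPerm, rev_rev, one_mul, ← zpow_add]
    congr 1; ring

lemma isRefl_mul (g h : DihInf) : (g * h).isRefl = xor g.isRefl h.isRefl := by
  rcases g with i | i <;> rcases h with j | j <;> rfl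

lemma cycle_map_finRotate (n : ℕ) :
    (List.finRange n : Cycle (Fin n)).map (finRotate n) = (List.finRange n : Cycle (Fin n)) := by
  refine (Quot.sound ⟨1, ?_⟩ : ((List.finRange n : List (Fin n)) : Cycle (Fin n)) =
    ((List.finRange n).map (finRotate n) : List (Fin n))).symm
  refine List.ext_getElem (by simp) fun i h₁ h₂ => ?_
  have hi : i < n := by simpa using h₁
  have : NeZero n := ⟨by omega⟩
  rw [List.getElem_rotate, List.getElem_map, List.getElem_finRange, List.getElem_finRange,
    finRotate_apply]
  ext
  simp [Fin.val_add]

lemma cycle_map_mul {n : ℕ} (f g : Equiv.Perm (Fin n)) (c : Cycle (Fin n)) :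
    c.map (f * g : Equiv.Perm (Fin n)) = (c.map g).map f := by
  induction c using Quotient.inductionOn' with
  | h l =>
    refine congrArg (fun l : List (Fin n) => (l : Cycle (Fin n))) ?_
    rw [Equiv.Perm.coe_mul, List.map_map]

lemma cycle_map_finRotate_zpow (n : ℕ) (i : ℤ) :
    (List.finRange n : Cycle (Fin n)).map (finRotate n ^ i : Equiv.Perm (Fin n)) =
      (List.finRange n : Cycle (Fin n)) := by
  have h1 : ∀ c : Cycle (Fin n), c.map (1 : Equiv.Perm (Fin n)) = c := by
    intro c
    induction c using Quotient.inductionOn' with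
    | h l => exact congrArg _ (List.map_id l)
  induction i using Int.induction_on with
  | zero => rw [zpow_zero, h1]
  | succ i hi => rw [zpow_add_one, cycle_map_mul, cycle_map_finRotate, hi]
  | pred i hi =>
    have h := congrArg (Cycle.map ((finRotate n)⁻¹ : Equiv.Perm (Fin n))) (cycle_map_finRotate n)
    rw [← cycle_map_mul, inv_mul_cancel, h1] at h
    rw [zpow_sub_one, cycle_map_mul, ← h, hi]

lemma cycle_reverse_map_rev (n : ℕ) :
    ((List.finRange n : Cycle (Fin n)).reverse).map (Fin.revPerm : Equiv.Perm (Fin n)) =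
      (List.finRange n : Cycle (Fin n)) := by
  refine congrArg (fun l : List (Fin n) => (l : Cycle (Fin n))) (?_ :
    (List.finRange n).reverse.map Fin.revPerm = List.finRange n)
  refine List.ext_getElem (by simp) fun i h₁ h₂ => ?_
  have hi : i < n := by simpa using h₂
  ext
  simp only [List.getElem_map, List.getElem_reverse, List.getElem_finRange, List.length_finRange,
    Fin.revPerm_apply, Fin.val_rev, Fin.val_cast]
  omega

/-- The action of the infinite dihedral group on `PlT n`: the labels of the leaves are changed by
the corresponding permutation, and for a reflection, the mirror image of the tree is taken, so that
the labels remain compatible with the cyclic order. -/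
def PlT.act {n : ℕ} (g : DihInf) (T : PlT n) : PlT n :=
  ⟨(if g.isRefl then T.1.mirror else T.1).map (dihPerm n g), by
    rw [PlaneTree.leafCycle_map]
    rcases g with i | i
    · exact (congrArg _ T.2).trans (cycle_map_finRotate_zpow n i)
    · have h : (if DihInf.isRefl (.sr i) then T.1.mirror else T.1) = T.1.mirror := rfl
      rw [h, PlaneTree.leafCycle_mirror, T.2]
      have h' : dihPerm n (.sr i) = finRotate n ^ (-(show ℤ from i)) * Fin.revPerm :=
        rev_finRotate_zpow n i
      rw [h', cycle_map_mul, cycle_reverse_map_rev, cycle_map_finRotate_zpow]⟩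

lemma PlT.one_act {n : ℕ} (T : PlT n) : PlT.act 1 T = T :=
  Subtype.ext ((congrArg (fun σ : Equiv.Perm (Fin n) => T.1.map σ) (zpow_zero (finRotate n))).trans
    (PlaneTree.map_id T.1))

lemma PlT.mul_act {n : ℕ} (g h : DihInf) (T : PlT n) :
    PlT.act (g * h) T = PlT.act g (PlT.act h T) := by
  apply Subtype.ext
  simp only [PlT.act, isRefl_mul, dihPerm_mul]
  rcases g.isRefl <;> rcases h.isRefl <;>
    simp [PlaneTree.map_comp, ← PlaneTree.map_mirror, PlaneTree.mirror_mirror]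

end Dihedral

section PaDih

variable (k : Type u) [CommRing k] [Algebra ℚ k] (S : Type v)

/-- The objects of the category of which `PaDih` is a quotient: the union over `n ≥ 0` of
`PlT n × S ^ n`. -/
@[ext]
structure PaDihCover where
  /-- The number of leaves. -/
  n : ℕ
  /-- The tree. -/
  tree : PlT n
  /-- The labels. -/
  label : Fin n → S

instance : MulAction DihInf (PaDihCover S) where
  smul g X := ⟨X.n, X.tree.act g, fun i => X.label ((dihPerm X.n g)⁻¹ i)⟩
  one_smul X := PaDihCover.ext rfl (heq_of_eq (PlT.one_act X.tree)) (heq_of_eq (by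
    funext i
    exact congrArg X.label rfl))
  mul_smul g h X := PaDihCover.ext rfl (heq_of_eq (PlT.mul_act g h X.tree)) (heq_of_eq (by
    funext i
    refine congrArg X.label ?_
    rw [dihPerm_mul, mul_inv_rev]
    rfl))

/-- A copy of the set `PaDihCover S`, depending on the base ring `k`. -/
def PaDihTilde (_k : Type u) (S : Type v) : Type v := PaDihCover S

namespace PaDihTilde

/-- The morphisms from `(t, s)` to `(t', s')`: the set `exp (p̂_n) ⋊ {f ∈ S_n | s' ∘ f = s}` if `s`
and `s'` have the same length `n`, and the empty set otherwise. -/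
instance : Category.{u} (PaDihTilde k S) where
  Hom X Y := DecHom (expPFamily k) (PaDihCover.label X) (PaDihCover.label Y)
  id X := DecHom.one (PaDihCover.label X)
  comp f g := DecHom.mul g f
  id_comp f := DecHom.mul_one f
  comp_id f := DecHom.one_mul f
  assoc f g h := (DecHom.mul_assoc h g f).symm

instance : MulAction DihInf (PaDihTilde k S) := inferInstanceAs (MulAction DihInf (PaDihCover S))

variable {S}

/-- The isomorphism `i g X` from `X` to `g • X`, given by the image of `g` under the composite
map from the infinite dihedral group to `S_n` and to `exp (p̂_n) ⋊ S_n`. -/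
def dihHom (g : DihInf) (X : PaDihTilde k S) : X ⟶ g • X where
  elt := 1
  perm := dihPerm (PaDihCover.n X) g
  comm i := congrArg (PaDihCover.label X) (Equiv.symm_apply_apply (dihPerm _ g) i)

/-- All the morphisms are invertible. -/
def isoMk {X Y : PaDihTilde k S} (f : X ⟶ Y) : X ≅ Y where
  hom := f
  inv := DecHom.inv f
  hom_inv_id := DecHom.inv_mul f
  inv_hom_id := DecHom.mul_inv f

variable (S)

lemma eqToHom_perm_val {X Y : PaDihTilde k S} (h : X = Y) (i : Fin (PaDihCover.n X)) :
    (DecHom.perm (eqToHom h) i : ℕ) = i := by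
  subst h; rfl

lemma eqToHom_elt {X Y : PaDihTilde k S} (h : X = Y) : DecHom.elt (eqToHom h) = 1 := by
  subst h; rfl

/-- The action of the infinite dihedral group. -/
def dihAction : CatAction DihInf (PaDihTilde k S) where
  i g X := isoMk k (dihHom k g X)
  i_mul g h X := by
    have e := (mul_smul g h X).symm
    refine DecHom.ext ?_ (Equiv.ext fun i => Fin.ext ?_)
    · change 1 = (DecHom.elt (eqToHom e) * (expPFamily k).relabel _ 1) *
        (expPFamily k).relabel _ 1
      rw [eqToHom_elt, map_one, map_one, _root_.mul_one, _root_.mul_one]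
    · change _ = (DecHom.perm (eqToHom e) (dihPerm _ g (dihPerm _ h i)) : ℕ)
      rw [eqToHom_perm_val]
      change (dihPerm _ (g * h) i : ℕ) = _
      rw [dihPerm_mul]
      rfl

end PaDihTilde

/-- The category `PaDih`, quotient of the category with objects `PlT n × S ^ n` by the infinite
dihedral group. -/
abbrev PaDih : Type v := (PaDihTilde.dihAction k S).QuotCat

end PaDih

/-! ## The half-balanced structure and the contraction of `PaCD` -/

namespace PaWord

variable {S : Type v}

lemma leaves_length (X : PaWord S) : X.leaves.length = X.len :=
  induct rfl (fun _ => rfl)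
    (fun X Y hX hY => by rw [leaves_mul, List.length_append, hX, hY, len_mul]) X

lemma ofFn_magmaLetters (x : FreeMagma S) : List.ofFn (magmaLetters x) = magmaLeaves x := by
  induction x with
  | ih1 s => rfl
  | ih2 x y hx hy => exact (List.ofFn_fin_append _ _).trans (congrArg₂ _ hx hy)

lemma ofFn_letters (X : PaWord S) : List.ofFn X.letters = X.leaves := by
  induction X using WithOne.recOneCoe with
  | one => rfl
  | coe x => exact ofFn_magmaLetters x

lemma len_mirror (X : PaWord S) : X.mirror.len = X.len := by
  rw [← leaves_length, leaves_mirror, List.length_reverse, leaves_length]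

/-- The reversal, from positions in `X` to positions in the mirror image of `X`. -/
def revPerm (X : PaWord S) : Fin X.len ≃ Fin X.mirror.len :=
  Fin.revPerm.trans (finCongr X.len_mirror.symm)

lemma letters_revPerm (X : PaWord S) (i : Fin X.len) :
    X.mirror.letters (X.revPerm i) = X.letters i := by
  have key : ∀ (Y : PaWord S) (j : Fin Y.len) (h : (j : ℕ) < Y.leaves.length),
      Y.letters j = Y.leaves[(j : ℕ)] := by
    intro Y j h
    simp [← ofFn_letters]
  have hi := i.2
  rw [key _ _ (by rw [leaves_length]; exact (X.revPerm i).2), key _ _ (by rwa [leaves_length])]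
  simp only [leaves_mirror, List.getElem_reverse, leaves_length]
  congr 1
  simp only [revPerm, Equiv.trans_apply, Fin.revPerm_apply, finCongr_apply, Fin.val_cast,
    Fin.val_rev]
  omega

end PaWord

namespace PaCD

/-- The conjugate of a morphism by the reversals of the order of the letters. -/
def starHom {k : Type u} [CommRing k] [Algebra ℚ k] {S : Type v} {X Y : PaWord S} (f : Hm k X Y) :
    Hm k X.mirror Y.mirror where
  elt := (expTFamily k).relabel Y.revPerm f.elt
  perm := X.revPerm.symm.trans (f.perm.trans Y.revPerm)
  comm i := by
    rw [Equiv.trans_apply, Equiv.trans_apply, PaWord.letters_revPerm, f.comm,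
      ← PaWord.letters_revPerm, Equiv.apply_symm_apply]

variable {k : Type u} [CommRing k] [Algebra ℚ k] (A : Associator k) (S : Type v)

/-- The involution `*` of `PaCD`: words are replaced by their mirror images, and morphisms are
conjugated by the permutations reversing the order of the letters. -/
def star : PaCD A S ⥤ PaCD A S where
  obj X := PaWord.mirror (L := S) X
  map f := starHom f
  map_id X := DecHom.ext (map_one _)
    (Equiv.ext fun i => Equiv.apply_symm_apply (PaWord.revPerm (S := S) X) i)
  map_comp {X Y Z} f g := by
    have key : ∀ {X Y Z : PaWord S} (f : Hm k X Y) (g : Hm k Y Z),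
        starHom (DecHom.mul g f) = DecHom.mul (starHom g) (starHom f) := by
      intro X Y Z f g
      refine DecHom.ext ?_ (Equiv.ext fun i => by simp [starHom, DecHom.mul])
      refine (map_mul _ _ _).trans (congrArg₂ _ rfl ?_)
      refine ((expTFamily k).relabel_trans _ _ _).symm.trans
        (Eq.trans ?_ ((expTFamily k).relabel_trans _ _ _))
      congr 2
      ext j : 1
      simp [starHom]
    exact key f g

/-- The half-twist of a nonempty word, defined by the identities of letters, and by
`a_{X ⊗ Y} = (a_Y ⊗ a_X) β_{X, Y}`. -/
def magmaHalfTwist : (x : FreeMagma S) →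
    ((show PaCD A S from (x : PaWord S)) ≅ (star A S).obj (show PaCD A S from (x : PaWord S)))
  | .of s => Iso.refl (show PaCD A S from ((FreeMagma.of s : FreeMagma S) : PaWord S))
  | .mul x y =>
    β_ (show PaCD A S from (x : PaWord S)) (show PaCD A S from (y : PaWord S)) ≪≫
      MonoidalCategory.tensorIso (magmaHalfTwist y) (magmaHalfTwist x)

/-- The half-twist `a_X : X ≅ X*`: the identity if `X` is empty or a letter, and
`a_{X ⊗ Y} = (a_Y ⊗ a_X) β_{X, Y}`. This is the image in `PaCD` of the half-twist in the category
of parenthesized braids. -/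
def halfTwist (X : PaCD A S) : X ≅ (star A S).obj X :=
  WithOne.recOneCoe
    (motive := fun X : PaWord S => (show PaCD A S from X) ≅ (star A S).obj (show PaCD A S from X))
    (Iso.refl (show PaCD A S from (1 : PaWord S))) (magmaHalfTwist A S) X

/-- The involution and the half-twists of `PaCD`. -/
def halfBalance : HalfBalanceData (PaCD A S) := ⟨star A S, halfTwist A S⟩

/-- The functor from `PaCD` to the category of which `PaDih` is a quotient, induced by the maps
from parenthesized words to planar trees and by the projections `t_n → p_n`. -/
def toTilde : PaCD A S ⥤ PaDihTilde k S where
  obj X := PaDihCover.mk (PaWord.len (S := S) X) (PlT.ofWord (S := S) X) (PaWord.letters (S := S) X)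
  map f := { elt := expProj k _ (DecHom.elt f), perm := DecHom.perm f, comm := DecHom.comm f }
  map_id _ := DecHom.ext (map_one _) rfl
  map_comp _ _ := DecHom.ext ((map_mul (expProj k _) _ _).trans
    (congrArg₂ _ rfl (expProj_relabel _ _).symm)) rfl

/-- The functor from `PaCD` to `PaDih`. -/
def contraction : PaCD A S ⥤ PaDih k S := toTilde A S ⋙ (PaDihTilde.dihAction k S).quotFunctor

end PaCD

end

/-! The half-twist has a closed form. Let T_n be the sum of t_ij over all ordered pairs of indices.
The infinitesimal braid relations make T_n central in t_n, and it is invariant under S_n. Sorting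
the pairs of positions of X ⊗ Y according to the factors they meet gives T = T_X + T_Y + 2·(mixed
terms), and the three summands commute. Hence exp(μ T_n / 4) times the order-reversing permutation
satisfies the recursion a_{X ⊗ Y} = (a_Y ⊗ a_X) β_{X,Y}, so it is a_X (`twistHom_mul`,
`halfTwist_hom`). Naturality of a is then centrality and invariance of T_n, and (a_X)* = a_{X*} is
invariance. That * respects the braiding comes from the symmetry of t_12; that it inverts the
associativity constraint is the duality Φ(B, A) = Φ(A, B)⁻¹.

A morphism becomes an identity in the quotient category once its group element dies in exp(p̂_n),
its permutation comes from an element g of the dihedral group, and g carries the source tree to the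
target tree (`contraction_map_eq`). This is applied three times. For a_X, the element T_n is a sum
of defining relations of p_n, and only the reversal s remains. For (θ_Y ⊗ id) β_{X,Y}, the exponent
is μ/2 times the sum of the relations of p_n attached to the positions of Y, and the permutation is
the rotation r^|Y|; the trees differ by a move of the root.

For the associativity constraint, adding the relations of p_n attached to the positions of the
middle block shows that the two arguments of Φ and the internal sum T_Y add up to zero. Since T_Y
commutes with the first argument, the two arguments commute in p_n (`proj_lie_blocks₃`). An
associator is trivial on commuting arguments (`Associator.subst_eq_one`): then Φ(x, y) = Φ(x, 0)
Φ(0, y), and the pentagon, pushed along t_12 ↦ x with all other generators sent to 0, reads Φ(x, 0)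
= Φ(x, 0)². -/

noncomputable section

open CategoryTheory MonoidalCategory

set_option linter.unusedSectionVars false

attribute [local instance 100] LieRing.ofAssociativeRing

/-! ## Exponentials of commuting elements -/

section LinePart

variable {k : Type u} [CommRing k] {L : Type v} [LieRing L] [LieAlgebra k L]

/-- The Lie algebra morphism from the abelian Lie algebra `k` which takes `1` to `x`. -/
def lineHom (x : L) : k →ₗ⁅k⁆ L :=
  { LinearMap.toSpanSingleton k L x with
    map_lie' := fun {c d} => by
      change (⁅c, d⁆ : k) • x = ⁅c • x, d • x⁆
      rw [smul_lie, lie_smul, lie_self, smul_zero, smul_zero,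
        LieRing.of_associative_ring_bracket, mul_comm, sub_self, zero_smul] }

lemma lineHom_apply (x : L) (c : k) : lineHom x c = c • x := rfl

lemma freeLie_lift_single_left (x : L) :
    FreeLieAlgebra.lift k ![x, 0] = (lineHom x).comp (FreeLieAlgebra.lift k ![(1 : k), 0]) := by
  apply FreeLieAlgebra.hom_ext
  intro i
  rw [LieHom.comp_apply, FreeLieAlgebra.lift_of_apply, FreeLieAlgebra.lift_of_apply, lineHom_apply]
  fin_cases i <;> simp

lemma freeLie_lift_single_right (y : L) :
    FreeLieAlgebra.lift k ![0, y] = (lineHom y).comp (FreeLieAlgebra.lift k ![(0 : k), 1]) := by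
  apply FreeLieAlgebra.hom_ext
  intro i
  rw [LieHom.comp_apply, FreeLieAlgebra.lift_of_apply, FreeLieAlgebra.lift_of_apply, lineHom_apply]
  fin_cases i <;> simp

/-- Each lift factors through the abelian Lie algebra `k`, so the two images lie on the lines
spanned by `x` and by `y`. -/
lemma freeLie_lift_commute {x y : L} (h : ⁅x, y⁆ = 0) (a b : FreeLieAlgebra k (Fin 2)) :
    ⁅FreeLieAlgebra.lift k ![x, 0] a, FreeLieAlgebra.lift k ![0, y] b⁆ = 0 := by
  rw [freeLie_lift_single_left, freeLie_lift_single_right, LieHom.comp_apply, LieHom.comp_apply,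
    lineHom_apply, lineHom_apply, smul_lie, lie_smul, h, smul_zero, smul_zero]

/-- The sum of two Lie algebra morphisms whose images commute. -/
def LieHom.addOfCommute {L' : Type w} [LieRing L'] [LieAlgebra k L'] (f g : L →ₗ⁅k⁆ L')
    (h : ∀ x y, ⁅f x, g y⁆ = 0) : L →ₗ⁅k⁆ L' :=
  { (f : L →ₗ[k] L') + (g : L →ₗ[k] L') with
    map_lie' := fun {x y} => by
      change f ⁅x, y⁆ + g ⁅x, y⁆ = ⁅f x + g x, f y + g y⁆
      have h' : ⁅g x, f y⁆ = 0 := by rw [← lie_skew, h, neg_zero]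
      rw [add_lie, lie_add, lie_add, h, h', LieHom.map_lie, LieHom.map_lie, add_zero, zero_add] }

end LinePart

/-! ### Exponentials of commuting elements and sums of commuting morphisms -/

namespace ExpGroup

variable {k : Type u} [CommRing k] [Algebra ℚ k] {L : Type v} [LieRing L] [LieAlgebra k L]
  {L' : Type w} [LieRing L'] [LieAlgebra k L']

lemma expUnit_add (N : ℕ) {x y : L} (h : ⁅x, y⁆ = 0) :
    TruncEnv.expUnit (k := k) N (x + y) = TruncEnv.expUnit N x * TruncEnv.expUnit N y := by
  apply Units.ext
  change IsNilpotent.exp (TruncEnv.ι N (x + y)) =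
    IsNilpotent.exp (TruncEnv.ι N x) * IsNilpotent.exp (TruncEnv.ι N y)
  rw [← IsNilpotent.exp_add_of_commute (commute_expUnit N h) (TruncEnv.isNilpotent_ι N _)
    (TruncEnv.isNilpotent_ι N _), TruncEnv.ι, map_add, map_add]
  rfl

lemma exp_add {x y : L} (h : ⁅x, y⁆ = 0) : exp (k := k) (x + y) = exp x * exp y :=
  ext_val fun N => expUnit_add N h

/-- The exponential of a central element is central. -/
lemma exp_central {x : L} (h : ∀ y : L, ⁅x, y⁆ = 0) (g : ExpGroup k L) :
    exp x * g = g * exp x := by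
  -- The line through `x` commutes with the image of the identity morphism, so `commute_map` applies
  -- to the exponential of `1 : k` and to an arbitrary `g`.
  have e := commute_map (lineHom x) (LieHom.id : L →ₗ⁅k⁆ L)
    (fun c y => by rw [lineHom_apply, smul_lie, LieHom.id_apply, h, smul_zero]) (exp (1 : k)) g
  rwa [map_id, map_exp, lineHom_apply, one_smul] at e

/-- At each truncation both sides are multiplicative, the right one because the two images commute.
It is therefore enough to compare them on exponentials, where the identity is exp (u + v) = exp u *
exp v for commuting `u`, `v`. -/
lemma map_addOfCommute (f g : L →ₗ⁅k⁆ L') (h : ∀ x y, ⁅f x, g y⁆ = 0) (a : ExpGroup k L) :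
    map (LieHom.addOfCommute f g h) a = map f a * map g a := by
  refine ext_val fun N => ?_
  change TruncEnv.unitsMap _ N (a.1 N) =
    TruncEnv.unitsMap f N (a.1 N) * TruncEnv.unitsMap g N (a.1 N)
  -- Commutation is only available on the subgroup generated by exponentials, hence the double
  -- induction on closure membership.
  have comm : ∀ {b c : (TruncEnv k L N)ˣ},
      b ∈ Subgroup.closure (Set.range (TruncEnv.expUnit (k := k) (L := L) N)) →
      c ∈ Subgroup.closure (Set.range (TruncEnv.expUnit (k := k) (L := L) N)) →
      Commute (TruncEnv.unitsMap f N b) (TruncEnv.unitsMap g N c) := by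
    intro b c hb hc
    induction hb using Subgroup.closure_induction with
    | mem b hb =>
      obtain ⟨x, rfl⟩ := hb
      induction hc using Subgroup.closure_induction with
      | mem c hc =>
        obtain ⟨y, rfl⟩ := hc
        rw [TruncEnv.map_expUnit, TruncEnv.map_expUnit, Commute, SemiconjBy,
          ← expUnit_add N (h x y), ← expUnit_add N (by rw [← lie_skew, h, neg_zero]), add_comm]
      | one => rw [map_one]; exact Commute.one_right _
      | mul u v _ _ hu hv => rw [map_mul]; exact hu.mul_right hv
      | inv u _ hu => rw [map_inv]; exact hu.inv_right
    | one => rw [map_one]; exact Commute.one_left _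
    | mul u v _ _ hu hv => rw [map_mul]; exact hu.mul_left hv
    | inv u _ hu => rw [map_inv]; exact hu.inv_left
  refine Subgroup.closure_induction (p := fun u _ => TruncEnv.unitsMap _ N u =
    TruncEnv.unitsMap f N u * TruncEnv.unitsMap g N u) ?_ ?_ ?_ ?_ (a.2.1 N)
  · rintro _ ⟨x, rfl⟩
    rw [TruncEnv.map_expUnit, TruncEnv.map_expUnit, TruncEnv.map_expUnit, ← expUnit_add N (h x x)]
    rfl
  · rw [map_one, map_one, map_one, mul_one]
  · intro u v hu hv eu ev
    rw [map_mul, map_mul, map_mul, eu, ev]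
    exact Commute.mul_mul_mul_comm (comm hv hu).symm _ _
  · intro u hu eu
    rw [map_inv, map_inv, map_inv, eu, mul_inv_rev]
    exact ((comm hu hu).inv_inv).symm

end ExpGroup

/-! ### Associators evaluated on commuting elements -/

section SubstCommute

variable {k : Type u} [CommRing k] [Algebra ℚ k] {L : Type v} [LieRing L] [LieAlgebra k L]

/-- The morphism A ↦ x, B ↦ y is the sum of A ↦ x, B ↦ 0 and A ↦ 0, B ↦ y, whose images commute;
`ExpGroup.map_addOfCommute` turns this sum into a product. -/
lemma subst_eq_mul (Φ : ExpGroup k (FreeLieAlgebra k (Fin 2))) {x y : L} (h : ⁅x, y⁆ = 0) :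
    subst Φ x y = subst Φ x 0 * subst Φ 0 y := by
  rw [subst, subst, subst, ← ExpGroup.map_addOfCommute _ _ (freeLie_lift_commute h)]
  congr 1
  congr 1
  apply FreeLieAlgebra.hom_ext
  intro i
  change _ = FreeLieAlgebra.lift k ![x, 0] _ + FreeLieAlgebra.lift k ![0, y] _
  rw [FreeLieAlgebra.lift_of_apply, FreeLieAlgebra.lift_of_apply, FreeLieAlgebra.lift_of_apply]
  fin_cases i <;> simp

/-- The morphism from `t_4` which takes `t_12` to `x` and the other generators to `0`. -/
def dkSingle (x : L) : DK k (Fin 4) →ₗ⁅k⁆ L :=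
  lieLift _ (FreeLieAlgebra.lift k fun p =>
    if p.1 = (0, 1) ∨ p.1 = (1, 0) then x else 0) (by
    -- Every generator goes to `x` or to `0`, so all brackets of generators die; the symmetry
    -- relation holds because the condition on the pair is symmetric.
    intro z hz
    induction hz with
    | symm i j h =>
      rw [map_sub, FreeLieAlgebra.lift_of_apply, FreeLieAlgebra.lift_of_apply, sub_eq_zero]
      refine if_congr ?_ rfl rfl
      simp only [Prod.mk.injEq]
      tauto
    | three i j l hij hil hjl =>
      rw [LieHom.map_lie, map_add, FreeLieAlgebra.lift_of_apply, FreeLieAlgebra.lift_of_apply,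
        FreeLieAlgebra.lift_of_apply, lie_add]
      split_ifs <;> simp
    | four i j l m hij hlm hil him hjl hjm =>
      rw [LieHom.map_lie, FreeLieAlgebra.lift_of_apply, FreeLieAlgebra.lift_of_apply]
      split_ifs <;> simp)

lemma dkSingle_t (x : L) {i j : Fin 4} (h : i ≠ j) :
    dkSingle x (DK.t k i j) = if (i, j) = (0, 1) ∨ (i, j) = (1, 0) then x else 0 := by
  rw [DK.t_of_ne h, dkSingle, lieLift_mk, FreeLieAlgebra.lift_of_apply]

namespace Associator

variable (A : Associator k)

/-- Under `dkSingle x` the pentagon collapses to Φ(x, 0) = Φ(x, 0) Φ(x, 0), all other factors being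
Φ(0, 0) = 1. -/
lemma subst_left_zero (x : L) : subst A.Φ x 0 = 1 := by
  have h := congrArg (ExpGroup.map (dkSingle x)) A.pentagon
  simp only [map_mul, map_subst, map_add] at h
  rw [dkSingle_t x (by decide), dkSingle_t x (by decide), dkSingle_t x (by decide),
    dkSingle_t x (by decide), dkSingle_t x (by decide)] at h
  simpa [subst_zero] using h

/-- The image of `Φ` is trivial if `A` and `B` are mapped to commuting elements. -/
lemma subst_eq_one {x y : L} (h : ⁅x, y⁆ = 0) : subst A.Φ x y = 1 := by
  -- Duality rewrites Φ(0, y) as Φ(y, 0)⁻¹, so that `subst_left_zero` covers both factors.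
  rw [subst_eq_mul _ h, subst_swap A y 0, subst_left_zero, subst_left_zero, inv_one, mul_one]

end Associator

end SubstCommute

/-! ## The sum of all the generators -/

namespace DK

variable {k : Type u} [CommRing k] {ι J : Type} [DecidableEq ι] [DecidableEq J] [Fintype ι]
  [Fintype J]

variable (k J) in
/-- The central element `∑ t i j`, where `i` and `j` run over all indices. -/
def total : DK k J := ∑ i, ∑ j, t k i j

/-- For each γ the sum t_γα + t_γβ commutes with t_αβ, and so does every generator with both indices
outside {α, β}; the terms of `total` group into such pieces. -/
lemma t_lie_total (α β : J) : ⁅t k α β, total k J⁆ = 0 := by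
  by_cases hne : α = β
  · rw [hne, t_self, zero_lie]
  -- For γ = α or γ = β one term is the convention t_γγ = 0 and the other is the bracket of t_αβ
  -- with itself.
  have key : ∀ γ, ⁅t k α β, t k γ α⁆ + ⁅t k α β, t k γ β⁆ = 0 := by
    intro γ
    by_cases hα : γ = α
    · rw [hα, t_self, lie_zero, lie_self, zero_add]
    by_cases hβ : γ = β
    · rw [hβ, t_self, lie_zero, t_symm α β, lie_self, zero_add]
    rw [← lie_add, t_symm α γ, t_symm β γ]
    exact t_three hne (Ne.symm hα) (Ne.symm hβ)
  -- Summing over the second index outermost, the columns α and β cancel against each other row by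
  -- row, while in any other column the rows α and β cancel.
  rw [total, Finset.sum_comm, lie_sum, Fintype.sum_eq_add α β hne]
  · rw [lie_sum, lie_sum, ← Finset.sum_add_distrib]
    exact Finset.sum_eq_zero fun γ _ => key γ
  · rintro δ ⟨hα, hβ⟩
    rw [lie_sum, Fintype.sum_eq_add α β hne]
    · rw [t_symm δ α, t_symm δ β]
      exact key δ
    · rintro γ ⟨hγα, hγβ⟩
      exact t_four (Ne.symm hγα) (Ne.symm hα) (Ne.symm hγβ) (Ne.symm hβ)

lemma total_lie (x : DK k J) : ⁅total k J, x⁆ = 0 := by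
  refine mem_of_gen (commSubalgebra (total k J) LieHom.id) (fun i j => ?_) x
  change ⁅total k J, t k i j⁆ = 0
  rw [← lie_skew, t_lie_total, neg_zero]

/-- The effect of `x ↦ x ^ (I_i)` on generators, if each `I_i` is a singleton `{f i}`. -/
lemma cable_t_of_section (φ : J → Option ι) (f : ι → J) (h : ∀ a i, φ a = some i ↔ a = f i)
    (i j : ι) : cable k φ (t k i j) = t k (f i) (f j) := by
  by_cases hij : i = j
  · rw [hij, t_self, t_self, map_zero]
  · have hs : ∀ l, (Finset.univ.filter fun a => φ a = some l) = {f l} := by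
      intro l
      ext a
      simp [h]
    rw [cable_t _ hij, cableGen, hs, hs, Finset.sum_singleton, Finset.sum_singleton]

lemma cable_total_of_section (φ : J → Option ι) (f : ι → J) (h : ∀ a i, φ a = some i ↔ a = f i) :
    cable k φ (total k ι) = ∑ i, ∑ j, t k (f i) (f j) := by
  rw [total, map_sum]
  refine Finset.sum_congr rfl fun i _ => ?_
  rw [map_sum]
  exact Finset.sum_congr rfl fun j _ => cable_t_of_section φ f h i j

/-- This invariance under relabelling, together with centrality, is what makes the half-twist
natural. -/
lemma cable_total_equiv (e : ι ≃ J) :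
    cable k (fun a => some (e.symm a)) (total k ι) = total k J := by
  rw [cable_total_of_section _ e fun a i => by rw [Option.some_inj, Equiv.symm_apply_eq], total,
    ← Equiv.sum_comp e]
  exact Finset.sum_congr rfl fun i _ => Equiv.sum_comp e fun j => t k (e i) j

end DK

/-! ## The half-twist -/

namespace PaWord

variable {k : Type u} [CommRing k] {S : Type v}

lemma sum_pos {M : Type w} [AddCommMonoid M] (X Y : PaWord S) (f : Fin (X * Y).len → M) :
    ∑ a, f a = ∑ i, f (pos X Y (Sum.inl i)) + ∑ i, f (pos X Y (Sum.inr i)) := by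
  rw [← Equiv.sum_comp (pos X Y), Fintype.sum_sum_type]

lemma cableGen_blocks₂ (X Y : PaWord S) : DK.cableGen k (blocks₂ X Y) 0 1 =
    ∑ i, ∑ j, DK.t k (pos X Y (Sum.inl i)) (pos X Y (Sum.inr j)) := by
  simp [DK.cableGen, Finset.sum_filter, sum_pos]

lemma leftPart_eq_some (X Y : PaWord S) (a : Fin (X * Y).len) (i : Fin X.len) :
    leftPart X Y a = some i ↔ a = pos X Y (Sum.inl i) :=
  pos_cases (P := fun a => leftPart X Y a = some i ↔ a = pos X Y (Sum.inl i))
    (by simp) (by simp) a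

lemma rightPart_eq_some (X Y : PaWord S) (a : Fin (X * Y).len) (i : Fin Y.len) :
    rightPart X Y a = some i ↔ a = pos X Y (Sum.inr i) :=
  pos_cases (P := fun a => rightPart X Y a = some i ↔ a = pos X Y (Sum.inr i))
    (by simp) (by simp) a

lemma cable_leftPart_total (X Y : PaWord S) : DK.cable k (leftPart X Y) (DK.total k _) =
    ∑ i, ∑ j, DK.t k (pos X Y (Sum.inl i)) (pos X Y (Sum.inl j)) :=
  DK.cable_total_of_section _ (fun i => pos X Y (Sum.inl i)) (leftPart_eq_some X Y)

lemma cable_rightPart_total (X Y : PaWord S) : DK.cable k (rightPart X Y) (DK.total k _) =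
    ∑ i, ∑ j, DK.t k (pos X Y (Sum.inr i)) (pos X Y (Sum.inr j)) :=
  DK.cable_total_of_section _ (fun i => pos X Y (Sum.inr i)) (rightPart_eq_some X Y)

/-- An ordered pair of positions lies inside X, inside Y, or is mixed. A mixed pair occurs in both
orders with the same generator, whence the factor 2. -/
lemma total_mul (X Y : PaWord S) : DK.total k (Fin (X * Y).len) =
    DK.cable k (leftPart X Y) (DK.total k _) + DK.cable k (rightPart X Y) (DK.total k _) +
      (2 : k) • DK.cableGen k (blocks₂ X Y) 0 1 := by
  rw [cable_leftPart_total, cable_rightPart_total, cableGen_blocks₂, two_smul, DK.total, sum_pos]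
  simp only [sum_pos, Finset.sum_add_distrib]
  have h : ∑ i, ∑ j, DK.t k (pos X Y (Sum.inr i)) (pos X Y (Sum.inl j)) =
      ∑ i, ∑ j, DK.t k (pos X Y (Sum.inl i)) (pos X Y (Sum.inr j)) := by
    rw [Finset.sum_comm]
    exact Finset.sum_congr rfl fun _ _ => Finset.sum_congr rfl fun _ _ => DK.t_symm _ _
  rw [h]
  abel

/-- Here and in the next two lemmas, the second partial map is constant on the domain of definition
of the first one, which is the criterion of `DK.lie_cable`. -/
lemma lie_leftPart_rightPart (X Y : PaWord S) (a : DK k (Fin X.len)) (b : DK k (Fin Y.len)) :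
    ⁅DK.cable k (leftPart X Y) a, DK.cable k (rightPart X Y) b⁆ = 0 :=
  DK.lie_cable (pos_cases (fun i => pos_cases (by simp) (by simp))
    fun i => pos_cases (by simp) (by simp)) a b

lemma lie_leftPart_blocks₂ (X Y : PaWord S) (a : DK k (Fin X.len)) (b : DK k (Fin 2)) :
    ⁅DK.cable k (leftPart X Y) a, DK.cable k (blocks₂ X Y) b⁆ = 0 :=
  DK.lie_cable (pos_cases (fun i => pos_cases (by simp) (by simp))
    fun i => pos_cases (by simp) (by simp)) a b

lemma lie_rightPart_blocks₂ (X Y : PaWord S) (a : DK k (Fin Y.len)) (b : DK k (Fin 2)) :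
    ⁅DK.cable k (rightPart X Y) a, DK.cable k (blocks₂ X Y) b⁆ = 0 :=
  DK.lie_cable (pos_cases (fun i => pos_cases (by simp) (by simp))
    fun i => pos_cases (by simp) (by simp)) a b

end PaWord

/-! ### The central twist exp(μ T_n / 4) -/

namespace Associator

open PaWord

variable {k : Type u} [CommRing k] [Algebra ℚ k] (A : Associator k)

/-- The exponential of `μ / 2` times the sum of all `t i j`, `i < j`, written as a symmetric sum. -/
def twist (n : ℕ) : ExpT k (Fin n) := ExpGroup.exp (((1 / 4 : ℚ) • A.μ) • DK.total k (Fin n))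

lemma twist_central (n : ℕ) (g : ExpT k (Fin n)) : A.twist n * g = g * A.twist n :=
  ExpGroup.exp_central (fun y => by rw [smul_lie, DK.total_lie, smul_zero]) g

lemma relabel_twist {m n : ℕ} (e : Fin m ≃ Fin n) :
    ins (fun a => some (e.symm a)) (A.twist m) = A.twist n := by
  rw [twist, ins, ExpGroup.map_exp, map_smul, DK.cable_total_equiv, twist]

/-- The coefficient 1/4 of `twist` is matched with the 1/2 of `halfBraid`, since `total` counts
every unordered pair twice. -/
lemma quarter_add_quarter : (1 / 4 : ℚ) • A.μ * 2 = (1 / 2 : ℚ) • A.μ := by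
  rw [mul_two, ← add_smul]
  norm_num

/-- This is the exponential of `total_mul`: the three summands commute pairwise, and the doubled
mixed terms yield exactly the element of the braiding. -/
lemma twist_mul {S : Type v} (X Y : PaWord S) : A.twist (X * Y).len =
    ins (leftPart X Y) (A.twist X.len) * ins (rightPart X Y) (A.twist Y.len) *
      ins (blocks₂ X Y) A.halfBraid := by
  have e : DK.cableGen k (blocks₂ X Y) 0 1 = DK.cable k (blocks₂ X Y) (DK.t k 0 1) :=
    (DK.cable_t _ (by decide)).symm
  rw [twist, twist, twist, ins_halfBraid, ins, ins, ExpGroup.map_exp, ExpGroup.map_exp, total_mul,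
    smul_add, smul_smul, quarter_add_quarter, ExpGroup.exp_add, smul_add, ExpGroup.exp_add,
    map_smul, map_smul]
  · rw [smul_lie, lie_smul, lie_leftPart_rightPart, smul_zero, smul_zero]
  · rw [e, smul_lie, lie_smul, add_lie, lie_leftPart_blocks₂, lie_rightPart_blocks₂, add_zero,
      smul_zero, smul_zero]

lemma twist_eq_one_of_le_one {n : ℕ} (h : n ≤ 1) : A.twist n = 1 := by
  have : Subsingleton (Fin n) := Fin.subsingleton_iff_le_one.2 h
  have e : DK.total k (Fin n) = 0 :=
    Finset.sum_eq_zero fun i _ => Finset.sum_eq_zero fun j _ => by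
      rw [Subsingleton.elim i j, DK.t_self]
  rw [twist, e, smul_zero, ExpGroup.exp_zero]

end Associator

/-! ### Reversal of the positions in a product -/

namespace PaWord

variable {S : Type v}

lemma revPerm_val (X : PaWord S) (i : Fin X.len) : (X.revPerm i : ℕ) = X.len - (i + 1) := by
  simp [revPerm]

/-- The identity permutation between the positions of two equal words. -/
def congrPerm {X Y : PaWord S} (h : X = Y) : Fin X.len ≃ Fin Y.len := finCongr (congrArg len h)

lemma congrPerm_val {X Y : PaWord S} (h : X = Y) (i : Fin X.len) : (congrPerm h i : ℕ) = i := rfl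

/-- Reversal exchanges the two blocks and reverses each of them. The transport `congrPerm` appears
because `mirror_mul` is only a propositional equality of words. -/
lemma revPerm_pos_inl (X Y : PaWord S) (i : Fin X.len) :
    congrPerm (mirror_mul X Y) (revPerm (X * Y) (pos X Y (Sum.inl i))) =
      pos _ _ (Sum.inr (X.revPerm i)) := by
  apply Fin.ext
  rw [congrPerm_val, revPerm_val, pos_inl_val, pos_inr_val, revPerm_val, len_mul, len_mirror]
  have := i.2
  omega

lemma revPerm_pos_inr (X Y : PaWord S) (i : Fin Y.len) :
    congrPerm (mirror_mul X Y) (revPerm (X * Y) (pos X Y (Sum.inr i))) =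
      pos _ _ (Sum.inl (Y.revPerm i)) := by
  apply Fin.ext
  rw [congrPerm_val, revPerm_val, pos_inr_val, pos_inl_val, revPerm_val, len_mul]
  have := i.2
  omega

@[simp] lemma revPerm_symm_pos_inl (X Y : PaWord S) (i : Fin Y.mirror.len) :
    (revPerm (X * Y)).symm ((congrPerm (mirror_mul X Y)).symm (pos _ _ (Sum.inl i))) =
      pos X Y (Sum.inr (Y.revPerm.symm i)) := by
  rw [Equiv.symm_apply_eq, Equiv.symm_apply_eq, revPerm_pos_inr, Equiv.apply_symm_apply]

@[simp] lemma revPerm_symm_pos_inr (X Y : PaWord S) (i : Fin X.mirror.len) :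
    (revPerm (X * Y)).symm ((congrPerm (mirror_mul X Y)).symm (pos _ _ (Sum.inr i))) =
      pos X Y (Sum.inl (X.revPerm.symm i)) := by
  rw [Equiv.symm_apply_eq, Equiv.symm_apply_eq, revPerm_pos_inl, Equiv.apply_symm_apply]

end PaWord

/-! ### The recursion satisfied by the closed form -/

namespace PaCD

open PaWord

variable {k : Type u} [CommRing k] [Algebra ℚ k] (A : Associator k) {S : Type v}

/-- The half-twist, in closed form. -/
def twistHom (X : PaWord S) : Hm k X X.mirror where
  elt := A.twist X.mirror.len
  perm := X.revPerm
  comm := letters_revPerm X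

/-- The identity morphism between equal words. -/
def congrHom (k : Type u) [CommRing k] [Algebra ℚ k] {X Y : PaWord S} (h : X = Y) : Hm k X Y where
  elt := 1
  perm := congrPerm h
  comm _ := letters_congr h.symm _ _ rfl

/-- On permutations, reversing X * Y is swapping the blocks and then reversing each one. On group
elements, the identity is `Associator.twist_mul`, the twists being unchanged by relabelling. -/
lemma twistHom_mul (X Y : PaWord S) :
    DecHom.mul (congrHom k (mirror_mul X Y)) (twistHom A (X * Y)) =
      DecHom.mul (tensor (twistHom A Y) (twistHom A X)) (braid A X Y) := by
  refine hm_ext (pos_cases (fun i => ?_) fun i => ?_) ?_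
  · simpa [DecHom.mul, congrHom, twistHom, tensor, braid] using revPerm_pos_inl X Y i
  · simpa [DecHom.mul, congrHom, twistHom, tensor, braid] using revPerm_pos_inr X Y i
  · simp only [DecHom.mul, congrHom, twistHom, tensor, braid, _root_.one_mul, ins_ins]
    rw [Associator.relabel_twist, Associator.twist_mul]
    refine congrArg₂ _ rfl ?_
    -- The relabelled braiding labels the two blocks in the opposite order; the symmetry t_12 = t_21
    -- makes up for this.
    conv_lhs => rw [← A.halfBraid_swap, ins_ins]
    exact ins_congr (pos_cases (by simp) (by simp)) _

end PaCD

/-! ## The half-balanced structure of `PaCD` -/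

namespace PaCD

open PaWord

variable {k : Type u} [CommRing k] [Algebra ℚ k] (A : Associator k) {S : Type v}

lemma eqToHom_eq_congrHom {X Y : PaCD A S} (h : X = Y) :
    (eqToHom h : X ⟶ Y) = congrHom (S := S) k h := by
  subst h
  rfl

/-- The axioms are stated with `eqToHom`, which does not compute. With `congrHom` in its place they
can be checked separately on group elements and on permutations. -/
lemma eq_conj_eqToHom {X Y X' Y' : PaCD A S} {f : X ⟶ Y} {g : X' ⟶ Y'} {hX : X = X'}
    {hY : Y = Y'} (h : DecHom.mul (congrHom (S := S) k hY) f =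
      DecHom.mul g (congrHom (S := S) k hX)) :
    f = eqToHom hX ≫ g ≫ eqToHom hY.symm := by
  subst hX hY
  rw [eqToHom_refl, eqToHom_refl, Category.id_comp, Category.comp_id]
  exact (DecHom.one_mul f).symm.trans (h.trans (DecHom.mul_one g))

lemma twistHom_one : twistHom A (1 : PaWord S) = DecHom.one (1 : PaWord S).letters :=
  hm_ext (fun i => i.elim0) (A.twist_eq_one_of_le_one (Nat.zero_le 1))

lemma twistHom_letter (s : S) :
    twistHom A (WithOne.coe (FreeMagma.of s) : PaWord S) =
      DecHom.one (PaWord.letters (WithOne.coe (FreeMagma.of s) : PaWord S)) :=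
  hm_ext (fun _ => Subsingleton.elim (α := Fin 1) _ _) (A.twist_eq_one_of_le_one (le_refl 1))

lemma magmaHalfTwist_hom (x : FreeMagma S) :
    (magmaHalfTwist A S x).hom = twistHom A (x : PaWord S) := by
  induction x with
  | ih1 s => exact (twistHom_letter A s).symm
  | ih2 x y hx hy =>
    have h := twistHom_mul A (x : PaWord S) (y : PaWord S)
    -- For nonempty words the mirror image of a product is the reversed product by definition, so
    -- the transport in `h` is the identity morphism.
    refine Eq.trans ?_ (h.symm.trans (DecHom.one_mul _))
    exact congrArg₂ (fun f g => DecHom.mul (tensor f g) (braid A (x : PaWord S) (y : PaWord S)))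
      hy hx

lemma halfTwist_hom (X : PaCD A S) : (halfTwist A S X).hom = twistHom (S := S) A X := by
  induction X using WithOne.recOneCoe with
  | one => exact (twistHom_one A).symm
  | coe x => exact magmaHalfTwist_hom A x

/-- Centrality moves the twist past the element of `f`, and invariance under relabelling moves it
past the permutation; what is left is conjugation by the reversals. -/
lemma twist_natural {X Y : PaWord S} (f : Hm k X Y) :
    DecHom.mul (twistHom A Y) f = DecHom.mul (starHom f) (twistHom A X) := by
  refine hm_ext (fun i => by simp [DecHom.mul, twistHom, starHom]) ?_
  refine (A.twist_central _ _).trans (congrArg₂ _ rfl ?_)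
  exact (A.relabel_twist _).symm

lemma starHom_twistHom (X : PaWord S) : starHom (twistHom A X) = twistHom A X.mirror := by
  refine hm_ext (fun i => by simp [twistHom, starHom]) ?_
  exact A.relabel_twist _

lemma congrPerm_revPerm_revPerm (X : PaWord S) (i : Fin X.len) :
    congrPerm (mirror_mirror X) (X.mirror.revPerm (X.revPerm i)) = i := by
  apply Fin.ext
  rw [congrPerm_val, revPerm_val, revPerm_val, len_mirror]
  have := i.2
  omega

lemma revPerm_symm_revPerm_symm (X : PaWord S) (i : Fin X.len) :
    X.revPerm.symm (X.mirror.revPerm.symm ((congrPerm (mirror_mirror X)).symm i)) = i := by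
  rw [Equiv.symm_apply_eq, Equiv.symm_apply_eq, Equiv.symm_apply_eq, congrPerm_revPerm_revPerm]

lemma starHom_starHom {X Y : PaWord S} (f : Hm k X Y) :
    DecHom.mul (congrHom k (mirror_mirror Y)) (starHom (starHom f)) =
      DecHom.mul f (congrHom k (mirror_mirror X)) := by
  refine hm_ext (fun i => ?_) ?_
  · obtain ⟨i, rfl⟩ := X.mirror.revPerm.surjective i
    obtain ⟨i, rfl⟩ := X.revPerm.surjective i
    simp [DecHom.mul, congrHom, starHom, congrPerm_revPerm_revPerm]
  · simp only [DecHom.mul, congrHom, starHom, ins_ins, map_one, _root_.one_mul, _root_.mul_one]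
    refine (ins_congr (fun i => ?_) _).trans (ins_some _)
    exact congrArg some (revPerm_symm_revPerm_symm Y i)

lemma rev_cases {X Y : PaWord S} {P : Fin (X * Y).mirror.len → Prop}
    (hl : ∀ i, P (revPerm (X * Y) (pos X Y (Sum.inl i))))
    (hr : ∀ i, P (revPerm (X * Y) (pos X Y (Sum.inr i)))) (a : Fin (X * Y).mirror.len) : P a := by
  obtain ⟨a, rfl⟩ := (revPerm (X * Y)).surjective a
  exact pos_cases (P := fun a => P (revPerm (X * Y) a)) hl hr a

-- The involution on tensor products, braidings and associativity constraints

attribute [local simp] revPerm_pos_inl revPerm_pos_inr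

lemma starHom_tensor {X X' Y Y' : PaWord S} (f : Hm k X X') (g : Hm k Y Y') :
    DecHom.mul (congrHom k (mirror_mul X' Y')) (starHom (tensor f g)) =
      DecHom.mul (tensor (starHom g) (starHom f)) (congrHom k (mirror_mul X Y)) := by
  refine hm_ext (rev_cases (by simp [DecHom.mul, congrHom, starHom, tensor])
    (by simp [DecHom.mul, congrHom, starHom, tensor])) ?_
  simp only [DecHom.mul, congrHom, starHom, tensor, map_one, _root_.one_mul, _root_.mul_one,
    ins_ins]
  refine (_root_.map_mul (ins _) _ _).trans ?_
  simp only [ins_ins]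
  -- After reversal the factor coming from `f` sits on the right block but is still written first;
  -- the two factors commute, so they can be exchanged.
  have h := left_right_comm (X := Y'.mirror) (Y := X'.mirror)
    (ins (fun a => some (Y'.revPerm.symm a)) g.elt) (ins (fun a => some (X'.revPerm.symm a)) f.elt)
  simp only [ins_ins] at h
  rw [h]
  refine congrArg₂ _ ?_ ?_
  · exact ins_congr (pos_cases (by simp) (by simp)) _
  · exact ins_congr (pos_cases (by simp) (by simp)) _

lemma starHom_braid (X Y : PaWord S) :
    DecHom.mul (congrHom k (mirror_mul Y X)) (starHom (braid A X Y)) =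
      DecHom.mul (braid A Y.mirror X.mirror) (congrHom k (mirror_mul X Y)) := by
  refine hm_ext (rev_cases (by simp [DecHom.mul, congrHom, starHom, braid])
    (by simp [DecHom.mul, congrHom, starHom, braid])) ?_
  simp only [DecHom.mul, congrHom, starHom, braid, ins_ins, map_one, _root_.one_mul,
    _root_.mul_one]
  -- Reversal exchanges the two blocks, which does not affect exp(μ t_12 / 2).
  conv_lhs => rw [← A.halfBraid_swap, ins_ins]
  exact ins_congr (pos_cases (by simp) (by simp)) _

lemma mirror_mul_mul (X Y Z : PaWord S) :
    (X * Y * Z).mirror = Z.mirror * (Y.mirror * X.mirror) := by rw [mirror_mul, mirror_mul]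

lemma mirror_mul_mul' (X Y Z : PaWord S) :
    (X * (Y * Z)).mirror = Z.mirror * Y.mirror * X.mirror := by rw [mirror_mul, mirror_mul]

lemma revPerm_mul_mul_1 (X Y Z : PaWord S) (i : Fin X.len) :
    congrPerm (mirror_mul_mul' X Y Z) (revPerm (X * (Y * Z)) (pos _ _ (Sum.inl i))) =
      pos _ _ (Sum.inr (X.revPerm i)) := by
  apply Fin.ext
  simp only [congrPerm_val, revPerm_val, pos_inl_val, pos_inr_val, len_mul, len_mirror]
  omega

lemma revPerm_mul_mul_2 (X Y Z : PaWord S) (i : Fin Y.len) :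
    congrPerm (mirror_mul_mul' X Y Z)
        (revPerm (X * (Y * Z)) (pos _ _ (Sum.inr (pos _ _ (Sum.inl i))))) =
      pos _ _ (Sum.inl (pos _ _ (Sum.inr (Y.revPerm i)))) := by
  apply Fin.ext
  simp only [congrPerm_val, revPerm_val, pos_inl_val, pos_inr_val, len_mul, len_mirror]
  omega

lemma revPerm_mul_mul_3 (X Y Z : PaWord S) (i : Fin Z.len) :
    congrPerm (mirror_mul_mul' X Y Z)
        (revPerm (X * (Y * Z)) (pos _ _ (Sum.inr (pos _ _ (Sum.inr i))))) =
      pos _ _ (Sum.inl (pos _ _ (Sum.inl (Z.revPerm i)))) := by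
  apply Fin.ext
  simp only [congrPerm_val, revPerm_val, pos_inl_val, pos_inr_val, len_mul]
  omega

lemma revPerm_symm_mul_mul_1 (X Y Z : PaWord S) (i : Fin X.mirror.len) :
    (revPerm (X * (Y * Z))).symm ((congrPerm (mirror_mul_mul' X Y Z)).symm (pos _ _ (Sum.inr i))) =
      pos _ _ (Sum.inl (X.revPerm.symm i)) := by
  rw [Equiv.symm_apply_eq, Equiv.symm_apply_eq, revPerm_mul_mul_1, Equiv.apply_symm_apply]

lemma revPerm_symm_mul_mul_2 (X Y Z : PaWord S) (i : Fin Y.mirror.len) :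
    (revPerm (X * (Y * Z))).symm ((congrPerm (mirror_mul_mul' X Y Z)).symm
        (pos _ _ (Sum.inl (pos _ _ (Sum.inr i))))) =
      pos _ _ (Sum.inr (pos _ _ (Sum.inl (Y.revPerm.symm i)))) := by
  rw [Equiv.symm_apply_eq, Equiv.symm_apply_eq, revPerm_mul_mul_2, Equiv.apply_symm_apply]

lemma revPerm_symm_mul_mul_3 (X Y Z : PaWord S) (i : Fin Z.mirror.len) :
    (revPerm (X * (Y * Z))).symm ((congrPerm (mirror_mul_mul' X Y Z)).symm
        (pos _ _ (Sum.inl (pos _ _ (Sum.inl i))))) =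
      pos _ _ (Sum.inr (pos _ _ (Sum.inr (Z.revPerm.symm i)))) := by
  rw [Equiv.symm_apply_eq, Equiv.symm_apply_eq, revPerm_mul_mul_3, Equiv.apply_symm_apply]

lemma assocPerm_val (X Y Z : PaWord S) (i : Fin (X * Y * Z).len) :
    (assocPerm X Y Z i : ℕ) = i := rfl

lemma assocPerm_symm_val (X Y Z : PaWord S) (i : Fin (X * (Y * Z)).len) :
    ((assocPerm X Y Z).symm i : ℕ) = i := rfl

/-- Reversing three consecutive blocks replaces Φ(t_12, t_23) by Φ(t_23, t_12), which is the inverse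
by duality (`Associator.phi_reverse`). -/
lemma starHom_assoc (X Y Z : PaWord S) :
    DecHom.mul (congrHom k (mirror_mul_mul' X Y Z)) (starHom (assoc A X Y Z)) =
      DecHom.mul (DecHom.inv (assoc A Z.mirror Y.mirror X.mirror))
        (congrHom k (mirror_mul_mul X Y Z)) := by
  refine hm_ext (fun i => ?_) ?_
  · obtain ⟨i, rfl⟩ := (revPerm (X * Y * Z)).surjective i
    apply Fin.ext
    simp only [DecHom.mul, DecHom.inv, congrHom, starHom, assoc, Equiv.trans_apply,
      Equiv.symm_apply_apply, congrPerm_val, assocPerm_symm_val, revPerm_val, assocPerm_val,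
      len_mul]
    omega
  · simp only [DecHom.mul, DecHom.inv, congrHom, starHom, assoc, ins_ins, map_one,
      _root_.one_mul, _root_.mul_one]
    rw [← map_inv, ← A.phi_reverse, ins_ins, ins_ins]
    exact ins_congr (pos_cases₃' (by simp [revPerm_symm_mul_mul_3])
      (by simp [revPerm_symm_mul_mul_2]) (by simp [revPerm_symm_mul_mul_1])) _

variable (S)

/-- The mirror image and the half-twists are a half-balanced structure. -/
theorem isHalfBalanced : (halfBalance A S).IsHalfBalanced where
  star_star := CategoryTheory.Functor.ext (fun X => PaWord.mirror_mirror (L := S) X)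
    fun _ _ f => eq_conj_eqToHom A (starHom_starHom f)
  star_tensor X Y := PaWord.mirror_mul (L := S) X Y
  star_tensorHom f g := eq_conj_eqToHom A (starHom_tensor f g)
  star_a X := by
    refine (congrArg (star A S).map (halfTwist_hom A X)).trans ?_
    exact (starHom_twistHom A X).trans (halfTwist_hom A ((star A S).obj X)).symm
  star_braiding X Y := eq_conj_eqToHom A (starHom_braid A X Y)
  star_associator X Y Z := eq_conj_eqToHom A (starHom_assoc A X Y Z)
  a_natural {X Y} f := by
    refine (congrArg (f ≫ ·) (halfTwist_hom A Y)).trans ?_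
    exact (twist_natural A f).trans (congrArg (· ≫ (star A S).map f) (halfTwist_hom A X)).symm
  a_tensor X Y := by
    -- The trivial transport on the source only serves to give the recursion the shape required by
    -- `eq_conj_eqToHom`.
    have h : DecHom.mul (congrHom (S := S) k (PaWord.mirror_mul (L := S) X Y))
        (halfTwist A S (X ⊗ Y)).hom = DecHom.mul ((β_ X Y).hom ≫
          ((halfTwist A S Y).hom ⊗ₘ (halfTwist A S X).hom)) (congrHom (S := S) k rfl) := by
      rw [halfTwist_hom, halfTwist_hom, halfTwist_hom]
      exact (twistHom_mul A X Y).trans (DecHom.mul_one _).symm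
    refine (eq_conj_eqToHom A (hX := rfl) h).trans ?_
    exact (Category.id_comp _).trans (Category.assoc _ _ _)

end PaCD

/-! ## Planar trees and rotations -/

namespace PaWord

variable {L : Type v} {S : Type v}

lemma magmaMap_magmaReplace {M N : Type*} (x : FreeMagma L) (f : Fin x.length → M) (g : M → N) :
    magmaMap g (magmaReplace x f) = magmaReplace x (g ∘ f) := by
  induction x with
  | ih1 s => rfl
  | ih2 x y hx hy => exact congrArg₂ FreeMagma.mul (hx _) (hy _)

/-- Numberings of equal words carry labels in different types `Fin X.len` and `Fin Y.len`, so they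
are compared after this transport. -/
lemma number_map_congrPerm {X Y : PaWord S} (h : X = Y) :
    X.number.map (congrPerm h) = Y.number := by
  subst h
  exact map_id _

/-- The numbering of a product. -/
lemma number_mul (X Y : PaWord S) : (X * Y).number =
    X.number.map (fun i => pos X Y (Sum.inl i)) * Y.number.map (fun i => pos X Y (Sum.inr i)) := by
  induction X using WithOne.recOneCoe with
  | one =>
    -- When a factor is empty, the product is replaced by the other factor through the unit law, and
    -- its positions have to be transported accordingly.
    have e := number_map_congrPerm (MulOneClass.one_mul Y).symm
    rw [← e]
    refine Eq.trans ?_ (MulOneClass.one_mul _).symm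
    congr 1
    funext i
    exact Fin.ext (by rw [congrPerm_val, pos_inr_val]; exact (Nat.zero_add _).symm)
  | coe x =>
    induction Y using WithOne.recOneCoe with
    | one =>
      have e := number_map_congrPerm (MulOneClass.mul_one (x : PaWord S)).symm
      rw [← e]
      refine Eq.trans ?_ (MulOneClass.mul_one _).symm
      congr 1
    | coe y =>
      refine congrArg WithOne.coe (congrArg₂ FreeMagma.mul ?_ ?_)
      · exact (magmaMap_magmaReplace x id _).symm
      · exact (magmaMap_magmaReplace y id _).symm

/-- The numbering of the mirror image. -/
lemma number_mirror (X : PaWord S) : X.mirror.number = X.number.mirror.map X.revPerm :=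
  induct rfl (fun s => congrArg (fun i : Fin 1 => (WithOne.coe (FreeMagma.of i) : PaWord (Fin 1)))
      (Subsingleton.elim _ _))
    (fun X Y hX hY => by
      rw [← number_map_congrPerm (mirror_mul X Y).symm, number_mul, number_mul,
        mirror_mul (X.number.map _), map_mul, map_mul, hX, hY]
      simp only [← map_mirror, map_comp]
      refine congrArg₂ _ (congrArg₂ _ (funext fun i => ?_) rfl)
        (congrArg₂ _ (funext fun i => ?_) rfl)
      · exact (Equiv.symm_apply_eq (congrPerm (mirror_mul X Y))).2 (revPerm_pos_inr X Y i).symm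
      · exact (Equiv.symm_apply_eq (congrPerm (mirror_mul X Y))).2 (revPerm_pos_inl X Y i).symm) X

end PaWord

/-- Comparing trees and labels after relabelling along the equality of lengths avoids the
heterogeneous equalities of plain extensionality. -/
lemma PaDihCover.ext_cast {S : Type v} {P Q : PaDihCover S} (h : P.n = Q.n)
    (ht : P.tree.1.map (finCongr h) = Q.tree.1) (hl : ∀ i, P.label i = Q.label (finCongr h i)) :
    P = Q := by
  obtain ⟨n, T, l⟩ := P
  obtain ⟨m, T', l'⟩ := Q
  obtain rfl : n = m := h
  have e₁ : T = T' := Subtype.ext ((PlaneTree.map_id T.1).symm.trans ht)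
  have e₂ : l = l' := funext hl
  rw [e₁, e₂]

lemma finRotate_pow_val {n : ℕ} (m : ℕ) (i : Fin n) :
    ((finRotate n ^ m) i : ℕ) = (i + m) % n := by
  have : NeZero n := ⟨fun h => (h ▸ i).elim0⟩
  induction m with
  | zero => exact (Nat.mod_eq_of_lt i.2).symm
  | succ m ih =>
    rw [pow_succ', Equiv.Perm.mul_apply, finRotate_apply, Fin.val_add, ih, Fin.val_one',
      ← Nat.add_mod, Nat.add_assoc]

namespace PaDihTilde

variable (k : Type u) [CommRing k] [Algebra ℚ k] {S : Type v}

/-- A morphism given by an element of the dihedral group has a trivial image in `PaDih`. -/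
lemma quotFunctor_map_eq {X Y : PaDihTilde k S} (f : X ⟶ Y) (g : DihInf) (h : g • X = Y)
    (he : DecHom.elt f = 1)
    (hp : ∀ i, (DecHom.perm f i : ℕ) = dihPerm (PaDihCover.n X) g i) :
    (dihAction k S).quotFunctor.map f = eqToHom (((dihAction k S).quotFunctor_obj g X).trans
      (congrArg (dihAction k S).quotFunctor.obj h)) := by
  subst h
  have e : f = ((dihAction k S).i g X).hom :=
    DecHom.ext he (Equiv.ext fun i => Fin.ext (hp i))
  rw [e]
  exact (dihAction k S).quotFunctor_i g X

end PaDihTilde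

/-! ## The contraction of `PaCD` -/

namespace DK

variable {k : Type u} [CommRing k]

lemma proj_sum_t {n : ℕ} (i : Fin n) : SphDK.proj k n (∑ j, t k i j) = 0 :=
  (LieSubmodule.Quotient.mk_eq_zero _).2 (LieSubmodule.subset_lieSpan ⟨i, rfl⟩)

/-- The total is the sum of all the defining relations of p_n; consequently the half-twist keeps
only its permutation in exp(p̂_n) ⋊ S_n. -/
lemma proj_total (n : ℕ) : SphDK.proj k n (total k (Fin n)) = 0 := by
  rw [total, map_sum]
  exact Finset.sum_eq_zero fun i _ => proj_sum_t i

end DK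

/-! ### Defining relations of p_n summed over a block -/

namespace PaWord

variable {k : Type u} [CommRing k] {S : Type v}

/-- This is the sum of the relations of p_n attached to the positions of X: the other index runs
over X, giving the internal total, or over Y, giving the mixed terms. -/
lemma proj_left (X Y : PaWord S) : SphDK.proj k _
    (DK.cable k (leftPart X Y) (DK.total k _) + DK.cableGen k (blocks₂ X Y) 0 1) = 0 := by
  rw [cable_leftPart_total, cableGen_blocks₂, ← Finset.sum_add_distrib, map_sum]
  refine Finset.sum_eq_zero fun i _ => ?_
  rw [← sum_pos X Y (fun a => DK.t k (pos X Y (Sum.inl i)) a)]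
  exact DK.proj_sum_t _

/-- The partially defined map attached to the second of three consecutive blocks. -/
def midPart (X Y Z : PaWord S) (a : Fin (X * (Y * Z)).len) : Option (Fin Y.len) :=
  (rightPart X (Y * Z) a).bind (leftPart Y Z)

lemma midPart_eq_some (X Y Z : PaWord S) (a : Fin (X * (Y * Z)).len) (i : Fin Y.len) :
    midPart X Y Z a = some i ↔ a = pos _ _ (Sum.inr (pos _ _ (Sum.inl i))) :=
  PaCD.pos_cases₃ (P := fun a => midPart X Y Z a = some i ↔
    a = pos _ _ (Sum.inr (pos _ _ (Sum.inl i)))) (by simp [midPart]) (by simp [midPart])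
    (by simp [midPart]) a

/-- The relations attached to the positions of the middle block are added; the other index runs over
Y, over X or over Z, which accounts for the three terms. -/
lemma proj_mid (X Y Z : PaWord S) : SphDK.proj k _ (DK.cable k (midPart X Y Z) (DK.total k _) +
    (DK.cableGen k (blocks₃ X Y Z) 0 1 + DK.cableGen k (blocks₃ X Y Z) 1 2)) = 0 := by
  -- The mixed terms between X and Y are rewritten so that their first index lies in the middle
  -- block, as in the relations.
  rw [DK.cable_total_of_section _ _ (midPart_eq_some X Y Z), ← DK.cableGen_symm]
  have h : ∑ i, ∑ j, DK.t k (pos X (Y * Z) (Sum.inr (pos Y Z (Sum.inl i))))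
        (pos X (Y * Z) (Sum.inr (pos Y Z (Sum.inl j)))) +
      (DK.cableGen k (blocks₃ X Y Z) 1 0 + DK.cableGen k (blocks₃ X Y Z) 1 2) =
      ∑ i, ∑ a, DK.t k (pos X (Y * Z) (Sum.inr (pos Y Z (Sum.inl i)))) a := by
    simp [DK.cableGen, Finset.sum_filter, sum_pos, Finset.sum_add_distrib]
    abel
  rw [h, map_sum]
  exact Finset.sum_eq_zero fun i _ => DK.proj_sum_t _

/-- By `proj_mid` the second element is minus the sum of the first one and of the internal total of
the middle block. That total commutes with every cabling along `blocks₃`, because `blocks₃` is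
constant on the middle block. -/
lemma proj_lie_blocks₃ (X Y Z : PaWord S) :
    ⁅SphDK.proj k _ (DK.cableGen k (blocks₃ X Y Z) 0 1),
      SphDK.proj k _ (DK.cableGen k (blocks₃ X Y Z) 1 2)⁆ = 0 := by
  have h := proj_mid (k := k) X Y Z
  rw [map_add, map_add, ← add_assoc] at h
  rw [eq_neg_of_add_eq_zero_right h, lie_neg, lie_add, lie_self, add_zero, neg_eq_zero,
    ← lie_skew, neg_eq_zero, ← LieHom.map_lie,
    ← DK.cable_t (k := k) _ (show (0 : Fin 3) ≠ 1 by decide),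
    DK.lie_cable, map_zero]
  exact PaCD.pos_cases₃ (fun i => PaCD.pos_cases₃ (by simp [midPart]) (by simp [midPart])
    (by simp [midPart])) (fun i => PaCD.pos_cases₃ (by simp [midPart]) (by simp [midPart])
    (by simp [midPart])) (fun i => PaCD.pos_cases₃ (by simp [midPart]) (by simp [midPart])
    (by simp [midPart]))

end PaWord

/-! ### Unrooted trees and permutations for the swap and the associativity constraint -/

namespace PaWord

variable {S : Type v}

/-- Once relabelled, the two rooted trees are products of the same two subtrees in opposite orders,
which is one move of the root; the next lemma uses the other kind of move. -/
lemma unroot_number_swap (X Y : PaWord S) :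
    PlaneTree.unroot ((X * Y).number.map (swapPerm X Y)) = PlaneTree.unroot (Y * X).number := by
  have e₁ : ⇑(swapPerm X Y) ∘ (fun i => pos X Y (Sum.inl i)) = fun i => pos Y X (Sum.inr i) :=
    funext (swapPerm_inl X Y)
  have e₂ : ⇑(swapPerm X Y) ∘ (fun i => pos X Y (Sum.inr i)) = fun i => pos Y X (Sum.inl i) :=
    funext (swapPerm_inr X Y)
  rw [number_mul, number_mul, map_mul, map_comp, map_comp, e₁, e₂]
  exact Quot.sound (.swap _ _)

lemma unroot_number_assoc (X Y Z : PaWord S) :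
    PlaneTree.unroot ((X * Y * Z).number.map (assocPerm X Y Z)) =
      PlaneTree.unroot (X * (Y * Z)).number := by
  rw [number_mul (X * Y), number_mul X Y, number_mul X, number_mul Y Z]
  simp only [map_mul, map_comp]
  have e₁ : ⇑(assocPerm X Y Z) ∘ (fun i => pos (X * Y) Z (Sum.inl i)) ∘
      (fun i => pos X Y (Sum.inl i)) = fun i => pos _ _ (Sum.inl i) := funext (assocPerm_1 X Y Z)
  have e₂ : ⇑(assocPerm X Y Z) ∘ (fun i => pos (X * Y) Z (Sum.inl i)) ∘
      (fun i => pos X Y (Sum.inr i)) =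
        (fun i => pos X (Y * Z) (Sum.inr i)) ∘ fun i => pos Y Z (Sum.inl i) :=
    funext (assocPerm_2 X Y Z)
  have e₃ : ⇑(assocPerm X Y Z) ∘ (fun i => pos (X * Y) Z (Sum.inr i)) =
      (fun i => pos X (Y * Z) (Sum.inr i)) ∘ fun i => pos Y Z (Sum.inr i) :=
    funext (assocPerm_3 X Y Z)
  rw [e₁, e₂, e₃]
  exact Quot.sound (.shift _ _ _)

/-- Exchanging two consecutive blocks is the rotation by |Y|: positions of X move up by |Y| without
passing the end, and those of Y wrap around exactly once. -/
lemma swapPerm_val (X Y : PaWord S) (i : Fin (X * Y).len) :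
    (swapPerm X Y i : ℕ) = dihPerm (X * Y).len (.r (Y.len : ℤ)) i := by
  change _ = ((finRotate (X * Y).len ^ (Y.len : ℤ)) i : ℕ)
  rw [zpow_natCast, finRotate_pow_val]
  refine pos_cases (P := fun i => (swapPerm X Y i : ℕ) = (i + Y.len) % (X * Y).len)
    (fun i => ?_) (fun i => ?_) i
  · rw [swapPerm_inl, pos_inr_val, pos_inl_val, len_mul, Nat.mod_eq_of_lt (by omega), Nat.add_comm]
  · rw [swapPerm_inr, pos_inl_val, pos_inr_val, len_mul, Nat.add_right_comm, Nat.add_mod_left,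
      Nat.mod_eq_of_lt (by omega)]

end PaWord

/-! ### Images of the structure morphisms in the quotient category -/

namespace PaCD

open PaWord

variable {k : Type u} [CommRing k] [Algebra ℚ k] (A : Associator k) {S : Type v}

/-- Morphisms which are mapped to the identity in `PaDih`. -/
lemma contraction_map_eq {X Y : PaCD A S} (f : X ⟶ Y) (g : DihInf)
    (he : expProj k _ (DecHom.elt f) = 1)
    (hp : ∀ i, (DecHom.perm f i : ℕ) = dihPerm (PaWord.len (S := S) X) g i)
    (ht : PlaneTree.unroot ((if g.isRefl then (PaWord.number (L := S) X).mirror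
      else PaWord.number (L := S) X).map (DecHom.perm f)) =
        PlaneTree.unroot (PaWord.number (L := S) Y)) :
    ∃ h, (contraction A S).map f = eqToHom h := by
  have hn : PaWord.len (S := S) X = PaWord.len (S := S) Y :=
    Fin.equiv_iff_eq.1 ⟨DecHom.perm f⟩
  have hp' : ∀ i, finCongr hn (dihPerm (PaWord.len (S := S) X) g i) = DecHom.perm f i :=
    fun i => Fin.ext (hp i).symm
  have h : g • (toTilde A S).obj X = (toTilde A S).obj Y := by
    refine PaDihCover.ext_cast hn ?_ fun i => ?_
    · refine Eq.trans ?_ ht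
      rw [← funext hp']
      -- The reflection flag is made an arbitrary Boolean so that both kinds of dihedral elements
      -- reduce to functoriality of relabelling.
      have key : ∀ (b : Bool) (c : PaWord _),
          ((if b then (PlaneTree.unroot c).mirror else PlaneTree.unroot c).map
            (dihPerm (PaWord.len (S := S) X) g)).map (finCongr hn) =
          PlaneTree.unroot ((if b then c.mirror else c).map
            fun i => finCongr hn (dihPerm (PaWord.len (S := S) X) g i)) := by
        rintro (_ | _) c <;> exact PlaneTree.map_comp _ _ _
      exact key g.isRefl _
    · obtain ⟨i, rfl⟩ := (dihPerm (PaWord.len (S := S) X) g).surjective i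
      refine Eq.trans (congrArg (PaWord.letters (S := S) X) (Equiv.symm_apply_apply _ i)) ?_
      exact (DecHom.comm f i).symm.trans (congrArg (PaWord.letters (S := S) Y) (hp' i).symm)
  exact ⟨_, PaDihTilde.quotFunctor_map_eq k ((toTilde A S).map f) g h he hp⟩

lemma expProj_exp {n : ℕ} {x : DK k (Fin n)} (h : SphDK.proj k n x = 0) :
    expProj k n (ExpGroup.exp x) = 1 :=
  (ExpGroup.map_exp _ x).trans ((congrArg _ h).trans ExpGroup.exp_zero)

lemma expProj_twist (n : ℕ) : expProj k n (A.twist n) = 1 :=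
  expProj_exp (by rw [map_smul, DK.proj_total, smul_zero])

/-- The twist dies in exp(p̂_n), and the remaining reversal is the image of the generator s = `.sr
0`, which acts on trees by mirror image; `number_mirror` matches the trees. -/
lemma contraction_halfTwist (X : PaCD A S) :
    ∃ h, (contraction A S).map (halfTwist A S X).hom = eqToHom h := by
  rw [halfTwist_hom]
  refine contraction_map_eq A _ (.sr 0) ?_ (fun i => rfl) ?_
  · exact expProj_twist A _
  · exact congrArg PlaneTree.unroot (number_mirror (S := S) X).symm

/-- The permutation is that of the neutral element, and moving the root identifies the two trees.
The element vanishes because Φ is evaluated in p_n on commuting arguments. -/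
lemma contraction_associator (X Y Z : PaCD A S) :
    ∃ h, (contraction A S).map (α_ X Y Z).hom = eqToHom h := by
  refine contraction_map_eq A _ 1 ?_ (fun i => rfl) (unroot_number_assoc (S := S) X Y Z)
  change ExpGroup.map _ (ins (blocks₃ (S := S) X Y Z) A.phi) = 1
  rw [Associator.ins_phi, map_subst, A.subst_eq_one]
  exact proj_lie_blocks₃ (S := S) X Y Z

/-- The full twist, in closed form. -/
def fullTwistHom (X : PaWord S) : Hm k X X where
  elt := A.twist X.len * A.twist X.len
  perm := Equiv.refl _
  comm _ := rfl

lemma twistHom_twistHom (X : PaWord S) :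
    DecHom.mul (DecHom.mul (congrHom k (mirror_mirror X)) (twistHom A X.mirror)) (twistHom A X) =
      fullTwistHom A X := by
  refine hm_ext (congrPerm_revPerm_revPerm X) ?_
  refine congrArg₂ (· * ·) ?_ (A.relabel_twist _)
  exact (_root_.one_mul _).trans (A.relabel_twist _)

lemma balance_hom (X : PaCD A S) :
    (HalfBalanceData.balance (isHalfBalanced A S) X).hom = fullTwistHom (S := S) A X := by
  have h : (star A S).obj ((star A S).obj X) = X := PaWord.mirror_mirror (L := S) X
  have e : (HalfBalanceData.balance (isHalfBalanced A S) X).hom =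
      (halfTwist A S X).hom ≫ (halfTwist A S ((star A S).obj X)).hom ≫ eqToHom h := rfl
  rw [e, eqToHom_eq_congrHom, halfTwist_hom, halfTwist_hom]
  exact twistHom_twistHom (S := S) A X

/-- The full twist of Y contributes exp(μ/2 · total) and the braiding exp(μ/2 · mixed terms). The
two commute, and the combined exponent is a multiple of the element which `proj_left` kills. -/
lemma fullTwist_braid_elt (X Y : PaWord S) :
    (DecHom.mul (tensor (fullTwistHom A Y) (DecHom.one X.letters)) (braid A X Y)).elt =
      ExpGroup.exp (((1 / 2 : ℚ) • A.μ) •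
        (DK.cable k (leftPart Y X) (DK.total k _) + DK.cableGen k (blocks₂ Y X) 0 1)) := by
  have e : DK.cableGen k (blocks₂ Y X) 0 1 = DK.cable k (blocks₂ Y X) (DK.t k 0 1) :=
    (DK.cable_t _ (by decide)).symm
  have e' : A.twist Y.len * A.twist Y.len =
      ExpGroup.exp (((1 / 2 : ℚ) • A.μ) • DK.total k (Fin Y.len)) := by
    rw [Associator.twist, ← ExpGroup.exp_add (lie_self _), ← add_smul, ← mul_two,
      A.quarter_add_quarter]
  rw [smul_add, ExpGroup.exp_add, ← Associator.ins_halfBraid]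
  · simp only [DecHom.mul, tensor, fullTwistHom, DecHom.one, braid, map_one, _root_.mul_one,
      ins_ins, e']
    refine congrArg₂ _ ?_ ?_
    · rw [ins, ExpGroup.map_exp, map_smul]
    -- The braiding numbers the block of X first, whereas in the target Y * X the block of Y comes
    -- first; the symmetry of t_12 reconciles the two.
    · conv_lhs => rw [← A.halfBraid_swap, ins_ins]
      exact ins_congr (pos_cases (by simp) (by simp)) _
  · rw [e, smul_lie, lie_smul, lie_leftPart_blocks₂, smul_zero, smul_zero]

lemma expProj_fullTwist_braid (X Y : PaWord S) : expProj k _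
    (DecHom.mul (tensor (fullTwistHom A Y) (DecHom.one X.letters)) (braid A X Y)).elt = 1 := by
  rw [fullTwist_braid_elt]
  exact expProj_exp (by rw [map_smul, proj_left, smul_zero])

lemma fullTwist_braid_perm (X Y : PaWord S) :
    ⇑(DecHom.mul (tensor (fullTwistHom A Y) (DecHom.one X.letters)) (braid A X Y)).perm =
      swapPerm X Y :=
  funext (pos_cases (by simp [DecHom.mul, tensor, fullTwistHom, DecHom.one, braid])
    (by simp [DecHom.mul, tensor, fullTwistHom, DecHom.one, braid]))

/-- The full twist of Y is exactly the correction which completes the exponent of the braiding to a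
sum of relations of p_n; the permutation left over is the rotation r^|Y|. -/
lemma contraction_swap (X Y : PaCD A S) : ∃ h, (contraction A S).map ((β_ X Y).hom ≫
    ((HalfBalanceData.balance (isHalfBalanced A S) Y).hom ⊗ₘ 𝟙 X)) = eqToHom h := by
  rw [balance_hom]
  refine contraction_map_eq A _ (.r (PaWord.len (S := S) Y : ℤ)) (expProj_fullTwist_braid A _ _)
    (fun i => ?_) ?_
  · exact (congrArg Fin.val (congrFun (fullTwist_braid_perm A _ _) i)).trans
      (swapPerm_val (S := S) X Y i)
  · refine Eq.trans ?_ (unroot_number_swap (S := S) X Y)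
    exact congrArg (fun f => PlaneTree.unroot (PaWord.map f
      (PaWord.number (HMul.hMul (α := PaWord S) (β := PaWord S) X Y))))
      (fullTwist_braid_perm A _ _)

end PaCD

end

theorem mainTheorem9 {k : Type u} [CommRing k] [Algebra ℚ k] (A : Associator k) (S : Type v) :
    ∃ h : (PaCD.halfBalance A S).IsHalfBalanced,
      IsHalfBalancedContraction h (PaCD.contraction A S) :=
  ⟨PaCD.isHalfBalanced A S,
    -- Each existential statement provides the equality of objects together with the equality of
    -- morphisms lying over it.
    { obj_swap := fun X Y => (PaCD.contraction_swap A X Y).fst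
      map_swap := fun X Y => (PaCD.contraction_swap A X Y).snd
      obj_assoc := fun X Y Z => (PaCD.contraction_associator A X Y Z).fst
      map_assoc := fun X Y Z => (PaCD.contraction_associator A X Y Z).snd
      obj_star := fun X => (PaCD.contraction_halfTwist A X).fst
      map_a := fun X => (PaCD.contraction_halfTwist A X).snd }⟩
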